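/- Let $G$ be a topological group (for instance $G=\mathbb G(F)$ for a reductive algebraic group $\mathbb G$ over a non-archimedean local field $F$) and let $R$ be a ring. Let $X$ be a semi-simplicial set with a smooth $G$-action, i.e. a functor $X\colon \Delta_{\mathrm{inj}}^{op}\times BG\to \mathrm{Sets}$ such that the stabilizer $G_x$ of every simplex $x$ is open in $G$. Let $\int_G \mathrm{simp}(X)$ be its Grothendieck construction: the objects are the simplices of $X$, and a morphism $x\to y$ is a pair $(\partial,g)$ consisting of a face operator $\partial$ and an element $g\in G$ with $\partial(gx)=y$. Call a functor $M\colon\int_G\mathrm{simp}(X)\to\mathrm{Mod}(R)$ smooth if for every simplex $x$ the representation $M(x)$ of $G_x$ is smooth, i.e. the stabilizer of each $m\in M(x)$ is open in $G_x$. Let $\mathcal{MV}(X)$ be the derived $\infty$-category of the abelian category of smooth functors, and let $D(G)=\mathcal{MV}(*)$ be the derived $\infty$-category of smooth $G$-representations on $R$-modules. Here the derived $\infty$-category of an abelian category $\mathcal A$ is the $\infty$-categorical localization of the category of unbounded complexes in $\mathcal A$ at the quasi-isomorphisms. Restriction along $p\colon\int_G\mathrm{simp}(X)\to BG$, the functor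 induced by the $G$-map $X\to *$, is exact and induces a functor $p^*\colon D(G)\to\mathcal{MV}(X)$. Suppose that the underlying semi-simplicial set of $X$ is contractible, i.e. that, for the simplicial set $S$ freely generated by it, $S\to *$ is a weak homotopy equivalence. Then $p^*$ has a left adjoint $\alpha\colon\mathcal{MV}(X)\to D(G)$, and $\alpha$ is a left Bousfield localization, that is, its right adjoint $p^*\colon D(G)\to\mathcal{MV}(X)$ is fully faithful. -/

import Mathlib

open CategoryTheory Limits Topology

universe w u

/-! ### Infinity-categories: localizations and derived infinity-categories

Infinity-categories are quasi-categories. They are the objects of Mathlib's strict bicategory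
`SSet.QCat`, whose hom-categories are the homotopy categories of the functor quasi-categories. -/

namespace MayerVietoris

/-- The nerve of an ordinary category, as a quasi-category. -/
def nerveQCat (A : Type (u + 1)) [LargeCategory A] : SSet.QCat.{u + 1} :=
  ⟨nerve A, inferInstance⟩

/-- A functor of ordinary categories, as a map between the nerves. -/
def nerveQCatMap {A B : Type (u + 1)} [LargeCategory A] [LargeCategory B] (F : A ⥤ B) :
    nerveQCat A ⟶ nerveQCat B :=
  ObjectProperty.homMk (nerveMap F)

/-- `F : N(A) ⟶ E` inverts the class `W` of morphisms of `A`: for every `C × [1] ⥤ A` all of whose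
components `(c, 0) ⟶ (c, 1)` lie in `W`, the resulting `C`-indexed family of arrows of `E` extends
to a `C`-indexed family of coherent isomorphisms, that is, along `[1] ⥤ {0 ≅ 1}`. For the one-point
category `C` this says that every arrow in `W` is sent to an equivalence of `E`. The condition for
general `C` is equivalent to that for the point, because a natural transformation of functors of
quasi-categories is invertible as soon as all its components are equivalences. -/
def Inverts {A : Type (u + 1)} [LargeCategory A] (W : MorphismProperty A) {E : SSet.QCat.{u + 1}}
    (F : nerveQCat A ⟶ E) : Prop :=
  ∀ (C : Type (u + 1)) [LargeCategory C] (H : C × Fin (1 + 1) ⥤ A),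
    (∀ c : C, W (H.map ((𝟙 c, homOfLE (Fin.zero_le 1)) : (c, (0 : Fin (1 + 1))) ⟶ (c, 1)))) →
    ∃ K : nerveQCat (C × WalkingIso.{0}) ⟶ E,
      nerveQCatMap ((𝟭 C).prod (ComposableArrows.mk₁ WalkingIso.iso.{0}.hom)) ≫ K =
        nerveQCatMap H ≫ F

/-- `L : N(A) ⟶ D` exhibits the quasi-category `D` as the localization of the category `A` at `W`:
for every quasi-category `E`, restriction along `L` identifies functors `D ⟶ E` with the functors
`N(A) ⟶ E` that invert `W`. -/
structure IsInfinityLocalization {A : Type (u + 1)} [LargeCategory A] (W : MorphismProperty A)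
    {D : SSet.QCat.{u + 1}} (L : nerveQCat A ⟶ D) : Prop where
  inverts : Inverts W L
  full (E : SSet.QCat.{u + 1}) : (Bicategory.precomp E L).Full
  faithful (E : SSet.QCat.{u + 1}) : (Bicategory.precomp E L).Faithful
  exists_lift (E : SSet.QCat.{u + 1}) (F : nerveQCat A ⟶ E) :
    Inverts W F → ∃ F' : D ⟶ E, Nonempty (L ≫ F' ≅ F)

/-- A (model of the) derived infinity-category of an abelian category `A`: a quasi-category that is
the localization of the category of unbounded complexes in `A` at the quasi-isomorphisms. It is
unique up to equivalence of quasi-categories under the nerve of the category of complexes. -/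
structure DerivedInfinityCategory (A : Type (u + 1)) [LargeCategory A] [Abelian A] where
  /-- the underlying quasi-category -/
  obj : SSet.QCat.{u + 1}
  /-- the localization functor -/
  loc : nerveQCat (CochainComplex A ℤ) ⟶ obj
  isLocalization :
    IsInfinityLocalization (HomologicalComplex.quasiIso A (ComplexShape.up ℤ)) loc

/-- The functor `F'` of derived infinity-categories is induced by the (exact) functor `F` of abelian
categories, applied termwise to complexes. -/
def IsInducedBy {A B : Type (u + 1)} [LargeCategory A] [LargeCategory B] [Abelian A] [Abelian B]
    (DA : DerivedInfinityCategory A) (DB : DerivedInfinityCategory B)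
    (F : A ⥤ B) [F.PreservesZeroMorphisms] (F' : DA.obj ⟶ DB.obj) : Prop :=
  Nonempty (DA.loc ≫ F' ≅
    nerveQCatMap (F.mapHomologicalComplex (ComplexShape.up ℤ)) ≫ DB.loc)

/-- A functor of quasi-categories is fully faithful: postcomposition with it is a fully faithful
functor from `ho Fun(K, C)` to `ho Fun(K, D)` for every quasi-category `K`. -/
def IsFullyFaithful {C D : SSet.QCat.{u + 1}} (F : C ⟶ D) : Prop :=
  ∀ K : SSet.QCat.{u + 1}, (Bicategory.postcomp K F).Full ∧ (Bicategory.postcomp K F).Faithful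

/-- `α` is a left Bousfield localization with right adjoint `r`: `α` is left adjoint to `r`, in the
bicategory of quasi-categories, and `r` is fully faithful. -/
def IsLeftBousfieldLocalization {C D : SSet.QCat.{u + 1}} (α : C ⟶ D) (r : D ⟶ C) : Prop :=
  Nonempty (Bicategory.Adjunction α r) ∧ IsFullyFaithful r

/-! ### Smooth functors -/

section Smooth

variable (R : Type u) [Ring R] {G : Type u} [Group G] [TopologicalSpace G]
  {C : Type w} [Category.{u} C] (q : C ⥤ SingleObj G)

/-- Let `C` be a category over the one-object category `BG`. A functor `M : C ⥤ Mod R` is smooth if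
every element `m` of every value `M(c)` is fixed by all endomorphisms of `c` that lie over some
neighbourhood of `1` in `G`. If the endomorphisms of `c` form a subgroup `H` of `G`, this says that
`M(c)` is a smooth representation of `H`: all stabilizers of its elements are open in `H`. -/
def IsSmooth : ObjectProperty (C ⥤ ModuleCat.{u} R) := fun M ↦
  ∀ (c : C) (m : M.obj c), ∃ U ∈ 𝓝 (1 : G), ∀ f : c ⟶ c,
    (show G from q.map f) ∈ U → (M.map f).hom m = m

variable {R} in
lemma IsSmooth.of_injective {M N : C ⥤ ModuleCat.{u} R} (hN : IsSmooth R q N) (φ : M ⟶ N)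
    (hφ : ∀ c, Function.Injective (φ.app c).hom) : IsSmooth R q M := by
  intro c m
  obtain ⟨U, hU, h⟩ := hN c ((φ.app c).hom m)
  refine ⟨U, hU, fun f hf ↦ hφ c ?_⟩
  have := ConcreteCategory.congr_hom (φ.naturality f) m
  exact this.trans (h f hf)

variable {R} in
lemma IsSmooth.of_surjective {M N : C ⥤ ModuleCat.{u} R} (hM : IsSmooth R q M) (φ : M ⟶ N)
    (hφ : ∀ c, Function.Surjective (φ.app c).hom) : IsSmooth R q N := by
  intro c n
  obtain ⟨m, rfl⟩ := hφ c n
  obtain ⟨U, hU, h⟩ := hM c m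
  refine ⟨U, hU, fun f hf ↦ ?_⟩
  have := ConcreteCategory.congr_hom (φ.naturality f) m
  exact this.symm.trans (congrArg (φ.app c).hom (h f hf))

instance : (IsSmooth R q).IsClosedUnderSubobjects where
  prop_of_mono f _ hN := hN.of_injective q f fun _ ↦
    (ModuleCat.mono_iff_injective _).1 inferInstance

instance : (IsSmooth R q).IsClosedUnderQuotients where
  prop_of_epi f _ hM := hM.of_surjective q f fun _ ↦
    (ModuleCat.epi_iff_surjective _).1 inferInstance

instance : (IsSmooth R q).ContainsZero where
  exists_zero := ⟨(Functor.const C).obj (ModuleCat.of R PUnit), (Functor.isZero_iff _).2 fun _ ↦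
    ModuleCat.isZero_of_subsingleton (ModuleCat.of R PUnit), fun c m ↦ ⟨Set.univ, Filter.univ_mem, fun f _ ↦ by
    exact Subsingleton.elim (α := PUnit) _ _⟩⟩

instance : (IsSmooth R q).IsClosedUnderFiniteProducts where
  isClosedUnderLimitsOfShape J _ := ⟨by
    rintro M ⟨p⟩ c m
    choose U hU h using fun j : J ↦ p.prop_diag_obj ⟨j⟩ c ((p.π.app ⟨j⟩).app c |>.hom m)
    refine ⟨⋂ j, U j, Filter.iInter_mem.2 hU, fun f hf ↦ ?_⟩
    refine Concrete.isLimit_ext _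
      (isLimitOfPreserves ((evaluation C (ModuleCat.{u} R)).obj c) p.isLimit) _ _ ?_
    rintro ⟨j⟩
    have := ConcreteCategory.congr_hom ((p.π.app ⟨j⟩).naturality f) m
    exact this.trans (h j f (Set.mem_iInter.1 hf j))⟩

/-- The abelian category of smooth functors `C ⥤ Mod R`. -/
abbrev SmoothFunctor : Type (max w (u + 1)) := (IsSmooth R q).FullSubcategory

end Smooth

/-! ### Smooth representations, G-semi-simplicial sets, Mayer--Vietoris resolutions -/

section Group

variable (R : Type u) [Ring R] {G : Type u} [Group G] [TopologicalSpace G]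

variable (G) in
/-- The abelian category of smooth representations of `G` on (left) `R`-modules: functors
`V : BG ⥤ Mod R` such that every vector is fixed by a neighbourhood of `1`. -/
abbrev SmoothRep : Type (u + 1) := SmoothFunctor R (𝟭 (SingleObj G))

/-- A semi-simplicial set with an action of `G`. -/
abbrev GSemiSimplicialSet (G : Type u) [Group G] : Type (u + 1) :=
  SemiSimplexCategoryᵒᵖ × SingleObj G ⥤ Type u

variable (X : GSemiSimplicialSet G)

/-- The action of `G` on `X` is smooth: the stabilizers of all simplices are open. -/
def HasOpenStabilizers : Prop :=
  ∀ (n : SemiSimplexCategoryᵒᵖ) (x : X.obj (n, SingleObj.star G)),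
    IsOpen {g : G | X.map ((𝟙 n, g) : (n, SingleObj.star G) ⟶ (n, SingleObj.star G)) x = x}

/-- The equivariant category of simplices, the Grothendieck construction of
`X : Δ_inj^op × BG ⥤ Sets`: objects are the simplices of `X`, and morphisms `x ⟶ y` are the pairs of
a face operator `∂` and an element `g` of `G` with `∂(g x) = y`. -/
abbrev EquivSimplices : Type u := X.Elements

/-- The projection from the equivariant category of simplices to `BG`, induced by `X ⟶ *`. -/
def toBG : EquivSimplices X ⥤ SingleObj G :=
  CategoryOfElements.π X ⋙ CategoryTheory.Prod.snd _ _

/-- The abelian category of functors `M` from the equivariant category of simplices of `X` to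
`R`-modules such that for every simplex `x` the representation `M(x)` of the stabilizer `G_x` is
smooth. Its derived infinity-category is the infinity-category `MV(X)` of Mayer--Vietoris
resolutions on `X`. -/
abbrev SmoothCoefficients : Type (u + 1) := SmoothFunctor R (toBG X)

/-- Restriction of smooth representations of `G` along the projection to `BG`. -/
def restriction : SmoothRep R G ⥤ SmoothCoefficients R X :=
  (IsSmooth R (toBG X)).lift
    ((IsSmooth R (𝟭 (SingleObj G))).ι ⋙ (Functor.whiskeringLeft _ _ _).obj (toBG X))
    fun V c m ↦ by
      obtain ⟨U, hU, h⟩ := V.property ((toBG X).obj c) m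
      exact ⟨U, hU, fun f hf ↦ h ((toBG X).map f) hf⟩

instance : (restriction R X).PreservesZeroMorphisms where

end Group

/-! ### Contractibility -/

section Contractible

open Simplicial

/-- The underlying semi-simplicial set of a semi-simplicial set with `G`-action. -/
def underlying {G : Type u} [Group G] (X : GSemiSimplicialSet G) :
    SemiSimplexCategoryᵒᵖ ⥤ Type u :=
  Functor.prod' (𝟭 _) ((Functor.const _).obj (SingleObj.star G)) ⋙ X

/-- The simplicial set freely generated by a semi-simplicial set. -/
noncomputable def freeSSet (Y : SemiSimplexCategoryᵒᵖ ⥤ Type u) : SSet.{u} :=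
  SemiSimplexCategory.toSimplexCategory.op.lan.obj Y

/-- A semi-simplicial set `Y` is contractible if, for the simplicial set `S` that it generates, the
map `S ⟶ *` is a weak homotopy equivalence: for every Kan complex `K`, sending a vertex `k` of `K`
to the constant map with value `k` induces a bijection from the set of path components of `K` to the
set of homotopy classes of maps `S ⟶ K`. -/
def IsContractible (Y : SemiSimplexCategoryᵒᵖ ⥤ Type u) : Prop :=
  ∀ (K : SSet.{u}) [SSet.KanComplex K],
    (∀ f : freeSSet Y ⟶ K, ∃ k : K _⦋0⦌, Nonempty (SSet.Homotopy f (SSet.const k))) ∧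
    (∀ k l : K _⦋0⦌,
      Nonempty (SSet.Homotopy (SSet.const k : freeSSet Y ⟶ K) (SSet.const l)) →
        Nonempty (SSet.Edge k l))

end Contractible

end MayerVietoris

open CategoryTheory Limits Topology Opposite

/-! ### 2-morphisms of quasi-categories induced by natural transformations -/

section NaturalTransformations

open CategoryTheory Limits Topology Simplicial Opposite
namespace MayerVietoris
open SSet.Truncated

/-! The left adjoint is given by chains: a complex of coefficients `K` goes to the total complex of
the sums of the values `K(x)` over the simplices `x`, with `G` permuting the summands. Direct sums
of complexes, filtered by the dimension of the simplex, preserve quasi-isomorphisms, so nothing has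
to be derived (`quasiIso_totMap`); open stabilizers make the result smooth
(`isSmoothComplex_chainsObj`). Chains with values in a restricted complex `V` carry a strict
augmentation to `V`. For contractible `X` it is a quasi-isomorphism (`quasiIso_totAug_constAug`).
This is the counit, and an invertible counit makes the right adjoint fully faithful.

There is no evident strict unit, because a vertex of a simplex cannot be chosen compatibly with all
faces. Hence `K` is replaced by a bar resolution, whose value at `p` is the total complex over
chains `p ⟶ F 0 ⟶ ... ⟶ F n` of the values of `K` at the last simplex. Prepending `p` to a chain
contracts it onto `K(p)` (`quasiIso_resolutionAug`), and sending a chain to the sequence of the last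
vertices of its members maps it naturally to the chains (`barChain`). One triangle identity then
holds strictly (`smoothResolutionToChains_triangle`). In place of the other one, the chain functor
sends the map from the resolution to a quasi-isomorphism (`quasiIso_chainsMap_resolutionToChains`):
followed by the augmentation, it is homotopic to the map induced by the augmentation of the
resolution, and the homotopy joins a simplex with the last vertices of a chain above it.

The rest is formal. A natural transformation with components in `W` becomes invertible in the
localization (`isIso_natCell_of_inverts`). In any bicategory, one triangle identity, an invertible
counit and the invertibility of the unit whiskered with the left adjoint give an adjunction, since
the remaining zigzag is then an invertible idempotent (`exists_adjunction_of_localization`).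

Contractibility is only known through maps to Kan complexes. It is turned into algebra by a Kan
complex `normalizedSSet`, of Dold-Kan type, built from the integral chains of the semi-simplicial
set: a null-homotopy of the tautological map to it is a contraction of these chains
(`exists_contraction`). -/

/-- The maps of quasi-categories, as the 1-morphisms of the bicategory of quasi-categories. -/
abbrev QMap (X Y : SSet.QCat.{u}) : Type u :=
  @Quiver.Hom SSet.QCat.{u} SSet.QCat.bicategory.toCategoryStruct.toQuiver X Y

/-- The simplicial set of maps between two simplicial sets. -/
abbrev funSSet (X Y : SSet.{u}) : SSet.{u} := X.functorHom Y

/-- A map of simplicial sets as a vertex of the simplicial set of maps. -/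
abbrev funVertex {X Y : SSet.{u}} (f : X ⟶ Y) : (funSSet X Y) _⦋0⦌ := Functor.HomObj.ofNatTrans f

/-- The 2-morphism of quasi-categories given by an edge of the simplicial set of maps. -/
def cell {X Y : SSet.QCat.{u}} {f g : QMap X Y}
    (e : SSet.Edge (X := funSSet X.obj Y.obj) (funVertex f.hom) (funVertex g.hom)) : f ⟶ g :=
  CatEnrichedOrdinary.Hom.mk' (C := SSet.QCat.{u}) (HomotopyCategory.homMk e.toTruncated)

lemma nerveMap_mk₁ {A B : Type w} [Category.{u} A] [Category.{u} B] (F : A ⥤ B) {X Y : A}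
    (f : X ⟶ Y) :
    (nerveMap F).app (op ⦋1⦌) (ComposableArrows.mk₁ f : (nerve A) _⦋1⦌) =
      (ComposableArrows.mk₁ (F.map f) : (nerve B) _⦋1⦌) :=
  ComposableArrows.ext₁ rfl rfl ((Category.id_comp _).trans (Category.comp_id _)).symm

lemma cell_id {X Y : SSet.QCat.{u}} (f : QMap X Y) :
    cell (SSet.Edge.id (funVertex f.hom)) = 𝟙 f := by
  unfold cell
  erw [SSet.Edge.toTruncated_id, HomotopyCategory.homMk_id]
  rfl

lemma cell_comp {X Y : SSet.QCat.{u}} {f g h : QMap X Y}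
    {e : SSet.Edge (X := funSSet X.obj Y.obj) (funVertex f.hom) (funVertex g.hom)}
    {e' : SSet.Edge (X := funSSet X.obj Y.obj) (funVertex g.hom) (funVertex h.hom)}
    {e'' : SSet.Edge (X := funSSet X.obj Y.obj) (funVertex f.hom) (funVertex h.hom)}
    (c : SSet.Edge.CompStruct e e' e'') : cell e ≫ cell e' = cell e'' := by
  have := HomotopyCategory.homMk_comp_homMk c.toTruncated
  exact congrArg (CatEnrichedOrdinary.Hom.mk' (C := SSet.QCat.{u})) this

/-- The composition with a map of simplicial sets, on simplicial sets of maps. -/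
def precompFun {W X : SSet.{u}} (k : W ⟶ X) (Y : SSet.{u}) : funSSet X Y ⟶ funSSet W Y where
  app n := ↾fun a ↦ (Functor.HomObj.ofNatTrans k).comp a

/-- The postcomposition with a map of simplicial sets, on simplicial sets of maps. -/
def postcompFun {X Y : SSet.{u}} (W : SSet.{u}) (k : X ⟶ Y) : funSSet W X ⟶ funSSet W Y where
  app n := ↾fun a ↦ a.comp (Functor.HomObj.ofNatTrans k)

/-- Whiskering is the enriched composition applied to a pair of an identity and the class of `e`. In
the homotopy category of the product this pair is the class of a single edge, degenerate in one
factor, and the composition map sends that edge to the image of `e`. -/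
lemma whiskerLeft_cell {W X Y : SSet.QCat.{u}} (k : QMap W X) {f g : QMap X Y}
    (e : SSet.Edge (X := funSSet X.obj Y.obj) (funVertex f.hom) (funVertex g.hom)) :
    Bicategory.whiskerLeft k (cell e) =
      cell (f := k ≫ f) (g := k ≫ g) (e.map (precompFun k.hom Y.obj)) := by
  refine CatEnrichedOrdinary.Hom.ext _ _ ?_
  refine (Category.id_comp _).trans ((Category.comp_id _).trans ?_)
  have h1 := HomotopyCategory.BinaryProduct.inverse_map_mkHom_id_homMk
    (X := (SSet.truncation 2).obj (funSSet W.obj X.obj)) (funVertex k.hom) e.toTruncated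
  exact congrArg (fun z ↦ (SSet.hoFunctor.map
    (eComp SSet.{u} W.obj X.obj Y.obj)).toFunctor.map z) h1

lemma whiskerRight_cell {X Y Z : SSet.QCat.{u}} {f g : QMap X Y}
    (e : SSet.Edge (X := funSSet X.obj Y.obj) (funVertex f.hom) (funVertex g.hom))
    (k : QMap Y Z) :
    Bicategory.whiskerRight (cell e) k =
      cell (f := f ≫ k) (g := g ≫ k) (e.map (postcompFun X.obj k.hom)) := by
  refine CatEnrichedOrdinary.Hom.ext _ _ ?_
  refine (Category.id_comp _).trans ((Category.comp_id _).trans ?_)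
  have h1 := HomotopyCategory.BinaryProduct.inverse_map_mkHom_homMk_id
    (Y := (SSet.truncation 2).obj (funSSet Y.obj Z.obj)) e.toTruncated (funVertex k.hom)
  exact congrArg (fun z ↦ (SSet.hoFunctor.map
    (eComp SSet.{u} X.obj Y.obj Z.obj)).toFunctor.map z) h1

section

variable {A B C : Type (u + 1)} [LargeCategory A] [LargeCategory B] [LargeCategory C]

variable (A B) in
/-- The canonical map from the nerve of a functor category. -/
def nerveFun : nerve (A ⥤ B) ⟶ funSSet (nerve A) (nerve B) where
  app n := ↾fun σ ↦
    -- The pulled-back chain of functors is evaluated diagonally on the chain of objects `x`: its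
    -- `i`-th functor is applied to the `i`-th object.
    { app m φ := ↾fun x ↦ Functor.prod' x ((nerve (A ⥤ B)).map φ σ) ⋙ evaluationUncurried A B }

/-- The map of quasi-categories induced by a functor, as a 1-morphism. -/
abbrev nerveQMap (F : A ⥤ B) : QMap (nerveQCat A) (nerveQCat B) := nerveQCatMap F

lemma nerveFun_vertex (F : A ⥤ B) :
    (nerveFun A B).app (op ⦋0⦌) (nerveEquiv.symm F : (nerve (A ⥤ B)) _⦋0⦌) =
      funVertex (nerveQMap F).hom := by
  refine Functor.HomObj.ext ?_
  funext m φ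
  ext x
  exact CategoryTheory.Functor.hext (fun _ ↦ rfl) fun i j f ↦
    heq_of_eq (Category.comp_id (F.map ((x : ComposableArrows A _).map f)))

/-- The edge of the functor quasi-category given by a natural transformation. -/
def natEdge {F G : A ⥤ B} (τ : F ⟶ G) : SSet.Edge (X := funSSet (nerveQCat A).obj (nerveQCat B).obj)
    (funVertex (nerveQMap F).hom) (funVertex (nerveQMap G).hom) :=
  ((nerve.edgeMk τ).map (nerveFun A B)).ofEq (nerveFun_vertex F) (nerveFun_vertex G)

/-- The 2-morphism of quasi-categories induced by a natural transformation. -/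
def natCell {F G : A ⥤ B} (τ : F ⟶ G) : nerveQMap F ⟶ nerveQMap G :=
  cell (natEdge τ)

lemma natCell_id (F : A ⥤ B) : natCell (𝟙 F) = 𝟙 (nerveQMap F) := by
  rw [← cell_id]
  refine congrArg cell (SSet.Edge.ext ?_)
  have h := congrArg (fun v ↦ (funSSet (nerve A) (nerve B)).σ (0 : Fin 1) v) (nerveFun_vertex F)
  refine Eq.trans ?_ h
  refine Eq.trans ?_ (SSet.σ_naturality_apply (nerveFun A B) (0 : Fin 1)
    (nerveEquiv.symm F : (nerve (A ⥤ B)) _⦋0⦌)).symm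
  exact congrArg (fun z : SSet.Edge (X := nerve (A ⥤ B)) _ _ ↦
    (nerveFun A B).app (op ⦋1⦌) z.edge) (nerve.edgeMk_id F)

lemma natCell_comp {F G H : A ⥤ B} (τ : F ⟶ G) (σ : G ⟶ H) :
    natCell (τ ≫ σ) = natCell τ ≫ natCell σ := by
  obtain ⟨c⟩ := (nerve.nonempty_compStruct_iff τ σ (τ ≫ σ)).2 rfl
  let c' := c.map (nerveFun A B)
  exact (cell_comp (SSet.Edge.CompStruct.mk c'.simplex c'.d₂ c'.d₀ c'.d₁)).symm

lemma nerveFun_precomp (F : C ⥤ A) :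
    nerveFun A B ≫ precompFun (nerveMap F) (nerve B) =
      nerveMap ((Functor.whiskeringLeft C A B).obj F) ≫ nerveFun C B := by
  ext n σ m φ x
  exact CategoryTheory.Functor.hext (fun _ ↦ rfl) fun i j f ↦ HEq.rfl

lemma nerveFun_postcomp (F : A ⥤ B) :
    nerveFun C A ≫ postcompFun (nerve C) (nerveMap F) =
      nerveMap ((Functor.whiskeringRight C A B).obj F) ≫ nerveFun C B := by
  ext n σ m φ x
  exact CategoryTheory.Functor.hext (fun _ ↦ rfl) fun i j f ↦ heq_of_eq (F.map_comp _ _)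

lemma whiskerLeft_natCell (F : C ⥤ A) {G H : A ⥤ B} (τ : G ⟶ H) :
    Bicategory.whiskerLeft (nerveQMap F) (natCell τ) = natCell (Functor.whiskerLeft F τ) := by
  refine (whiskerLeft_cell _ _).trans ?_
  refine congrArg cell (SSet.Edge.ext ?_)
  refine (congrArg (fun k ↦ k.app (op ⦋1⦌) (ComposableArrows.mk₁ τ)) (nerveFun_precomp F)).trans ?_
  exact congrArg (fun k ↦ (nerveFun C B).app (op ⦋1⦌) k)
    (nerveMap_mk₁ ((Functor.whiskeringLeft C A B).obj F) τ)

lemma whiskerRight_natCell {G H : C ⥤ A} (τ : G ⟶ H) (F : A ⥤ B) :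
    Bicategory.whiskerRight (natCell τ) (nerveQMap F) = natCell (Functor.whiskerRight τ F) := by
  refine (whiskerRight_cell _ _).trans ?_
  refine congrArg cell (SSet.Edge.ext ?_)
  refine (congrArg (fun k ↦ k.app (op ⦋1⦌) (ComposableArrows.mk₁ τ)) (nerveFun_postcomp F)).trans ?_
  exact congrArg (fun k ↦ (nerveFun C B).app (op ⦋1⦌) k)
    (nerveMap_mk₁ ((Functor.whiskeringRight C A B).obj F) τ)

lemma isIso_whiskerRight_comp_iff {𝔅 : Type*} [Bicategory 𝔅] {a b c d : 𝔅} {f f' : a ⟶ b}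
    (η : f ⟶ f') (g : b ⟶ c) (h : c ⟶ d) :
    IsIso (Bicategory.whiskerRight η (g ≫ h)) ↔
      IsIso (Bicategory.whiskerRight (Bicategory.whiskerRight η g) h) := by
  rw [Bicategory.whiskerRight_comp, isIso_comp_left_iff, isIso_comp_right_iff]

instance isIso_natCell {F G : A ⥤ B} (τ : F ⟶ G) [IsIso τ] : IsIso (natCell τ) :=
  ⟨natCell (inv τ), by rw [← natCell_comp, IsIso.hom_inv_id, natCell_id],
    by rw [← natCell_comp, IsIso.inv_hom_id, natCell_id]⟩

/-- Every transformation `τ` is the image of the tautological transformation between the two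
inclusions of `A` into `A × [1]`, under the functor `H` that encodes `τ`. Inverting `W` lets `H`
followed by `L` factor through `A × {0 ≅ 1}`, where the tautological transformation is already
invertible. -/
lemma isIso_natCell_of_inverts {W : MorphismProperty B} {E : SSet.QCat.{u + 1}}
    {L : QMap (nerveQCat B) E} (hL : Inverts W L) {F G : A ⥤ B} (τ : F ⟶ G)
    (hτ : ∀ a, W (τ.app a)) :
    IsIso (Bicategory.whiskerRight (natCell τ) L) := by
  let c₀ : A ⥤ A × Fin (1 + 1) := Functor.prod' (𝟭 A) ((Functor.const _).obj 0)
  let c₁ : A ⥤ A × Fin (1 + 1) := Functor.prod' (𝟭 A) ((Functor.const _).obj 1)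
  let c : c₀ ⟶ c₁ := { app a := (𝟙 a, homOfLE (Fin.zero_le 1)) }
  let P : A × Fin (1 + 1) ⥤ A × WalkingIso.{0} :=
    (𝟭 A).prod (ComposableArrows.mk₁ WalkingIso.iso.{0}.hom)
  let T : Fin (1 + 1) ⥤ A ⥤ B := ComposableArrows.mk₁ τ
  let H : A × Fin (1 + 1) ⥤ B := Functor.uncurry.obj T.flip
  -- Uncurrying inserts a composition with an identity, so `F` and `c₀ ⋙ H` are compared by an
  -- isomorphism with identity components.
  let i₀ : F ≅ c₀ ⋙ H := NatIso.ofComponents (fun a ↦ Iso.refl _)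
    (fun f ↦ (Category.comp_id _).trans ((Category.comp_id _).symm.trans (Category.id_comp _).symm))
  let i₁ : G ≅ c₁ ⋙ H := NatIso.ofComponents (fun a ↦ Iso.refl _)
    (fun f ↦ (Category.comp_id _).trans ((Category.comp_id _).symm.trans (Category.id_comp _).symm))
  have hH : ∀ a : A,
      H.map ((𝟙 a, homOfLE (Fin.zero_le 1)) : (a, (0 : Fin (1 + 1))) ⟶ (a, 1)) = τ.app a := by
    intro a
    dsimp [H, T]
    simp
  have hτ' : τ = i₀.hom ≫ Functor.whiskerRight c H ≫ i₁.inv := by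
    ext a
    refine (hH a).symm.trans ?_
    exact ((Category.id_comp _).trans (Category.comp_id _)).symm
  obtain ⟨(K : QMap (nerveQCat (A × WalkingIso.{0})) E), hK⟩ :=
    hL A H fun a ↦ by rw [hH]; exact hτ a
  have hP (a : A) : IsIso ((Functor.whiskerRight c P).app a) :=
    ⟨((𝟙 a, WalkingIso.iso.{0}.inv) : (a, WalkingIso.one.{0}) ⟶ (a, WalkingIso.zero.{0})),
      Prod.ext (Category.comp_id _) rfl, Prod.ext (Category.comp_id _) rfl⟩
  have : IsIso (Functor.whiskerRight c P) := NatIso.isIso_of_isIso_app _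
  have h₁ : IsIso (Bicategory.whiskerRight (natCell c) (nerveQMap P ≫ K)) := by
    rw [isIso_whiskerRight_comp_iff, whiskerRight_natCell]
    exact inferInstanceAs (IsIso (Bicategory.whiskerRight
      (natCell (F := c₀ ⋙ P) (G := c₁ ⋙ P) (Functor.whiskerRight c P)) K))
  have h₂ : IsIso (Bicategory.whiskerRight (natCell c) (nerveQMap H ≫ L)) := by
    have hK' : (nerveQMap P ≫ K) = nerveQMap H ≫ L := hK
    rwa [← hK']
  rw [isIso_whiskerRight_comp_iff, whiskerRight_natCell] at h₂
  have h₃ : IsIso (Bicategory.whiskerRight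
      (natCell (F := c₀ ⋙ H) (G := c₁ ⋙ H) (Functor.whiskerRight c H)) L) := h₂
  rw [hτ', natCell_comp, natCell_comp, Bicategory.comp_whiskerRight,
    Bicategory.comp_whiskerRight]
  infer_instance

end

end MayerVietoris

end NaturalTransformations

/-! ### Adjunctions in a bicategory and their passage to localizations -/

namespace MayerVietoris
open Bicategory

section

variable {𝔅 : Type*} [Bicategory 𝔅] {a b c : 𝔅}

/-- In two consecutive left zigzags the interchange law moves the second unit before the first
counit. The inner unit and counit then form a right zigzag whiskered with `f` on both sides, which
is trivial by `h`. -/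
theorem leftZigzag_idempotent_of_right_triangle {f : a ⟶ b} {g : b ⟶ a}
    (η : 𝟙 a ⟶ f ≫ g) (ζ : g ≫ f ⟶ 𝟙 b) (h : rightZigzag η ζ = (ρ_ _).hom ≫ (λ_ _).inv) :
    leftZigzag η ζ ⊗≫ leftZigzag η ζ = leftZigzag η ζ := by
  dsimp only [leftZigzag]
  calc
    _ = η ▷ f ⊗≫ (𝟙 a ◁ (f ◁ ζ) ≫ η ▷ (f ≫ 𝟙 b)) ⊗≫ f ◁ ζ := by
      bicategory
    _ = 𝟙 _ ⊗≫ (𝟙 a ◁ η ≫ η ▷ (f ≫ g)) ▷ f ⊗≫ f ◁ ((g ≫ f) ◁ ζ ≫ ζ ▷ 𝟙 b) ⊗≫ 𝟙 _ := by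
      rw [whisker_exchange]; bicategory
    _ = η ▷ f ⊗≫ f ◁ rightZigzag η ζ ▷ f ⊗≫ f ◁ ζ := by
      rw [whisker_exchange, whisker_exchange, rightZigzag]; bicategory
    _ = η ▷ f ⊗≫ f ◁ ζ := by
      rw [h]; bicategory

/-- An adjunction from one triangle identity and the invertibility of the other composite. -/
def adjunctionOfRightTriangle {f : a ⟶ b} {g : b ⟶ a}
    (η : 𝟙 a ⟶ f ≫ g) (ζ : g ≫ f ⟶ 𝟙 b) (h : rightZigzag η ζ = (ρ_ _).hom ≫ (λ_ _).inv)
    [IsIso (η ▷ f)] [IsIso ζ] : Bicategory.Adjunction f g where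
  unit := η
  counit := ζ
  right_triangle := h
  left_triangle := by
    -- Both factors `η ▷ f` and `f ◁ ζ` are invertible. An invertible idempotent is the identity, so
    -- cancelling one copy of the zigzag gives the triangle identity.
    have : IsIso (leftZigzag η ζ) := by
      dsimp only [leftZigzag, bicategoricalComp]
      infer_instance
    rw [← cancel_epi (leftZigzag η ζ ≫ (ρ_ f).hom ≫ (λ_ f).inv)]
    calc
      _ = leftZigzag η ζ ⊗≫ leftZigzag η ζ := by bicategory
      _ = leftZigzag η ζ := leftZigzag_idempotent_of_right_triangle _ _ h
      _ = _ := by simp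

/-- Conjugating `θ ▷ g ▷ f` with the invertible counit gives back `θ`, so `θ` is determined by `θ ▷
g`. -/
lemma faithful_postcomp_of_isIso_counit {f : a ⟶ b} {g : b ⟶ a} (adj : Bicategory.Adjunction f g)
    [IsIso adj.counit] (c : 𝔅) : (postcomp c g).Faithful where
  map_injective {s t θ θ'} h := by
    have h' : θ ▷ g = θ' ▷ g := h
    have key (θ : s ⟶ t) : θ = 𝟙 _ ⊗≫ s ◁ inv adj.counit ⊗≫ θ ▷ g ▷ f ⊗≫ t ◁ adj.counit ⊗≫ 𝟙 _ := by
      calc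
        _ = 𝟙 _ ⊗≫ s ◁ (inv adj.counit ≫ adj.counit) ⊗≫ θ ⊗≫ 𝟙 _ := by
          rw [IsIso.inv_hom_id]; bicategory
        _ = 𝟙 _ ⊗≫ s ◁ inv adj.counit ⊗≫ (s ◁ adj.counit ≫ θ ▷ 𝟙 b) ⊗≫ 𝟙 _ := by bicategory
        _ = _ := by
          rw [whisker_exchange]; bicategory
    rw [key θ, key θ', h']

/-- A preimage of `ω` is `ω ▷ f` conjugated with the counit; whiskering it with `g` creates a right
zigzag that straightens to `ω`. -/
lemma full_postcomp_of_isIso_counit {f : a ⟶ b} {g : b ⟶ a} (adj : Bicategory.Adjunction f g)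
    [IsIso adj.counit] (c : 𝔅) : (postcomp c g).Full where
  map_surjective {s t} ω := by
    change s ≫ g ⟶ t ≫ g at ω
    -- By the right triangle identity the unit whiskered with `g` is inverse to the counit whiskered
    -- with `g`.
    have h₁ : inv adj.counit ▷ g = 𝟙 _ ⊗≫ g ◁ adj.unit ⊗≫ 𝟙 _ := by
      rw [← cancel_mono (adj.counit ▷ g), ← comp_whiskerRight, IsIso.inv_hom_id]
      calc
        _ = (λ_ g).hom ≫ (ρ_ g).inv ≫ ((ρ_ g).hom ≫ (λ_ g).inv) := by simp
        _ = (λ_ g).hom ≫ (ρ_ g).inv ≫ rightZigzag adj.unit adj.counit := by rw [adj.right_triangle]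
        _ = _ := by dsimp only [rightZigzag]; bicategory
    refine ⟨𝟙 _ ⊗≫ s ◁ inv adj.counit ⊗≫ ω ▷ f ⊗≫ t ◁ adj.counit ⊗≫ 𝟙 _, ?_⟩
    change (𝟙 _ ⊗≫ s ◁ inv adj.counit ⊗≫ ω ▷ f ⊗≫ t ◁ adj.counit ⊗≫ 𝟙 _) ▷ g = ω
    calc
      _ = 𝟙 _ ⊗≫ s ◁ (inv adj.counit ▷ g) ⊗≫ ω ▷ f ▷ g ⊗≫ t ◁ adj.counit ▷ g ⊗≫ 𝟙 _ := by
        bicategory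
      _ = 𝟙 _ ⊗≫ ((s ≫ g) ◁ adj.unit ≫ ω ▷ (f ≫ g)) ⊗≫ t ◁ adj.counit ▷ g ⊗≫ 𝟙 _ := by
        rw [h₁]; bicategory
      _ = ω ⊗≫ t ◁ rightZigzag adj.unit adj.counit ⊗≫ 𝟙 _ := by
        rw [whisker_exchange]; bicategory
      _ = _ := by
        rw [adj.right_triangle]; bicategory

/-- A zigzag of 2-morphisms that becomes an adjunction with invertible counit after passage to
localizations. -/
theorem exists_adjunction_of_localization {a b A B : 𝔅} {L : a ⟶ A} {M : b ⟶ B}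
    (hL : ∀ c : 𝔅, (precomp c L).Full) (hL' : ∀ c : 𝔅, (precomp c L).Faithful)
    (hM : ∀ c : 𝔅, (precomp c M).Full) (hM' : ∀ c : 𝔅, (precomp c M).Faithful)
    {F : a ⟶ b} {G : b ⟶ a} {Q : a ⟶ a} (q : Q ⟶ 𝟙 a) (v : Q ⟶ F ≫ G) (e : G ≫ F ⟶ 𝟙 b)
    [IsIso (q ▷ L)] [IsIso (e ▷ M)] [IsIso (v ▷ F ▷ M)]
    (tri : G ◁ v ⊗≫ e ▷ G = G ◁ q ⊗≫ 𝟙 _)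
    {α : A ⟶ B} (φ : L ≫ α ≅ F ≫ M) {r : B ⟶ A} (ψ : M ≫ r ≅ G ≫ L) :
    ∃ adj : Bicategory.Adjunction α r, IsIso adj.counit := by
  -- Since precomposition with `L` is full, it suffices to define the unit after whiskering with
  -- `L`. There it is the fraction `q⁻¹` followed by `v`, transported along `ψ` and `φ`.
  obtain ⟨η, hη⟩ : ∃ η : 𝟙 A ⟶ α ≫ r, L ◁ η =
      𝟙 _ ⊗≫ inv (q ▷ L) ⊗≫ v ▷ L ⊗≫ F ◁ ψ.inv ⊗≫ φ.inv ▷ r ⊗≫ 𝟙 _ :=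
    (precomp A L).map_surjective _
  obtain ⟨ζ, hζ⟩ : ∃ ζ : r ≫ α ⟶ 𝟙 B, M ◁ ζ =
      𝟙 _ ⊗≫ ψ.hom ▷ α ⊗≫ G ◁ φ.hom ⊗≫ e ▷ M ⊗≫ 𝟙 _ :=
    (precomp B M).map_surjective _
  have hζiso : IsIso ζ := by
    have : IsIso ((precomp B M).map ζ) := by
      change IsIso (M ◁ ζ)
      rw [hζ]
      dsimp only [bicategoricalComp]
      infer_instance
    exact isIso_of_reflects_iso ζ (precomp B M)
  have hηα : IsIso (η ▷ α) := by
    have : IsIso ((precomp B L).map (η ▷ α)) := by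
      change IsIso (L ◁ (η ▷ α))
      have h₁ : L ◁ (η ▷ α) = 𝟙 _ ⊗≫ (L ◁ η) ▷ α ⊗≫ 𝟙 _ := by bicategory
      -- Nothing is known about `v ▷ L` alone. By interchange, `φ` trades `L ≫ α` for `F ≫ M`, and
      -- `v ▷ F ▷ M` is invertible by assumption.
      have h₂ : v ▷ L ▷ α = 𝟙 _ ⊗≫ (Q ◁ φ.hom) ⊗≫ v ▷ F ▷ M ⊗≫ ((F ≫ G) ◁ φ.inv) ⊗≫ 𝟙 _ := by
        calc
          _ = 𝟙 _ ⊗≫ v ▷ (L ≫ α) ⊗≫ (F ≫ G) ◁ (φ.hom ≫ φ.inv) ⊗≫ 𝟙 _ := by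
            rw [Iso.hom_inv_id]; bicategory
          _ = 𝟙 _ ⊗≫ (v ▷ (L ≫ α) ≫ (F ≫ G) ◁ φ.hom) ⊗≫ (F ≫ G) ◁ φ.inv ⊗≫ 𝟙 _ := by
            bicategory
          _ = _ := by
            rw [← whisker_exchange]; bicategory
      have h₃ : IsIso (v ▷ L ▷ α) := by
        rw [h₂]
        dsimp only [bicategoricalComp]
        infer_instance
      rw [h₁, hη]
      have h₄ : (𝟙 (L ≫ 𝟙 A) ⊗≫ inv (q ▷ L) ⊗≫ v ▷ L ⊗≫ F ◁ ψ.inv ⊗≫ φ.inv ▷ r ⊗≫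
          𝟙 (L ≫ α ≫ r)) ▷ α =
          𝟙 ((L ≫ 𝟙 A) ≫ α) ⊗≫ inv (q ▷ L) ▷ α ⊗≫ v ▷ L ▷ α ⊗≫ (F ◁ ψ.inv) ▷ α ⊗≫ (φ.inv ▷ r) ▷ α ⊗≫
            𝟙 _ := by bicategory
      rw [h₄]
      dsimp only [bicategoricalComp]
      infer_instance
    exact isIso_of_reflects_iso _ (precomp B L)
  have hright : rightZigzag η ζ = (ρ_ _).hom ≫ (λ_ _).inv := by
    apply (precomp A M).map_injective
    change M ◁ (r ◁ η ⊗≫ ζ ▷ r) = M ◁ ((ρ_ r).hom ≫ (λ_ r).inv)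
    have : IsIso (G ◁ (q ▷ L) ⊗≫ ψ.inv ⊗≫ 𝟙 (M ≫ r ≫ 𝟙 A)) := by
      dsimp only [bicategoricalComp]
      infer_instance
    -- Composing with `q` on the left cancels the formal inverse in `hη`. After `φ` and `ψ` have
    -- cancelled as well, what remains is `tri` whiskered with `L`.
    rw [← cancel_epi (G ◁ (q ▷ L) ⊗≫ ψ.inv ⊗≫ 𝟙 (M ≫ r ≫ 𝟙 A))]
    calc
      _ = 𝟙 _ ⊗≫ G ◁ (q ▷ L) ⊗≫ (ψ.inv ▷ (𝟙 A) ≫ (M ≫ r) ◁ η) ⊗≫ (M ◁ ζ) ▷ r ⊗≫ 𝟙 _ := by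
        bicategory
      _ = 𝟙 _ ⊗≫ G ◁ (q ▷ L ⊗≫ L ◁ η) ⊗≫ ψ.inv ▷ (α ≫ r) ⊗≫ (M ◁ ζ) ▷ r ⊗≫ 𝟙 _ := by
        rw [← whisker_exchange]; bicategory
      _ = 𝟙 _ ⊗≫ G ◁ ((q ▷ L ≫ inv (q ▷ L)) ⊗≫ v ▷ L ⊗≫ F ◁ ψ.inv ⊗≫ φ.inv ▷ r) ⊗≫
            ((ψ.inv ≫ ψ.hom) ▷ α ⊗≫ G ◁ φ.hom ⊗≫ e ▷ M) ▷ r ⊗≫ 𝟙 _ := by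
        rw [hη, hζ]; bicategory
      _ = 𝟙 _ ⊗≫ G ◁ (v ▷ L ⊗≫ F ◁ ψ.inv) ⊗≫ G ◁ (φ.inv ≫ φ.hom) ▷ r ⊗≫
            e ▷ M ▷ r ⊗≫ 𝟙 _ := by
        rw [IsIso.hom_inv_id, Iso.inv_hom_id]; bicategory
      _ = 𝟙 _ ⊗≫ G ◁ v ▷ L ⊗≫ ((G ≫ F) ◁ ψ.inv ≫ e ▷ (M ≫ r)) ⊗≫ 𝟙 _ := by
        rw [Iso.inv_hom_id]; bicategory
      _ = 𝟙 _ ⊗≫ (G ◁ v ⊗≫ e ▷ G) ▷ L ⊗≫ ψ.inv ⊗≫ 𝟙 _ := by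
        rw [whisker_exchange]; bicategory
      _ = _ := by
        rw [tri]; bicategory
  exact ⟨adjunctionOfRightTriangle η ζ hright, hζiso⟩

end

end MayerVietoris

/-! ### Strict functors with an adjunction up to weak equivalence -/

namespace MayerVietoris
open Bicategory

section

variable {A B : Type (u + 1)} [LargeCategory A] [LargeCategory B]

/-- The bicategory of quasi-categories is strict, so the associator and the unitors are 2-morphisms
of identity transformations, and the identity reduces to an identity of natural transformations,
checked at each object. The primed 2-morphisms are variables, so that their sources and targets are
composites of 1-morphisms instead of nerves of composite functors. -/
lemma nerveQMap_triangle {F : A ⥤ B} {G : B ⥤ A} {Q : A ⥤ A} (q : Q ⟶ 𝟭 A) (v : Q ⟶ F ⋙ G)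
    (e : G ⋙ F ⟶ 𝟭 B) (tri : ∀ V, v.app (G.obj V) ≫ G.map (e.app V) = q.app (G.obj V))
    (v' : nerveQMap Q ⟶ nerveQMap F ≫ nerveQMap G) (hv : v' = natCell v)
    (e' : nerveQMap G ≫ nerveQMap F ⟶ 𝟙 (nerveQCat B)) (he : e' = natCell e)
    (q' : nerveQMap Q ⟶ 𝟙 (nerveQCat A)) (hq : q' = natCell q) :
    nerveQMap G ◁ v' ⊗≫ e' ▷ nerveQMap G = nerveQMap G ◁ q' ⊗≫ 𝟙 _ := by
  have h : Functor.whiskerLeft G v ≫ (Functor.associator G F G).inv ≫ Functor.whiskerRight e G =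
      Functor.whiskerLeft G q ≫ (G.rightUnitor ≪≫ G.leftUnitor.symm).hom := by
    ext V
    simpa using tri V
  have h' := congrArg natCell h
  have ha : (α_ (nerveQMap G) (nerveQMap F) (nerveQMap G)).inv =
      natCell (Functor.associator G F G).inv := by
    rw [Bicategory.Strict.associator_eqToIso]
    exact (natCell_id (G ⋙ F ⋙ G)).symm
  have hr : (ρ_ (nerveQMap G)).hom ≫ (λ_ (nerveQMap G)).inv =
      natCell (G.rightUnitor ≪≫ G.leftUnitor.symm).hom := by
    rw [Bicategory.Strict.leftUnitor_eqToIso, Bicategory.Strict.rightUnitor_eqToIso]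
    refine Eq.trans (b := 𝟙 (nerveQMap G)) ?_ ?_
    · exact Category.id_comp _
    · exact (natCell_id G).symm.trans (congrArg natCell (Category.id_comp (𝟙 G)).symm)
  have hl : nerveQMap G ◁ v' ⊗≫ e' ▷ nerveQMap G =
      nerveQMap G ◁ v' ≫ (α_ _ _ _).inv ≫ e' ▷ nerveQMap G := by
    bicategory
  have hr' : nerveQMap G ◁ q' ⊗≫ 𝟙 (𝟙 _ ≫ nerveQMap G) =
      nerveQMap G ◁ q' ≫ (ρ_ (nerveQMap G)).hom ≫ (λ_ (nerveQMap G)).inv := by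
    bicategory
  rw [hl, hr', ha, hr, hv, he, hq]
  refine Eq.trans ?_ (h'.trans ?_)
  · rw [natCell_comp, natCell_comp]
    exact congrArg₂ (fun x y ↦ x ≫ natCell (Functor.associator G F G).inv ≫ y)
      (whiskerLeft_natCell G v) (whiskerRight_natCell e G)
  · rw [natCell_comp]
    exact congrArg (fun x ↦ x ≫ natCell (G.rightUnitor ≪≫ G.leftUnitor.symm).hom)
      (whiskerLeft_natCell G q).symm

lemma Inverts.of_functor {W : MorphismProperty A} {W' : MorphismProperty B} {E : SSet.QCat.{u + 1}}
    {L : nerveQCat B ⟶ E} (hL : Inverts W' L) (F : A ⥤ B)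
    (hF : ∀ {x y : A} (f : x ⟶ y), W f → W' (F.map f)) : Inverts W (nerveQCatMap F ≫ L) := by
  intro C _ H hH
  exact hL C (H ⋙ F) fun c ↦ hF _ (hH c)

/-- Strict functors that are mutually adjoint up to weak equivalences induce an adjunction with
fully faithful right adjoint between the localizations. -/
theorem exists_leftBousfieldLocalization {W : MorphismProperty A} {W' : MorphismProperty B}
    {D E : SSet.QCat.{u + 1}} {L : nerveQCat A ⟶ D} {M : nerveQCat B ⟶ E}
    (hL : IsInfinityLocalization W L) (hM : IsInfinityLocalization W' M)
    {F : A ⥤ B} {G : B ⥤ A} {Q : A ⥤ A} (q : Q ⟶ 𝟭 A) (v : Q ⟶ F ⋙ G) (e : G ⋙ F ⟶ 𝟭 B)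
    (tri : ∀ V, v.app (G.obj V) ≫ G.map (e.app V) = q.app (G.obj V))
    (hF : ∀ {x y : A} (f : x ⟶ y), W f → W' (F.map f))
    (hG : ∀ {x y : B} (f : x ⟶ y), W' f → W (G.map f))
    (hq : ∀ K, W (q.app K)) (he : ∀ V, W' (e.app V)) (hv : ∀ K, W' (F.map (v.app K))) :
    ∃ (res : E ⟶ D) (α : D ⟶ E), Nonempty (M ≫ res ≅ nerveQCatMap G ≫ L) ∧
      IsLeftBousfieldLocalization α res := by
  obtain ⟨r, ⟨ψ⟩⟩ := hM.exists_lift _ _ (hL.inverts.of_functor G hG)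
  obtain ⟨α, ⟨φ⟩⟩ := hL.exists_lift _ _ (hM.inverts.of_functor F hF)
  let v' : nerveQMap Q ⟶ nerveQMap F ≫ nerveQMap G := natCell v
  let e' : nerveQMap G ≫ nerveQMap F ⟶ 𝟙 (nerveQCat B) := natCell e
  let q' : nerveQMap Q ⟶ 𝟙 (nerveQCat A) := natCell q
  have : IsIso (Bicategory.whiskerRight q' L) := isIso_natCell_of_inverts hL.inverts q hq
  have : IsIso (Bicategory.whiskerRight e' M) := isIso_natCell_of_inverts hM.inverts e he
  have : IsIso (Bicategory.whiskerRight (Bicategory.whiskerRight v' (nerveQMap F)) M) := by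
    have h := isIso_natCell_of_inverts hM.inverts (Functor.whiskerRight v F) hv
    have h' : Bicategory.whiskerRight v' (nerveQMap F) = natCell (Functor.whiskerRight v F) :=
      whiskerRight_natCell v F
    rw [h']
    exact h
  obtain ⟨adj, hadj⟩ := exists_adjunction_of_localization hL.full hL.faithful hM.full hM.faithful
    (L := L) (M := M) (F := nerveQMap F) (G := nerveQMap G)
    q' v' e' (nerveQMap_triangle q v e tri v' rfl e' rfl q' rfl) (α := α) φ (r := r) ψ
  exact ⟨r, α, ⟨ψ⟩, ⟨adj⟩, fun K ↦ ⟨full_postcomp_of_isIso_counit adj K,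
    faithful_postcomp_of_isIso_counit adj K⟩⟩

end

end MayerVietoris

/-! ### Complexes of smooth functors and their values -/

namespace MayerVietoris

section

variable {R : Type u} [Ring R] {G : Type u} [Group G] [TopologicalSpace G]
  {C : Type w} [Category.{u} C] {q : C ⥤ SingleObj G}

/-- The values of a complex of smooth functors, as a functor to complexes of modules. -/
@[simps]
def pointwiseObj (K : CochainComplex (SmoothFunctor R q) ℤ) :
    C ⥤ CochainComplex (ModuleCat.{u} R) ℤ where
  obj c :=
    { X i := (K.X i).obj.obj c
      d i j := (K.d i j).hom.app c
      shape i j h := by rw [K.shape i j h]; rfl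
      d_comp_d' i j k _ _ :=
        congrArg (fun φ : K.X i ⟶ K.X k ↦ φ.hom.app c) (K.d_comp_d i j k) }
  map f :=
    { f i := (K.X i).obj.map f
      comm' i j _ := (K.d i j).hom.naturality f }
  map_id c := by
    ext i : 1
    exact (K.X i).obj.map_id c
  map_comp f g := by
    ext i : 1
    exact (K.X i).obj.map_comp f g

variable (R q) in
/-- Complexes of smooth functors as functors to complexes of modules. -/
@[simps]
def pointwise : CochainComplex (SmoothFunctor R q) ℤ ⥤
    C ⥤ CochainComplex (ModuleCat.{u} R) ℤ where
  obj := pointwiseObj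
  map {X Y} φ :=
    { app c :=
        { f i := (φ.f i).hom.app c
          comm' i j _ :=
            congrArg (fun ψ : X.X i ⟶ Y.X j ↦ ψ.hom.app c) (φ.comm i j) }
      naturality c c' f := by
        ext i : 1
        exact (φ.f i).hom.naturality f }

variable (R q) in
/-- Maps of complexes of smooth functors are the natural maps between their values. -/
def fullyFaithfulPointwise : (pointwise R q).FullyFaithful where
  preimage φ :=
    { f i := ObjectProperty.homMk
        { app c := (φ.app c).f i
          naturality c c' f := congrArg (fun ψ ↦ ψ.f i) (φ.naturality f) }
      comm' i j _ := by
        ext c : 3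
        exact (φ.app c).comm i j }

/-- A functor to complexes of modules whose terms are smooth. -/
def IsSmoothComplex (q : C ⥤ SingleObj G) (T : C ⥤ CochainComplex (ModuleCat.{u} R) ℤ) : Prop :=
  ∀ i, IsSmooth R q (T ⋙ HomologicalComplex.eval _ _ i)

/-- The complex of smooth functors given by its values. -/
def ofPointwise (T : C ⥤ CochainComplex (ModuleCat.{u} R) ℤ) (hT : IsSmoothComplex q T) :
    CochainComplex (SmoothFunctor R q) ℤ where
  X i := ⟨T ⋙ HomologicalComplex.eval _ _ i, hT i⟩
  d i j := ObjectProperty.homMk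
    { app c := (T.obj c).d i j
      naturality c c' f := (T.map f).comm i j }
  shape i j h := by
    ext c : 3
    exact (T.obj c).shape i j h
  d_comp_d' i j k _ _ := by
    ext c : 3
    exact (T.obj c).d_comp_d i j k

lemma isSmoothComplex_pointwise (K : CochainComplex (SmoothFunctor R q) ℤ) :
    IsSmoothComplex q ((pointwise R q).obj K) := fun i ↦ (K.X i).property

/-- A functor to complexes of smooth functors given by its values. -/
def liftPointwise {𝒟 : Type*} [Category 𝒟] (Φ : 𝒟 ⥤ C ⥤ CochainComplex (ModuleCat.{u} R) ℤ)
    (hΦ : ∀ K, IsSmoothComplex q (Φ.obj K)) : 𝒟 ⥤ CochainComplex (SmoothFunctor R q) ℤ where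
  obj K := ofPointwise (Φ.obj K) (hΦ K)
  map {K L} φ := (fullyFaithfulPointwise R q).preimage
    (X := ofPointwise (Φ.obj K) (hΦ K)) (Y := ofPointwise (Φ.obj L) (hΦ L)) (Φ.map φ)
  map_id K := (fullyFaithfulPointwise R q).map_injective (Φ.map_id K)
  map_comp f g := (fullyFaithfulPointwise R q).map_injective (Φ.map_comp f g)

instance : (IsSmooth R q).ι.PreservesHomology where
  preservesKernels _ _ f := (IsSmooth R q).preservesKernels_ι f
  preservesCokernels _ _ f := (IsSmooth R q).preservesCokernels_ι f

/-- The inclusion of smooth functors into all functors preserves kernels and cokernels, hence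
homology, and homology of functors is computed objectwise. -/
lemma quasiIso_iff_pointwise {K L : CochainComplex (SmoothFunctor R q) ℤ} (φ : K ⟶ L) :
    QuasiIso φ ↔ ∀ c, QuasiIso (((pointwise R q).map φ).app c) := by
  rw [← HomologicalComplex.quasiIso_map_iff_of_preservesHomology φ (IsSmooth R q).ι,
    HomologicalComplex.quasiIso_iff_evaluation]
  rfl

end

section

variable {R : Type u} [Ring R] {K L : CochainComplex (ModuleCat.{u} R) ℤ}

/-- Elements are maps from `R`, and refinements of `R` still reach the element `1`. Conversely, a
test object `A` is covered by the free module on its underlying set, on which solutions chosen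
element by element extend linearly. -/
lemma mono_homologyMap_iff_elements (f : K ⟶ L) (i j k : ℤ) (hi : i + 1 = j) (hk : j + 1 = k) :
    Mono (HomologicalComplex.homologyMap f j) ↔
      ∀ x : K.X j, (K.d j k).hom x = 0 → ∀ y : L.X i, (f.f j).hom x = (L.d i j).hom y →
        ∃ w : K.X i, x = (K.d i j).hom w := by
  rw [HomologicalComplex.mono_homologyMap_iff_up_to_refinements f i j k
    (by simp; lia) (by simp; lia)]
  constructor
  · intro h x hx y hy
    obtain ⟨A', π, hπ, w, hw⟩ := h (A := ModuleCat.of R R)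
      (ModuleCat.ofHom (LinearMap.toSpanSingleton R _ x)) (by ext; simpa using hx)
      (ModuleCat.ofHom (LinearMap.toSpanSingleton R _ y)) (by ext; simpa using hy)
    obtain ⟨a, ha⟩ := (ModuleCat.epi_iff_surjective π).1 hπ (1 : R)
    refine ⟨w.hom a, ?_⟩
    have := ConcreteCategory.congr_hom hw a
    simpa [ha] using this
  · intro h A x hx y hy
    choose w hw using fun a : A ↦ h (x.hom a) (ConcreteCategory.congr_hom hx a) (y.hom a)
      (ConcreteCategory.congr_hom hy a)
    refine ⟨ModuleCat.of R (A →₀ R), ModuleCat.ofHom (Finsupp.linearCombination R id),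
      (ModuleCat.epi_iff_surjective _).2 (Finsupp.linearCombination_id_surjective R A),
      ModuleCat.ofHom (Finsupp.linearCombination R w), ?_⟩
    ext a
    simp [hw]

lemma epi_homologyMap_iff_elements (f : K ⟶ L) (i j k : ℤ) (hi : i + 1 = j) (hk : j + 1 = k) :
    Epi (HomologicalComplex.homologyMap f j) ↔
      ∀ y : L.X j, (L.d j k).hom y = 0 → ∃ x : K.X j, (K.d j k).hom x = 0 ∧ ∃ z : L.X i,
        y = (f.f j).hom x + (L.d i j).hom z := by
  rw [HomologicalComplex.epi_homologyMap_iff_up_to_refinements f i j k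
    (by simp; lia) (by simp; lia)]
  constructor
  · intro h y hy
    obtain ⟨A', π, hπ, x, hx, z, hz⟩ := h (A := ModuleCat.of R R)
      (ModuleCat.ofHom (LinearMap.toSpanSingleton R _ y)) (by ext; simpa using hy)
    obtain ⟨a, ha⟩ := (ModuleCat.epi_iff_surjective π).1 hπ (1 : R)
    refine ⟨x.hom a, ConcreteCategory.congr_hom hx a, z.hom a, ?_⟩
    have := ConcreteCategory.congr_hom hz a
    simpa [ha] using this
  · intro h A y hy
    choose x hx z hz using fun a : A ↦ h (y.hom a) (ConcreteCategory.congr_hom hy a)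
    refine ⟨ModuleCat.of R (A →₀ R), ModuleCat.ofHom (Finsupp.linearCombination R id),
      (ModuleCat.epi_iff_surjective _).2 (Finsupp.linearCombination_id_surjective R A),
      ModuleCat.ofHom (Finsupp.linearCombination R x), ?_,
      ModuleCat.ofHom (Finsupp.linearCombination R z), ?_⟩
    · ext a
      simp [hx]
    · ext a
      simp [← hz]

/-- A map of complexes is a quasi-isomorphism if and only if its cone is acyclic. -/
lemma quasiIso_iff_elements (f : K ⟶ L) :
    QuasiIso f ↔ ∀ (n₀ n n' n'' : ℤ) (_ : n₀ + 1 = n) (_ : n + 1 = n') (_ : n' + 1 = n'')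
      (y : K.X n') (z : L.X n), (K.d n' n'').hom y = 0 → (f.f n').hom y = (L.d n n').hom z →
      ∃ (y' : K.X n) (z' : L.X n₀), (K.d n n').hom y' = y ∧
        z = (f.f n).hom y' + (L.d n₀ n).hom z' := by
  have hd (C : CochainComplex (ModuleCat.{u} R) ℤ) (i j k : ℤ) (x : C.X i) :
      (C.d j k).hom ((C.d i j).hom x) = 0 := ConcreteCategory.congr_hom (C.d_comp_d i j k) x
  have hf (i j : ℤ) (x : K.X i) :
      (L.d i j).hom ((f.f i).hom x) = (f.f j).hom ((K.d i j).hom x) :=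
    ConcreteCategory.congr_hom (f.comm i j) x
  constructor
  · rintro hq n₀ _ _ _ rfl rfl rfl y z hy hz
    have h₁ : Mono (HomologicalComplex.homologyMap f (n₀ + 1 + 1)) := inferInstance
    have h₂ : Epi (HomologicalComplex.homologyMap f (n₀ + 1)) := inferInstance
    rw [mono_homologyMap_iff_elements f (n₀ + 1) (n₀ + 1 + 1) _ rfl rfl] at h₁
    rw [epi_homologyMap_iff_elements f n₀ (n₀ + 1) (n₀ + 1 + 1) rfl rfl] at h₂
    -- Injectivity on homology makes `y` a boundary `d w`; surjectivity one degree lower corrects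
    -- the cycle `z - f w`.
    obtain ⟨w, rfl⟩ := h₁ y hy z hz
    obtain ⟨x, hx, z', hz'⟩ := h₂ (z - (f.f _).hom w) (by rw [map_sub, hf, ← hz, sub_self])
    exact ⟨x + w, z', by simp [hx], by rw [map_add, add_right_comm, ← hz', sub_add_cancel]⟩
  · intro h
    rw [_root_.quasiIso_iff]
    intro n
    rw [quasiIsoAt_iff_isIso_homologyMap, isIso_iff_mono_and_epi,
      mono_homologyMap_iff_elements f (n - 1) n (n + 1) (by lia) rfl,
      epi_homologyMap_iff_elements f (n - 1) n (n + 1) (by lia) rfl]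
    refine ⟨fun x hx y hy ↦ ?_, fun y hy ↦ ?_⟩
    · obtain ⟨y', -, hy', -⟩ := h (n - 2) (n - 1) n (n + 1) (by lia) (by lia) rfl x y hx hy
      exact ⟨y', hy'.symm⟩
    · obtain ⟨x, z, hx, hz⟩ := h (n - 1) n (n + 1) (n + 1 + 1) (by lia) rfl rfl 0 y (map_zero _)
        (by rw [map_zero, hy])
      exact ⟨x, hx, z, hz⟩

end

end MayerVietoris

/-! ### The total complex of chains with values in a system of complexes -/

namespace MayerVietoris

/-- The map `(i, j) ↦ (j, i + 1)` is a bijection from the pairs with `j ≤ i` to the other pairs. It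
preserves the term and changes its sign. This is the cancellation behind `d ∘ d = 0`. -/
lemma sum_sum_alternating_eq_zero {M : Type*} [AddCommGroup M] (n : ℕ)
    (F : Fin (n + 2) → Fin (n + 3) → M)
    (hF : ∀ (i : Fin (n + 2)) (j : Fin (n + 3)) (h : (j : ℕ) ≤ i),
      F i j = F (j.castLT (h.trans_lt i.is_lt)) i.succ) :
    ∑ j : Fin (n + 3), ∑ i : Fin (n + 2), (-1 : ℤ) ^ ((i : ℕ) + j) • F i j = 0 := by
  rw [Finset.sum_comm, ← Finset.sum_product']
  let P := Fin (n + 2) × Fin (n + 3)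
  let S : Finset P := {ij : P | (ij.2 : ℕ) ≤ (ij.1 : ℕ)}
  rw [Finset.univ_product_univ, ← Finset.sum_add_sum_compl S, ← eq_neg_iff_add_eq_zero,
    ← Finset.sum_neg_distrib]
  let φ : ∀ ij : P, ij ∈ S → P := fun ij hij =>
    (Fin.castLT ij.2 (lt_of_le_of_lt (Finset.mem_filter.mp hij).right (Fin.is_lt ij.1)), ij.1.succ)
  apply Finset.sum_bij φ
  · intro ij hij
    simp_rw [S, φ, Finset.compl_filter, Finset.mem_filter_univ, Fin.val_succ,
      Fin.val_castLT] at hij ⊢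
    lia
  · rintro ⟨i, j⟩ hij ⟨i', j'⟩ hij' h
    rw [Prod.mk_inj]
    exact ⟨by simpa [φ] using! congr_arg Prod.snd h,
      by simpa [φ, Fin.castSucc_castLT] using! congr_arg Fin.castSucc (congr_arg Prod.fst h)⟩
  · rintro ⟨i', j'⟩ hij'
    simp_rw [S, Finset.compl_filter, Finset.mem_filter_univ, not_le] at hij'
    refine ⟨(j'.pred <| ?_, Fin.castSucc i'), ?_, ?_⟩
    · rintro rfl
      simp only [Fin.val_zero, not_lt_zero] at hij'
    · simpa [S] using! Nat.le_sub_one_of_lt hij'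
    · simp only [φ, Fin.castLT_castSucc, Fin.succ_pred]
  · rintro ⟨i, j⟩ hij
    have h := hF i j (by simpa [S] using hij)
    dsimp only [φ]
    rw [h, ← neg_smul]
    congr 1
    simp only [Fin.val_succ, Fin.val_castLT]
    ring

/-- The set of `m`-simplices. -/
abbrev Smp (S : SemiSimplexCategoryᵒᵖ ⥤ Type u) (m : ℕ) : Type u :=
  S.obj (op (SemiSimplexCategory.mk m))

/-- The face inclusions between standard simplices. -/
abbrev Inj (j m : ℕ) : Type := SemiSimplexCategory.mk j ⟶ SemiSimplexCategory.mk m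

/-- A simplex as an object of the category of simplices. -/
abbrev smp {S : SemiSimplexCategoryᵒᵖ ⥤ Type u} {m : ℕ} (x : Smp S m) : S.Elements :=
  S.elementsMk (op (SemiSimplexCategory.mk m)) x

/-- The `r`-th face of the simplex. -/
def face {m : ℕ} (r : Fin (m + 2)) : Inj m (m + 1) :=
  SemiSimplexCategory.homEquiv.symm (Fin.succAboveOrderEmb r)

lemma face_comp_face {m : ℕ} (i : Fin (m + 2)) (j : Fin (m + 3)) (h : (j : ℕ) ≤ i) :
    face i ≫ face j = face (j.castLT (h.trans_lt i.is_lt)) ≫ face i.succ := by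
  apply SemiSimplexCategory.toSimplexCategory.map_injective
  rw [Functor.map_comp, Functor.map_comp]
  exact (SimplexCategory.δ_comp_δ'' h).symm

section

variable {R : Type u} [Ring R] {S : SemiSimplexCategoryᵒᵖ ⥤ Type u}
  (K : S.Elements ⥤ CochainComplex (ModuleCat.{u} R) ℤ)

/-- The value at a simplex of a system of complexes. -/
abbrev val {m : ℕ} (x : Smp S m) (k : ℤ) : ModuleCat.{u} R :=
  (K.obj (smp x)).X k

/-- The differential of the value at a simplex. -/
abbrev valD {m : ℕ} (x : Smp S m) (k k' : ℤ) : val K x k →ₗ[R] val K x k' :=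
  ((K.obj (smp x)).d k k').hom

/-- The restriction of values along a morphism of simplices. -/
abbrev valMap {p p' : S.Elements} (φ : p ⟶ p') (k : ℤ) : (K.obj p).X k →ₗ[R] (K.obj p').X k :=
  ((K.map φ).f k).hom

/-- The terms of the total complex of the chains of a semi-simplicial set with values in a system
of complexes. -/
abbrev Tot (n : ℤ) : Type u :=
  DirectSum (Σ m : ℕ, Smp S m) fun s ↦ val K s.2 (n + s.1)

namespace Tot

variable {K}

open Classical in
/-- The inclusion of the summand of a simplex. -/
noncomputable def gen {m : ℕ} (x : Smp S m) {k n : ℤ} (h : k = n + m) :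
    val K x k →ₗ[R] Tot K n :=
  -- The internal degree `k` is a variable with a proof of `k = n + m`, so that degree shifts in
  -- later statements need no transport of elements.
  DirectSum.lof R _ (fun s : Σ m : ℕ, Smp S m ↦ val K s.2 (n + s.1)) ⟨m, x⟩ ∘ₗ
    (ModuleCat.ofHom (h ▸ LinearMap.id) : val K x k ⟶ val K x (n + m)).hom

open Classical in
/-- The linear map with given values on generators. -/
noncomputable def lift {n : ℤ} {N : Type*} [AddCommGroup N] [Module R N]
    (φ : ∀ (m : ℕ) (x : Smp S m) (k : ℤ), k = n + m → val K x k →ₗ[R] N) :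
    Tot K n →ₗ[R] N :=
  DirectSum.toModule R _ _ fun s ↦ φ s.1 s.2 _ rfl

@[simp]
lemma lift_gen {n : ℤ} {N : Type*} [AddCommGroup N] [Module R N]
    (φ : ∀ (m : ℕ) (x : Smp S m) (k : ℤ), k = n + m → val K x k →ₗ[R] N)
    {m : ℕ} (x : Smp S m) {k : ℤ} (h : k = n + m) (a : val K x k) :
    lift φ (gen x h a) = φ m x k h a := by
  classical
  subst h
  exact DirectSum.toModule_lof _ _ _

lemma hom_ext {n : ℤ} {N : Type*} [AddCommGroup N] [Module R N] {f g : Tot K n →ₗ[R] N}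
    (h : ∀ (m : ℕ) (x : Smp S m) (k : ℤ) (hk : k = n + m) (a : val K x k),
      f (gen x hk a) = g (gen x hk a)) : f = g := by
  classical
  refine DirectSum.linearMap_ext R fun s ↦ LinearMap.ext fun a ↦ ?_
  simpa [gen] using! h s.1 s.2 _ rfl a

/-- The element of the total complex given by a face of a simplex and an element of the value at
this simplex. -/
noncomputable def genMap {m j : ℕ} (f : Inj j m) (x : Smp S m) {k n : ℤ}
    (h : k = n + j) : val K x k →ₗ[R] Tot K n :=
  gen (S.map f.op x) h ∘ₗ valMap K (p := (smp x)) (p' := smp (S.map f.op x)) ⟨f.op, rfl⟩ k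

/-- The target of a morphism of simplices equals the corresponding face only propositionally;
substituting this equation once here spares all later arguments the transport. -/
lemma gen_valMap {m j : ℕ} {x : Smp S m} {y : Smp S j}
    (φ : smp x ⟶ smp y) {k n : ℤ} (h : k = n + j) (a : val K x k) :
    gen y h (valMap K φ k a) = genMap φ.1.unop x h a := by
  obtain ⟨f, hf⟩ := φ
  change op (SemiSimplexCategory.mk m) ⟶ op (SemiSimplexCategory.mk j) at f
  obtain rfl : S.map f x = y := hf
  rfl

lemma genMap_valMap {m j i : ℕ} {x : Smp S m} {y : Smp S j} (g : Inj i j)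
    (φ : smp x ⟶ smp y) {k n : ℤ} (h : k = n + i) (a : val K x k) :
    genMap g y h (valMap K φ k a) = genMap (g ≫ φ.1.unop) x h a := by
  rw [genMap, LinearMap.comp_apply]
  have : valMap K (p := smp y) (p' := smp (S.map g.op y)) ⟨g.op, rfl⟩ k
      (valMap K φ k a) = valMap K (φ ≫ ⟨g.op, rfl⟩) k a := by
    simp [valMap]
  rw [this, gen_valMap]
  rfl

/-- The alternating sum of the faces of a simplex. -/
noncomputable def bdry {n : ℤ} : ∀ (m : ℕ) (x : Smp S m) (k : ℤ), k + 1 = n + m →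
    (val K x k →ₗ[R] Tot K n)
  | 0, _, _, _ => 0
  | m + 1, x, k, h => ∑ r : Fin (m + 2), (-1 : ℤ) ^ (r : ℕ) • genMap (face r) x
      (by push_cast at h; lia)

lemma bdry_succ {n : ℤ} {m : ℕ} (x : Smp S (m + 1)) {k : ℤ} (h : k + 1 = n + (m + 1 : ℕ))
    (a : val K x k) :
    bdry (m + 1) x k h a = ∑ r : Fin (m + 2), (-1 : ℤ) ^ (r : ℕ) • genMap (face r) x
      (n := n) (by push_cast at h; lia) a := by
  simp [bdry]

/-- The differential of the total complex. -/
noncomputable def diff (n n' : ℤ) (h : n + 1 = n') : Tot K n →ₗ[R] Tot K n' :=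
  -- Faces preserve the internal degree `k` and the internal differential raises it by one, so the
  -- sign `(-1) ^ k` makes the two partial differentials anticommute.
  lift fun m x k hk ↦ gen x (n := n') (by lia) ∘ₗ valD K x k (k + 1) +
    (k.negOnePow : ℤ) • bdry (n := n') m x k (by lia)

lemma diff_gen {n n' : ℤ} (h : n + 1 = n') {m : ℕ} (x : Smp S m) {k : ℤ} (hk : k = n + m)
    (a : val K x k) : diff n n' h (gen x hk a) =
      gen x (k := k + 1) (n := n') (by lia) (valD K x k (k + 1) a) +
        (k.negOnePow : ℤ) • bdry (n := n') m x k (by lia) a := by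
  simp [diff]

lemma diff_genMap_zero {n n' : ℤ} (h : n + 1 = n') {m : ℕ} (f : Inj 0 m)
    (x : Smp S m) {k : ℤ} (hk : k = n + (0 : ℕ)) (a : val K x k) :
    diff n n' h (genMap f x hk a) =
      genMap f x (k := k + 1) (n := n') (by lia) (valD K x k (k + 1) a) := by
  rw [genMap, LinearMap.comp_apply, diff_gen]
  simp only [bdry, LinearMap.zero_apply, smul_zero, add_zero, genMap, LinearMap.comp_apply]
  congr 1
  exact ConcreteCategory.congr_hom ((K.map _).comm k (k + 1)) a

lemma diff_genMap_succ {n n' : ℤ} (h : n + 1 = n') {m j : ℕ} (f : Inj (j + 1) m)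
    (x : Smp S m) {k : ℤ} (hk : k = n + (j + 1 : ℕ)) (a : val K x k) :
    diff n n' h (genMap f x hk a) =
      genMap f x (k := k + 1) (n := n') (by lia) (valD K x k (k + 1) a) + (k.negOnePow : ℤ) •
        ∑ r : Fin (j + 2), (-1 : ℤ) ^ (r : ℕ) • genMap (face r ≫ f) x (n := n') (by lia) a := by
  rw [genMap, LinearMap.comp_apply, diff_gen, bdry_succ]
  simp only [genMap_valMap]
  congr 1
  simp only [genMap, LinearMap.comp_apply]
  congr 1
  exact ConcreteCategory.congr_hom ((K.map _).comm k (k + 1)) a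

lemma diff_diff {n n' n'' : ℤ} (h : n + 1 = n') (h' : n' + 1 = n'') (y : Tot K n) :
    diff n' n'' h' (diff n n' h y) = 0 := by
  suffices diff n' n'' h' ∘ₗ diff (K := K) n n' h = 0 from LinearMap.congr_fun this y
  refine hom_ext fun m x k hk a ↦ ?_
  have hd : valD K x (k + 1) (k + 1 + 1) (valD K x k (k + 1) a) = 0 :=
    ConcreteCategory.congr_hom ((K.obj _).d_comp_d _ _ _) a
  rw [LinearMap.comp_apply, diff_gen, map_add, diff_gen, hd, map_zero, zero_add,
    Int.negOnePow_succ, map_zsmul, LinearMap.zero_apply]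
  -- The boundary of a vertex is zero by definition, so double faces occur only from dimension 2 on.
  -- Dimension 1 contributes mixed terms only.
  obtain _ | _ | m := m
  · simp [bdry]
  · rw [bdry_succ, bdry_succ, map_sum]
    simp only [map_zsmul, diff_genMap_zero]
    simp
    abel
  · rw [bdry_succ, bdry_succ, map_sum]
    simp only [map_zsmul, diff_genMap_succ, smul_add, Finset.sum_add_distrib]
    rw [Units.val_neg, neg_smul, neg_add_cancel_left]
    refine (congrArg _ ?_).trans (smul_zero _)
    simp only [smul_comm _ (k.negOnePow : ℤ), ← Finset.smul_sum]
    refine (congrArg _ ?_).trans (smul_zero _)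
    simp only [Finset.smul_sum, smul_smul, ← pow_add]
    refine Eq.trans ?_ (sum_sum_alternating_eq_zero m (fun i j ↦
      genMap (face i ≫ face j) x (k := k) (n := n'') (by lia) a) ?_)
    · simp only [add_comm]
    · intro i j hij
      rw [face_comp_face i j hij]

end Tot

/-- The total complex of the chains of a semi-simplicial set with values in a system of
complexes. -/
@[simps X]
noncomputable def tot : CochainComplex (ModuleCat.{u} R) ℤ where
  X n := ModuleCat.of R (Tot K n)
  d n n' := if h : n + 1 = n' then ModuleCat.ofHom (Tot.diff n n' h) else 0
  shape n n' h := dif_neg h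
  d_comp_d' n n' n'' h h' := by
    simp only [ComplexShape.up_Rel] at h h'
    rw [dif_pos h, dif_pos h']
    exact ModuleCat.hom_ext (LinearMap.ext fun y ↦ Tot.diff_diff h h' y)

lemma tot_d {n n' : ℤ} (h : n + 1 = n') : ((tot K).d n n').hom = Tot.diff n n' h := by
  simp only [tot, dif_pos h]
  rfl

end

end MayerVietoris

/-! ### Functoriality of the total complex and invariance under quasi-isomorphisms -/

namespace MayerVietoris

section

variable {R : Type u} [Ring R] {S S' : SemiSimplexCategoryᵒᵖ ⥤ Type u}
  {K : S.Elements ⥤ CochainComplex (ModuleCat.{u} R) ℤ}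
  {K' : S'.Elements ⥤ CochainComplex (ModuleCat.{u} R) ℤ}

/-- The map on values induced by a map of systems of complexes. -/
def mapVal (f : S ⟶ S') (τ : K ⟶ NatTrans.mapElements f ⋙ K') {m : ℕ} (x : Smp S m) (k : ℤ) :
    val K x k →ₗ[R] val K' (m := m) (f.app _ x) k :=
  ((τ.app (smp x)).f k).hom

namespace Tot

/-- The map of total complexes induced by a map of semi-simplicial sets and a map of systems of
complexes. -/
noncomputable def map (f : S ⟶ S') (τ : K ⟶ NatTrans.mapElements f ⋙ K') (n : ℤ) :
    Tot K n →ₗ[R] Tot K' n :=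
  lift fun m x k hk ↦ gen (K := K') (m := m) (f.app _ x) hk ∘ₗ mapVal f τ x k

lemma map_gen (f : S ⟶ S') (τ : K ⟶ NatTrans.mapElements f ⋙ K') {n : ℤ} {m : ℕ} (x : Smp S m)
    {k : ℤ} (hk : k = n + m) (a : val K x k) :
    map f τ n (gen x hk a) =
      gen (K := K') (m := m) (f.app _ x) hk (mapVal f τ x k a) := by
  simp [map]

lemma map_genMap (f : S ⟶ S') (τ : K ⟶ NatTrans.mapElements f ⋙ K') {n : ℤ} {m j : ℕ}
    (g : Inj j m) (x : Smp S m) {k : ℤ} (hk : k = n + j) (a : val K x k) :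
    map f τ n (genMap g x hk a) =
      genMap (K := K') g (f.app _ x) hk (mapVal f τ x k a) := by
  rw [genMap, LinearMap.comp_apply, map_gen]
  let φ : smp x ⟶ smp (S.map g.op x) := ⟨g.op, rfl⟩
  have h := ConcreteCategory.congr_hom (HomologicalComplex.congr_hom (τ.naturality φ) k) a
  refine (congrArg (gen (K := K') (m := j) (f.app _ (S.map g.op x)) hk) h).trans ?_
  exact gen_valMap (S := S') (K := K') (x := (f.app _ x : Smp S' m))
    (y := (f.app _ (S.map g.op x) : Smp S' j)) ((NatTrans.mapElements f).map φ) hk _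

lemma map_bdry (f : S ⟶ S') (τ : K ⟶ NatTrans.mapElements f ⋙ K') {n : ℤ} {m : ℕ} (x : Smp S m)
    {k : ℤ} (hk : k + 1 = n + m) (a : val K x k) :
    map f τ n (bdry m x k hk a) =
      bdry (K := K') m (f.app _ x) k hk (mapVal f τ x k a) := by
  obtain _ | m := m
  · simp [bdry]
  · rw [bdry_succ, bdry_succ, map_sum]
    simp only [map_zsmul, map_genMap]

lemma diff_map (f : S ⟶ S') (τ : K ⟶ NatTrans.mapElements f ⋙ K') {n n' : ℤ} (h : n + 1 = n')
    (y : Tot K n) : diff n n' h (map f τ n y) = map f τ n' (diff n n' h y) := by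
  suffices diff n n' h ∘ₗ map f τ n = map f τ n' ∘ₗ diff n n' h from LinearMap.congr_fun this y
  refine hom_ext fun m x k hk a ↦ ?_
  rw [LinearMap.comp_apply, LinearMap.comp_apply, map_gen, diff_gen, diff_gen, map_add, map_zsmul,
    map_gen, map_bdry]
  congr 2
  exact ConcreteCategory.congr_hom ((τ.app (smp x)).comm k (k + 1)) a

end Tot

/-- Maps out of the total complex from compatible linear maps. -/
noncomputable def totDesc {L : CochainComplex (ModuleCat.{u} R) ℤ}
    (φ : ∀ n, Tot K n →ₗ[R] L.X n)
    (hφ : ∀ (n n' : ℤ) (h : n + 1 = n') (m : ℕ) (x : Smp S m) (k : ℤ) (hk : k = n + m)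
      (a : val K x k), (L.d n n').hom (φ n (Tot.gen x hk a)) =
        φ n' (Tot.diff n n' h (Tot.gen x hk a))) : tot K ⟶ L where
  f n := ModuleCat.ofHom (φ n)
  comm' n n' h := by
    refine ModuleCat.hom_ext (LinearMap.ext fun y ↦ ?_)
    suffices (L.d n n').hom ∘ₗ φ n = φ n' ∘ₗ Tot.diff n n' h from
      (LinearMap.congr_fun this y).trans (congrArg (φ n') (congrArg (fun f ↦ f y) (tot_d K h)).symm)
    exact Tot.hom_ext fun m x k hk a ↦ hφ n n' h m x k hk a

/-- Maps between total complexes from compatible linear maps. -/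
noncomputable def totHom (φ : ∀ n, Tot K n →ₗ[R] Tot K' n)
    (hφ : ∀ (n n' : ℤ) (h : n + 1 = n') (y : Tot K n),
      Tot.diff n n' h (φ n y) = φ n' (Tot.diff n n' h y)) : tot K ⟶ tot K' :=
  totDesc (L := tot K') φ fun n n' h _ _ _ _ _ ↦
    (DFunLike.congr_fun (tot_d K' h) _).trans (hφ n n' h _)

/-- The map of total complexes induced by a map of semi-simplicial sets and a map of systems of
complexes. -/
noncomputable def totMap (f : S ⟶ S') (τ : K ⟶ NatTrans.mapElements f ⋙ K') :
    tot K ⟶ tot K' :=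
  totHom (Tot.map f τ) fun _ _ h _ ↦ Tot.diff_map f τ h _

lemma tot_hom_ext {L : CochainComplex (ModuleCat.{u} R) ℤ} {φ ψ : tot K ⟶ L}
    (h : ∀ (n : ℤ) (m : ℕ) (x : Smp S m) (k : ℤ) (hk : k = n + m) (a : val K x k),
      (φ.f n).hom (Tot.gen x hk a) = (ψ.f n).hom (Tot.gen x hk a)) : φ = ψ := by
  ext n : 1
  exact ModuleCat.hom_ext (Tot.hom_ext (h n))

end

section

variable {R : Type u} [Ring R] {S : SemiSimplexCategoryᵒᵖ ⥤ Type u}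
  {K K' : S.Elements ⥤ CochainComplex (ModuleCat.{u} R) ℤ}

namespace Tot

/-- The component at a simplex. -/
noncomputable def comp {m : ℕ} (x : Smp S m) {k n : ℤ} (h : k = n + m) : Tot K n →ₗ[R] val K x k :=
  (ModuleCat.ofHom (h ▸ LinearMap.id) : val K x (n + m) ⟶ val K x k).hom ∘ₗ
    DirectSum.component R _ (fun s : Σ m : ℕ, Smp S m ↦ val K s.2 (n + s.1)) ⟨m, x⟩

lemma comp_rfl {n : ℤ} (s : Σ m : ℕ, Smp S m) (y : Tot K n) : comp s.2 rfl y = y s := rfl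

lemma comp_gen_self {m : ℕ} (x : Smp S m) {k n : ℤ} (h : k = n + m) (a : val K x k) :
    comp x h (gen x h a) = a := by
  classical
  subst h
  exact DirectSum.component.lof_self _ _ _

lemma comp_gen_of_ne {m m' : ℕ} (x : Smp S m) (x' : Smp S m') {k k' n : ℤ} (h : k = n + m)
    (h' : k' = n + m') (a : val K x k)
    (hx : (⟨m, x⟩ : Σ m : ℕ, Smp S m) ≠ ⟨m', x'⟩) : comp x' h' (gen x h a) = 0 := by
  classical
  subst h h'
  exact (DirectSum.component.of R _ _ _).trans (dif_neg hx)

lemma ext_comp {n : ℤ} {y z : Tot K n}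
    (h : ∀ (m : ℕ) (x : Smp S m), comp x rfl y = comp x rfl z) : y = z :=
  DFinsupp.ext fun s ↦ h s.1 s.2

lemma eq_sum_gen {n : ℤ} (y : Tot K n) : ∃ T : Finset (Σ m : ℕ, Smp S m),
    (∀ s ∈ T, comp s.2 rfl y ≠ 0) ∧ y = ∑ s ∈ T, gen s.2 rfl (comp s.2 rfl y) := by
  classical
  refine ⟨DFinsupp.support y, fun s hs ↦ DFinsupp.mem_support_iff.1 hs, ?_⟩
  exact (DirectSum.sum_support_of y).symm

/-- The differential in the highest dimension. -/
lemma comp_diff {n n' : ℤ} (h : n + 1 = n') {M m : ℕ} (hm : M ≤ m) (x : Smp S m) {k : ℤ}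
    (hk : k = n + m) {k' : ℤ} (hk' : k' = n' + m) (y : Tot K n)
    (hy : ∀ m, M < m → ∀ x : Smp S m, comp x rfl y = 0) :
    comp x hk' (diff n n' h y) = valD K x k k' (comp x hk y) := by
  obtain rfl : k' = k + 1 := by lia
  obtain ⟨T, hT, hyT⟩ := eq_sum_gen y
  rw [hyT]
  simp only [map_sum]
  refine Finset.sum_congr rfl fun s hs ↦ ?_
  obtain ⟨m', x'⟩ := s
  have hm' : m' ≤ M := by
    by_contra! h
    exact hT _ hs (hy _ h _)
  generalize comp x' rfl y = a
  rw [diff_gen, map_add, map_zsmul]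
  -- Faces of an `m'`-simplex have dimension less than `m' ≤ M ≤ m`, so they miss the component at
  -- `x`.
  have hb : comp x (k := k + 1) (n := n') (by lia) (bdry (n := n') m' x' _ (by lia) a) = 0 := by
    obtain _ | m' := m'
    · simp [bdry]
    · rw [bdry_succ, map_sum]
      refine Finset.sum_eq_zero fun r _ ↦ ?_
      rw [map_zsmul, genMap, LinearMap.comp_apply, comp_gen_of_ne, smul_zero]
      intro h
      have := congrArg Sigma.fst h
      dsimp at this
      lia
  rw [hb, smul_zero, add_zero]
  by_cases hs : (⟨m', x'⟩ : Σ m : ℕ, Smp S m) = ⟨m, x⟩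
  · obtain rfl := congrArg Sigma.fst hs
    obtain rfl := eq_of_heq (Sigma.mk.inj hs).2
    subst hk
    rw [comp_gen_self, comp_gen_self]
  · rw [comp_gen_of_ne _ _ _ _ _ hs, comp_gen_of_ne _ _ _ _ _ hs, map_zero]

end Tot

/-- A map of systems of complexes over one semi-simplicial set. -/
abbrev overId (τ : K ⟶ K') : K ⟶ NatTrans.mapElements (𝟙 S) ⋙ K' :=
  { app p := τ.app p, naturality _ _ f := τ.naturality f }

/-- The map on values induced by a map of systems of complexes. -/
def mapIdVal (τ : K ⟶ K') {m : ℕ} (x : Smp S m) (k : ℤ) : val K x k →ₗ[R] val K' x k :=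
  ((τ.app (smp x)).f k).hom

lemma Tot.mapId_gen (τ : K ⟶ K') {n : ℤ} {m : ℕ} (x : Smp S m) {k : ℤ} (hk : k = n + m)
    (a : val K x k) : Tot.map (𝟙 S) (overId τ) n (Tot.gen x hk a) =
      Tot.gen x hk (mapIdVal τ x k a) :=
  Tot.map_gen (𝟙 S) (overId τ) x hk a

lemma Tot.comp_mapId (τ : K ⟶ K') {n : ℤ} {m : ℕ} (x : Smp S m) {k : ℤ} (hk : k = n + m)
    (y : Tot K n) : Tot.comp x hk (Tot.map (𝟙 S) (overId τ) n y) =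
      mapIdVal τ x k (Tot.comp x hk y) := by
  suffices Tot.comp x hk ∘ₗ Tot.map (𝟙 S) (overId τ) n =
      mapIdVal τ x k ∘ₗ Tot.comp x hk from LinearMap.congr_fun this y
  refine hom_ext fun m' x' k' hk' a ↦ ?_
  simp only [LinearMap.comp_apply]
  rw [Tot.mapId_gen]
  by_cases hs : (⟨m', x'⟩ : Σ m : ℕ, Smp S m) = ⟨m, x⟩
  · obtain rfl := congrArg Sigma.fst hs
    obtain rfl := eq_of_heq (Sigma.mk.inj hs).2
    subst hk hk'
    rw [comp_gen_self, comp_gen_self]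
  · rw [comp_gen_of_ne _ _ _ _ _ hs, comp_gen_of_ne _ _ _ _ _ hs, map_zero]

/-- This assembles choices made separately at each simplex into an element of the direct sum,
provided that they vanish off one finite set. -/
lemma Tot.exists_of_comp {n : ℤ} (T : Finset (Σ m : ℕ, Smp S m))
    (c : ∀ (m : ℕ) (x : Smp S m), val K x (n + m))
    (hc : ∀ (m : ℕ) (x : Smp S m), c m x ≠ 0 → ⟨m, x⟩ ∈ T) :
    ∃ y : Tot K n, ∀ (m : ℕ) (x : Smp S m), comp x rfl y = c m x := by
  classical
  let β (s : Σ m : ℕ, Smp S m) : Type u := val K s.2 (n + s.1)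
  let f (s : (T : Set (Σ m : ℕ, Smp S m))) : β s := c s.1.1 s.1.2
  refine ⟨DirectSum.mk β T f, fun m x ↦ (comp_rfl ⟨m, x⟩ _).trans ?_⟩
  by_cases h : (⟨m, x⟩ : Σ m : ℕ, Smp S m) ∈ T
  · exact DirectSum.mk_apply_of_mem (f := f) h
  · refine (DirectSum.mk_apply_of_notMem (f := f) h).trans ?_
    by_contra h'
    exact h (hc m x (Ne.symm h'))

lemma Tot.exists_finset {n : ℤ} (y : Tot K n) : ∃ T : Finset (Σ m : ℕ, Smp S m),
    ∀ (m : ℕ) (x : Smp S m), comp x rfl y ≠ 0 → ⟨m, x⟩ ∈ T := by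
  classical
  exact ⟨DFinsupp.support y, fun m x h ↦ DFinsupp.mem_support_iff.2 h⟩

/-- Induction on a bound for the dimensions in the support. In the highest dimension the total
differential is the internal one, so the equations can be solved simplex by simplex with the
quasi-isomorphisms `τ`; subtracting these solutions lowers the bound. Every element has finite
support, so no boundedness of the complexes is needed. -/
lemma Tot.exists_of_quasiIso (τ : K ⟶ K') (hτ : ∀ p, QuasiIso (τ.app p)) (M : ℕ)
    {n₀ n n' n'' : ℤ} (h₀ : n₀ + 1 = n) (h : n + 1 = n') (h' : n' + 1 = n'')
    (y : Tot K n') (z : Tot K' n)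
    (hs₁ : ∀ m, M ≤ m → ∀ x : Smp S m, comp x rfl y = 0)
    (hs₂ : ∀ m, M ≤ m → ∀ x : Smp S m, comp x rfl z = 0)
    (hy : diff n' n'' h' y = 0) (hz : map (𝟙 S) (overId τ) n' y = diff n n' h z) :
    ∃ (y' : Tot K n) (z' : Tot K' n₀), diff n n' h y' = y ∧
      z = map (𝟙 S) (overId τ) n y' + diff n₀ n h₀ z' := by
  classical
  induction M generalizing y z with
  | zero =>
    obtain rfl : y = 0 := ext_comp fun m x ↦ (hs₁ m (Nat.zero_le _) x).trans (map_zero _).symm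
    obtain rfl : z = 0 := ext_comp fun m x ↦ (hs₂ m (Nat.zero_le _) x).trans (map_zero _).symm
    exact ⟨0, 0, by simp, by simp⟩
  | succ M ih =>
    -- The solutions are chosen to be zero wherever `y` and `z` vanish, which keeps the support
    -- finite, and outside dimension `M`, which leaves the other dimensions to the induction
    -- hypothesis.
    have key (m : ℕ) (x : Smp S m) : ∃ (y' : val K x (n + m)) (z' : val K' x (n₀ + m)),
        (comp x rfl y = 0 → comp x rfl z = 0 → y' = 0 ∧ z' = 0) ∧
        (m ≠ M → y' = 0 ∧ z' = 0) ∧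
        (m = M → valD K x (n + m) (n' + m) y' = comp x rfl y ∧
          comp x rfl z = mapIdVal τ x _ y' + valD K' x (n₀ + m) (n + m) z') := by
      by_cases hm : m = M
      · subst hm
        by_cases h0 : comp x rfl y = 0 ∧ comp x rfl z = 0
        · exact ⟨0, 0, fun _ _ ↦ ⟨rfl, rfl⟩, fun _ ↦ ⟨rfl, rfl⟩, fun _ ↦ by simp [h0.1, h0.2]⟩
        · have h₁ := comp_diff h' le_rfl x rfl rfl y hs₁
          rw [hy, map_zero] at h₁
          have h₂ := comp_mapId τ x rfl y
          rw [hz, comp_diff h le_rfl x rfl rfl z hs₂] at h₂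
          obtain ⟨y', z', hy', hz'⟩ := (quasiIso_iff_elements (τ.app (smp x))).1 (hτ _)
            (n₀ + m) (n + m) (n' + m) (n'' + m) (by lia) (by lia) (by lia)
            (comp x rfl y) (comp x rfl z) h₁.symm h₂.symm
          exact ⟨y', z', fun h1 h2 ↦ (h0 ⟨h1, h2⟩).elim, fun h ↦ (h rfl).elim,
            fun _ ↦ ⟨hy', hz'⟩⟩
      · exact ⟨0, 0, fun _ _ ↦ ⟨rfl, rfl⟩, fun _ ↦ ⟨rfl, rfl⟩, fun h ↦ (hm h).elim⟩
    choose y' z' h₁ h₂ h₃ using key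
    obtain ⟨T₁, hT₁⟩ := exists_finset y
    obtain ⟨T₂, hT₂⟩ := exists_finset z
    have hT (m : ℕ) (x : Smp S m) (hx : (⟨m, x⟩ : Σ m : ℕ, Smp S m) ∉ T₁ ∪ T₂) :
        y' m x = 0 ∧ z' m x = 0 := by
      rw [Finset.mem_union, not_or] at hx
      exact h₁ m x (not_not.1 fun h ↦ hx.1 (hT₁ m x h)) (not_not.1 fun h ↦ hx.2 (hT₂ m x h))
    obtain ⟨y₁, hy₁⟩ := exists_of_comp (T₁ ∪ T₂) y' fun m x h ↦
      not_not.1 fun hx ↦ h (hT m x hx).1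
    obtain ⟨z₁, hz₁⟩ := exists_of_comp (T₁ ∪ T₂) z' fun m x h ↦
      not_not.1 fun hx ↦ h (hT m x hx).2
    have hy₁' (m : ℕ) (hm : M < m) (x : Smp S m) : comp x rfl y₁ = 0 := by
      rw [hy₁, (h₂ m x hm.ne').1]
    have hz₁' (m : ℕ) (hm : M < m) (x : Smp S m) : comp x rfl z₁ = 0 := by
      rw [hz₁, (h₂ m x hm.ne').2]
    obtain ⟨y₂, z₂, hy₂, hz₂⟩ := ih (y - diff n n' h y₁)
      (z - map (𝟙 S) (overId τ) n y₁ - diff n₀ n h₀ z₁)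
      (fun m hm x ↦ by
        rw [map_sub, comp_diff h hm x rfl rfl y₁ hy₁', hy₁]
        obtain rfl | hm := hm.eq_or_lt
        · rw [(h₃ _ x rfl).1, sub_self]
        · rw [hs₁ m hm, (h₂ m x hm.ne').1, map_zero, sub_zero])
      (fun m hm x ↦ by
        rw [map_sub, map_sub, comp_diff h₀ hm x rfl rfl z₁ hz₁', hz₁, comp_mapId, hy₁]
        obtain rfl | hm := hm.eq_or_lt
        · rw [(h₃ _ x rfl).2, add_sub_cancel_left, sub_self]
        · rw [hs₂ m hm, (h₂ m x hm.ne').1, (h₂ m x hm.ne').2, map_zero, map_zero, sub_zero,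
            sub_zero])
      (by rw [map_sub, diff_diff, hy, sub_zero])
      (by rw [map_sub, map_sub, map_sub, diff_diff, hz, diff_map, sub_zero])
    refine ⟨y₁ + y₂, z₁ + z₂, by rw [map_add, hy₂, add_sub_cancel], ?_⟩
    rw [map_add, map_add, add_add_add_comm, ← hz₂]
    abel

/-- The total complex preserves quasi-isomorphisms of systems of complexes. -/
lemma quasiIso_totMap (τ : K ⟶ K') (hτ : ∀ p, QuasiIso (τ.app p)) :
    QuasiIso (totMap (𝟙 S) (overId τ)) := by
  classical
  rw [quasiIso_iff_elements]
  intro n₀ n n' n'' h₀ h h' y z hy hz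
  rw [tot_d K h'] at hy
  rw [tot_d K' h] at hz
  rw [tot_d K h, tot_d K' h₀]
  obtain ⟨T₁, hT₁⟩ := Tot.exists_finset y
  obtain ⟨T₂, hT₂⟩ := Tot.exists_finset z
  have hM (T : Finset (Σ m : ℕ, Smp S m)) (m : ℕ) (x : Smp S m)
      (hm : T.sup Sigma.fst < m) : (⟨m, x⟩ : Σ m : ℕ, Smp S m) ∉ T := fun h ↦
    (Finset.le_sup (f := Sigma.fst) h).not_gt hm
  exact Tot.exists_of_quasiIso τ hτ ((T₁ ∪ T₂).sup Sigma.fst + 1) h₀ h h' y z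
    (fun m hm x ↦ not_not.1 fun hx ↦ hM _ m x hm (Finset.mem_union_left _ (hT₁ m x hx)))
    (fun m hm x ↦ not_not.1 fun hx ↦ hM _ m x hm (Finset.mem_union_right _ (hT₂ m x hx))) hy hz

end
end MayerVietoris

/-! ### Augmentations of total complexes -/

namespace MayerVietoris

section

variable {R : Type u} [Ring R]

/-- The identification of the terms of a complex in equal degrees. -/
def degCast (L : CochainComplex (ModuleCat.{u} R) ℤ) {k n : ℤ} (h : k = n) : L.X k →ₗ[R] L.X n :=
  (L.XIsoOfEq h).hom.hom

@[simp]
lemma degCast_rfl (L : CochainComplex (ModuleCat.{u} R) ℤ) {k : ℤ} (a : L.X k) :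
    degCast L rfl a = a := by
  simp [degCast]

lemma degCast_d (L : CochainComplex (ModuleCat.{u} R) ℤ) {k n k' n' : ℤ} (h : k = n)
    (h' : k' = n') (a : L.X k) :
    (L.d n n').hom (degCast L h a) = degCast L h' ((L.d k k').hom a) := by
  subst h h'
  simp

lemma degCast_map {L L' : CochainComplex (ModuleCat.{u} R) ℤ} (φ : L ⟶ L') {k n : ℤ} (h : k = n)
    (a : L.X k) : (φ.f n).hom (degCast L h a) = degCast L' h ((φ.f k).hom a) := by
  subst h
  simp

/-- Since `i` is a chain map that splits `f`, only injectivity of `f` on homology is in question.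
For this a homotopy is needed on cycles only. -/
lemma quasiIso_of_contraction {K L : CochainComplex (ModuleCat.{u} R) ℤ} (f : K ⟶ L)
    (i : ∀ n, L.X n →ₗ[R] K.X n)
    (hi : ∀ n n' (_ : n + 1 = n') z, (K.d n n').hom (i n z) = i n' ((L.d n n').hom z))
    (hfi : ∀ n z, (f.f n).hom (i n z) = z)
    (h : ∀ n n' n'' (_ : n + 1 = n') (_ : n' + 1 = n'') (y : K.X n'), (K.d n' n'').hom y = 0 →
      ∃ w, y = i n' ((f.f n').hom y) + (K.d n n').hom w) : QuasiIso f := by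
  rw [quasiIso_iff_elements]
  intro n₀ n n' n'' h₀ h₁ h₂ y z hy hz
  obtain ⟨w, hw⟩ := h n n' n'' h₁ h₂ y hy
  -- The correction by `i` makes the image under `f` equal to `z`. It leaves `d w + i (f y) = y` as
  -- differential, because `f (d w) = 0` by the splitting.
  refine ⟨w + i n z - i n ((f.f n).hom w), 0, ?_, ?_⟩
  · have hf : (L.d n n').hom ((f.f n).hom w) = (f.f n').hom ((K.d n n').hom w) :=
      ConcreteCategory.congr_hom (f.comm n n') w
    have : (f.f n').hom ((K.d n n').hom w) = 0 := by
      have := congrArg (f.f n').hom hw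
      rw [map_add, hfi] at this
      simpa using this
    rw [map_sub, map_add, hi _ _ h₁, hi _ _ h₁, hf, this, map_zero, sub_zero, ← hz, add_comm]
    exact hw.symm
  · rw [map_sub, map_add, hfi, hfi]
    simp

variable {S : SemiSimplexCategoryᵒᵖ ⥤ Type u}
  {K : S.Elements ⥤ CochainComplex (ModuleCat.{u} R) ℤ}
  {L : CochainComplex (ModuleCat.{u} R) ℤ}

/-- The value at a simplex of an augmentation. -/
def augVal (ζ : K ⟶ (Functor.const _).obj L) {m : ℕ} (x : Smp S m) (k : ℤ) :
    val K x k →ₗ[R] L.X k :=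
  ((ζ.app (smp x)).f k).hom

lemma augVal_valMap (ζ : K ⟶ (Functor.const _).obj L) {m j : ℕ} {x : Smp S m} {y : Smp S j}
    (φ : smp x ⟶ smp y) {k : ℤ} (a : val K x k) :
    augVal ζ y k (valMap K φ k a) = augVal ζ x k a := by
  have := ConcreteCategory.congr_hom (HomologicalComplex.congr_hom (ζ.naturality φ) k) a
  exact this

lemma augVal_valD (ζ : K ⟶ (Functor.const _).obj L) {m : ℕ} (x : Smp S m) {k k' : ℤ}
    (a : val K x k) : (L.d k k').hom (augVal ζ x k a) = augVal ζ x k' (valD K x k k' a) :=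
  ConcreteCategory.congr_hom ((ζ.app (smp x)).comm k k') a

/-- The augmentation of the total complex, as linear maps. -/
noncomputable def Tot.aug (ζ : K ⟶ (Functor.const _).obj L) (n : ℤ) : Tot K n →ₗ[R] L.X n :=
  lift fun m x k hk ↦ match m, x, hk with
    | 0, x, hk => degCast L (by simpa using hk) ∘ₗ augVal ζ x k
    | _ + 1, _, _ => 0

lemma Tot.aug_gen_zero (ζ : K ⟶ (Functor.const _).obj L) {k n : ℤ} (x : Smp S 0)
    (hk : k = n + (0 : ℕ)) (a : val K x k) :
    aug ζ n (gen x hk a) = degCast L (by simpa using hk) (augVal ζ x k a) := by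
  rw [aug, lift_gen]
  rfl

lemma Tot.aug_gen_succ (ζ : K ⟶ (Functor.const _).obj L) {k n : ℤ} {m : ℕ} (x : Smp S (m + 1))
    (hk : k = n + (m + 1 : ℕ)) (a : val K x k) :
    aug ζ n (gen x hk a) = 0 := by
  rw [aug, lift_gen]
  rfl

lemma Tot.aug_genMap_zero (ζ : K ⟶ (Functor.const _).obj L) {k n : ℤ} {m : ℕ} (f : Inj 0 m)
    (x : Smp S m) (hk : k = n + (0 : ℕ)) (a : val K x k) :
    aug ζ n (genMap f x hk a) = degCast L (by simpa using hk) (augVal ζ x k a) := by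
  rw [genMap, LinearMap.comp_apply, aug_gen_zero, augVal_valMap]

lemma Tot.aug_genMap_succ (ζ : K ⟶ (Functor.const _).obj L) {k n : ℤ} {m j : ℕ} (f : Inj (j + 1) m)
    (x : Smp S m) (hk : k = n + (j + 1 : ℕ)) (a : val K x k) :
    aug ζ n (genMap f x hk a) = 0 := by
  rw [genMap, LinearMap.comp_apply, aug_gen_succ]

/-- The augmentation of the total complex given by a map to a constant system. -/
noncomputable def totAug (ζ : K ⟶ (Functor.const _).obj L) : tot K ⟶ L :=
  totDesc (Tot.aug ζ) fun n n' h m x k hk a ↦ by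
    rw [Tot.diff_gen, map_add, map_zsmul]
    obtain _ | _ | m := m
    · rw [Tot.aug_gen_zero, Tot.aug_gen_zero]
      simp only [Tot.bdry, LinearMap.zero_apply, map_zero, smul_zero, add_zero]
      rw [degCast_d L _ (k' := k + 1) (by simp [← h, hk]), augVal_valD]
    -- The two endpoints of an edge have equal augmentations and opposite signs.
    · rw [Tot.aug_gen_succ, Tot.aug_gen_succ, Tot.bdry_succ, map_sum]
      simp only [map_zsmul, Tot.aug_genMap_zero]
      simp
    · rw [Tot.aug_gen_succ, Tot.aug_gen_succ, Tot.bdry_succ, map_sum]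
      simp only [map_zsmul, Tot.aug_genMap_succ]
      simp

lemma totAug_gen_zero (ζ : K ⟶ (Functor.const _).obj L) {k n : ℤ} (x : Smp S 0)
    (hk : k = n + (0 : ℕ)) (a : val K x k) : ((totAug ζ).f n).hom (Tot.gen x hk a) =
      degCast L (by simpa using hk) (augVal ζ x k a) :=
  Tot.aug_gen_zero ζ x hk a

lemma totAug_gen_succ (ζ : K ⟶ (Functor.const _).obj L) {k n : ℤ} {m : ℕ} (x : Smp S (m + 1))
    (hk : k = n + (m + 1 : ℕ)) (a : val K x k) :
    ((totAug ζ).f n).hom (Tot.gen x hk a) = 0 :=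
  Tot.aug_gen_succ ζ x hk a

lemma Tot.induction {n : ℤ} {P : Tot K n → Prop} (y : Tot K n) (h0 : P 0)
    (hadd : ∀ y z, P y → P z → P (y + z))
    (hgen : ∀ (m : ℕ) (x : Smp S m) (k : ℤ) (hk : k = n + m) (a : val K x k), P (gen x hk a)) :
    P y := by
  obtain ⟨T, -, hy⟩ := eq_sum_gen y
  rw [hy]
  exact Finset.sum_induction _ P hadd h0 fun s _ ↦ hgen _ _ _ _ _

end

/-! ### Equivariant chains as complexes of smooth representations -/

section

variable {R : Type u} [Ring R] {G : Type u} [Group G] (X : GSemiSimplicialSet G)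

/-- The inclusion of the category of simplices into the equivariant category of simplices. -/
@[simps]
def inclElements : (underlying X).Elements ⥤ X.Elements where
  obj p := ⟨(p.1, SingleObj.star G), p.2⟩
  map φ := ⟨(φ.1, 𝟙 _), φ.2⟩
  map_comp φ ψ := by
    apply CategoryOfElements.ext
    exact Prod.ext rfl (Category.comp_id _).symm

/-- The action of an element of the group on the underlying semi-simplicial set. -/
def act (g : G) : underlying X ⟶ underlying X where
  app n := X.map ((𝟙 n, g) : (n, SingleObj.star G) ⟶ (n, SingleObj.star G))
  naturality n n' f := by
    refine (X.map_comp _ _).symm.trans (Eq.trans ?_ (X.map_comp _ _))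
    congr 1
    exact Prod.ext ((Category.comp_id _).trans (Category.id_comp _).symm)
      ((mul_one g).trans (one_mul g).symm)

/-- The map on terms given by a functor to complexes. -/
abbrev mapEl {C : Type*} [Category C] (T : C ⥤ CochainComplex (ModuleCat.{u} R) ℤ) {p p' : C}
    (φ : p ⟶ p') (k : ℤ) : (T.obj p).X k →ₗ[R] (T.obj p').X k :=
  ((T.map φ).f k).hom

lemma mapEl_id {C : Type*} [Category C] (T : C ⥤ CochainComplex (ModuleCat.{u} R) ℤ) {p : C}
    {k : ℤ} (a : (T.obj p).X k) : mapEl T (𝟙 p) k a = a := by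
  simp [mapEl]

lemma mapEl_comp {C : Type*} [Category C] (T : C ⥤ CochainComplex (ModuleCat.{u} R) ℤ)
    {p p' p'' : C} (φ : p ⟶ p') (ψ : p' ⟶ p'') {k : ℤ} (a : (T.obj p).X k) :
    mapEl T (φ ≫ ψ) k a = mapEl T ψ k (mapEl T φ k a) := by
  simp [mapEl]

lemma mapEl_naturality {C : Type*} [Category C] {T T' : C ⥤ CochainComplex (ModuleCat.{u} R) ℤ}
    (τ : T ⟶ T') {p p' : C} (φ : p ⟶ p') {k : ℤ} (a : (T.obj p).X k) :
    ((τ.app p').f k).hom (mapEl T φ k a) = mapEl T' φ k (((τ.app p).f k).hom a) :=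
  ConcreteCategory.congr_hom (HomologicalComplex.congr_hom (τ.naturality φ) k) a

variable {X}

/-- A simplex as an object of the equivariant category of simplices. -/
abbrev eqSmp {m : ℕ} (x : Smp (underlying X) m) : X.Elements := (inclElements X).obj (smp x)

/-- The translate of a simplex. -/
def translate (g : G) {m : ℕ} (x : Smp (underlying X) m) : Smp (underlying X) m :=
  (act X g).app _ x

/-- A simplex and its translate are isomorphic in the equivariant category of simplices. -/
def translateHom (g : G) {m : ℕ} (x : Smp (underlying X) m) : eqSmp x ⟶ eqSmp (translate g x) :=
  ⟨(𝟙 _, g), rfl⟩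

/-- Two morphisms given by the same face operator and group element may have targets that are equal
only propositionally. This compares the resulting chains; the functoriality of the action rests on
it. -/
lemma gen_map_congr (T : X.Elements ⥤ CochainComplex (ModuleCat.{u} R) ℤ) {p : X.Elements} {m : ℕ}
    {y y' : Smp (underlying X) m} (φ : p ⟶ eqSmp y)
    (φ' : p ⟶ eqSmp y') (hφ : φ.1 = φ'.1) {k n : ℤ} (hk : k = n + m)
    (a : (T.obj p).X k) :
    Tot.gen (K := inclElements X ⋙ T) y hk (mapEl T φ k a) =
      Tot.gen (K := inclElements X ⋙ T) y' hk (mapEl T φ' k a) := by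
  obtain ⟨φ, hy⟩ := φ
  obtain ⟨φ', hy'⟩ := φ'
  obtain rfl : φ = φ' := hφ
  obtain rfl : y = y' := hy.symm.trans hy'
  rfl

variable (X) in
/-- The natural map of systems of complexes given by translation. -/
def actSystem (T : X.Elements ⥤ CochainComplex (ModuleCat.{u} R) ℤ) (g : G) :
    inclElements X ⋙ T ⟶ NatTrans.mapElements (act X g) ⋙ inclElements X ⋙ T where
  app p := T.map (Y := (inclElements X).obj ((NatTrans.mapElements (act X g)).obj p))
    ⟨(𝟙 p.1, g), rfl⟩
  naturality p p' φ := by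
    refine (T.map_comp _ _).symm.trans (Eq.trans ?_ (T.map_comp _ _))
    congr 1
    apply CategoryOfElements.ext
    exact Prod.ext ((Category.comp_id _).trans (Category.id_comp _).symm)
      ((mul_one g).trans (one_mul g).symm)

/-- The translation of chains. -/
noncomputable def chainsAct (T : X.Elements ⥤ CochainComplex (ModuleCat.{u} R) ℤ) (g : G) :
    tot (inclElements X ⋙ T) ⟶ tot (inclElements X ⋙ T) :=
  totMap (act X g) (actSystem X T g)

lemma chainsAct_gen (T : X.Elements ⥤ CochainComplex (ModuleCat.{u} R) ℤ) (g : G) {n : ℤ} {m : ℕ}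
    (x : Smp (underlying X) m) {k : ℤ} (hk : k = n + m) (a : (T.obj (eqSmp x)).X k) :
    ((chainsAct T g).f n).hom (Tot.gen (K := inclElements X ⋙ T) x hk a) =
      Tot.gen (K := inclElements X ⋙ T) (translate g x) hk (mapEl T (translateHom g x) k a) :=
  Tot.map_gen _ _ _ _ _

/-- The complex of chains with values in a system of complexes, with its action of the group. -/
@[simps]
noncomputable def chainsObj (T : X.Elements ⥤ CochainComplex (ModuleCat.{u} R) ℤ) :
    SingleObj G ⥤ CochainComplex (ModuleCat.{u} R) ℤ where
  obj _ := tot (inclElements X ⋙ T)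
  map g := chainsAct T g
  map_id _ := by
    refine tot_hom_ext fun n m x k hk a ↦ (chainsAct_gen T _ x hk a).trans ?_
    refine (gen_map_congr T (translateHom (1 : G) x) (𝟙 (eqSmp x)) rfl hk a).trans ?_
    rw [mapEl_id]
    rfl
  map_comp g h := by
    refine tot_hom_ext fun n m x k hk a ↦ (chainsAct_gen T _ x hk a).trans ?_
    refine Eq.trans ?_ ((congrArg ((chainsAct T h).f n).hom (chainsAct_gen T g x hk a)).trans
      (chainsAct_gen T _ _ hk _)).symm
    refine (gen_map_congr T (translateHom (show G from g ≫ h) x)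
      (translateHom (show G from g) x ≫
        translateHom (show G from h) (translate (show G from g) x)) ?_ hk a).trans ?_
    · exact Prod.ext (Category.comp_id _).symm rfl
    · rw [mapEl_comp]

/-- The map of chains induced by a map of systems of complexes. -/
noncomputable def chainsMap {T T' : X.Elements ⥤ CochainComplex (ModuleCat.{u} R) ℤ}
    (τ : T ⟶ T') : tot (inclElements X ⋙ T) ⟶ tot (inclElements X ⋙ T') :=
  totMap (𝟙 _) (overId (Functor.whiskerLeft (inclElements X) τ))

lemma chainsMap_gen {T T' : X.Elements ⥤ CochainComplex (ModuleCat.{u} R) ℤ} (τ : T ⟶ T') {n : ℤ}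
    {m : ℕ} (x : Smp (underlying X) m) {k : ℤ} (hk : k = n + m) (a : (T.obj (eqSmp x)).X k) :
    ((chainsMap τ).f n).hom (Tot.gen (K := inclElements X ⋙ T) x hk a) =
      Tot.gen (K := inclElements X ⋙ T') x hk (((τ.app (eqSmp x)).f k).hom a) :=
  Tot.mapId_gen _ _ _ _

variable (X R) in
/-- The functor of chains on systems of complexes. -/
@[simps]
noncomputable def chains : (X.Elements ⥤ CochainComplex (ModuleCat.{u} R) ℤ) ⥤
    SingleObj G ⥤ CochainComplex (ModuleCat.{u} R) ℤ where
  obj T := chainsObj T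
  map {T T'} τ :=
    { app _ := chainsMap τ
      naturality _ _ g := by
        refine tot_hom_ext fun n m x k hk a ↦ ?_
        refine (congrArg ((chainsMap τ).f n).hom (chainsAct_gen T g x hk a)).trans ?_
        refine Eq.trans ?_ (congrArg ((chainsAct T' g).f n).hom (chainsMap_gen τ x hk a)).symm
        refine (chainsMap_gen _ _ _ _).trans (Eq.trans ?_ (chainsAct_gen _ _ _ _ _).symm)
        rw [mapEl_naturality] }
  map_id T := by
    ext s : 2
    refine tot_hom_ext fun n m x k hk a ↦ ?_
    exact chainsMap_gen _ _ _ _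
  map_comp τ σ := by
    ext s : 2
    refine tot_hom_ext fun n m x k hk a ↦ ?_
    refine (chainsMap_gen _ _ _ _).trans ?_
    refine Eq.trans ?_ (congrArg ((chainsMap σ).f n).hom (chainsMap_gen τ x hk a)).symm
    exact (chainsMap_gen σ x hk _).symm

lemma quasiIso_chainsMap {T T' : X.Elements ⥤ CochainComplex (ModuleCat.{u} R) ℤ} (τ : T ⟶ T')
    (hτ : ∀ p, QuasiIso (τ.app p)) : QuasiIso (chainsMap τ) :=
  quasiIso_totMap _ fun p ↦ hτ ((inclElements X).obj p)

variable [TopologicalSpace G]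

/-- A chain is a finite sum of generators, and finite intersections of neighbourhoods suffice. Near
`1` the group fixes the simplex `x` of a generator, because its stabilizer is open. It then acts on
the generator through endomorphisms of `x`, where smoothness of the coefficients applies. -/
lemma isSmoothComplex_chainsObj (hX : HasOpenStabilizers X)
    (T : X.Elements ⥤ CochainComplex (ModuleCat.{u} R) ℤ) (hT : IsSmoothComplex (toBG X) T) :
    IsSmoothComplex (𝟭 (SingleObj G)) (chainsObj T) := by
  intro n c (y : Tot (inclElements X ⋙ T) n)
  change ∃ U ∈ 𝓝 (1 : G), ∀ g : G, g ∈ U → ((chainsAct T g).f n).hom y = y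
  refine Tot.induction (P := fun y ↦ ∃ U ∈ 𝓝 (1 : G), ∀ g : G, g ∈ U →
    ((chainsAct T g).f n).hom y = y) y ⟨Set.univ, Filter.univ_mem, fun g _ ↦ map_zero _⟩ ?_ ?_
  · rintro y z ⟨U, hU, hy⟩ ⟨V, hV, hz⟩
    exact ⟨U ∩ V, Filter.inter_mem hU hV, fun g hg ↦
      (map_add ((chainsAct T g).f n).hom y z).trans (congrArg₂ _ (hy g hg.1) (hz g hg.2))⟩
  · intro m x k hk a
    obtain ⟨U, hU, ha⟩ := hT k (eqSmp x) a
    refine ⟨U ∩ {g | translate g x = x}, Filter.inter_mem hU ((hX _ x).mem_nhds ?_), ?_⟩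
    · exact ConcreteCategory.congr_hom (X.map_id _) x
    · rintro g ⟨hg, hgx⟩
      refine (chainsAct_gen T g x hk a).trans ?_
      let φ : eqSmp x ⟶ eqSmp x := ⟨(𝟙 _, g), hgx⟩
      refine (gen_map_congr T (translateHom g x) φ rfl hk a).trans ?_
      exact congrArg _ (ha φ hg)

end

section

variable (R : Type u) [Ring R] {G : Type u} [Group G] [TopologicalSpace G]
  (X : GSemiSimplicialSet G)

/-- The functor of chains on complexes of smooth coefficients. -/
noncomputable def smoothChains (hX : HasOpenStabilizers X) :
    CochainComplex (SmoothCoefficients R X) ℤ ⥤ CochainComplex (SmoothRep R G) ℤ :=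
  liftPointwise (pointwise R (toBG X) ⋙ chains R X) fun K ↦
    isSmoothComplex_chainsObj hX _ (isSmoothComplex_pointwise K)

/-- Restriction of complexes of smooth representations. -/
noncomputable abbrev restrictionComplex :
    CochainComplex (SmoothRep R G) ℤ ⥤ CochainComplex (SmoothCoefficients R X) ℤ :=
  (restriction R X).mapHomologicalComplex (ComplexShape.up ℤ)

/-- The augmentation of the system of complexes restricted from a complex of representations. -/
noncomputable def restrictAug (V : CochainComplex (SmoothRep R G) ℤ) :
    inclElements X ⋙ (pointwise R (toBG X)).obj ((restrictionComplex R X).obj V) ⟶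
      (Functor.const _).obj (((pointwise R _).obj V).obj (SingleObj.star G)) where
  app _ := 𝟙 _
  naturality p p' φ := by
    refine (Category.comp_id _).trans (Eq.trans ?_ (Category.id_comp _).symm)
    exact ((pointwise R (𝟭 (SingleObj G))).obj V).map_id _

/-- The augmentation of the chains with values in a restricted complex of representations. -/
noncomputable def chainsAug (hX : HasOpenStabilizers X) :
    restrictionComplex R X ⋙ smoothChains R X hX ⟶ 𝟭 _ where
  app V := (fullyFaithfulPointwise R _).preimage
    (X := (smoothChains R X hX).obj ((restrictionComplex R X).obj V)) (Y := V)
    { app _ := totAug (restrictAug R X V)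
      naturality _ _ g := by
        refine tot_hom_ext fun n m x k hk a ↦ ?_
        refine (congrArg ((totAug (restrictAug R X V)).f n).hom
          (chainsAct_gen (pointwiseObj ((restrictionComplex R X).obj V)) g x hk a)).trans ?_
        obtain _ | m := m
        · refine (totAug_gen_zero _ _ _ _).trans ?_
          refine Eq.trans ?_ (congrArg (((pointwiseObj V).map g).f n).hom
            (totAug_gen_zero (restrictAug R X V) x hk a).symm)
          exact (degCast_map ((pointwiseObj V).map g) _ _).symm
        · refine (totAug_gen_succ _ _ _ _).trans ?_
          refine Eq.trans ?_ (congrArg (((pointwiseObj V).map g).f n).hom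
            (totAug_gen_succ (restrictAug R X V) x hk a).symm)
          exact (map_zero _).symm }
  naturality V V' f := by
    apply (fullyFaithfulPointwise R _).map_injective
    ext s : 2
    refine tot_hom_ext fun n m x k hk a ↦ ?_
    refine (congrArg ((totAug (restrictAug R X V')).f n).hom (chainsMap_gen
      ((pointwise R (toBG X)).map ((restrictionComplex R X).map f)) x hk a)).trans ?_
    obtain _ | m := m
    · refine (totAug_gen_zero _ _ _ _).trans ?_
      refine Eq.trans ?_ (congrArg ((f.f n).hom.app s).hom
        (totAug_gen_zero (restrictAug R X V) x hk a).symm)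
      exact (degCast_map (((pointwise R _).map f).app s) _ _).symm
    · refine (totAug_gen_succ _ _ _ _).trans ?_
      refine Eq.trans ?_ (congrArg ((f.f n).hom.app s).hom
        (totAug_gen_succ (restrictAug R X V) x hk a).symm)
      exact (map_zero _).symm

end

end MayerVietoris

/-! ### The bar resolution of a system of complexes -/

namespace MayerVietoris

/-- The monotone map given by a face inclusion. -/
abbrev ordHom {n n' : SemiSimplexCategory} (f : n ⟶ n') : Fin (n.len + 1) →o Fin (n'.len + 1) :=
  (SemiSimplexCategory.homEquiv f).toOrderHom

lemma ordHom_comp {n n' n'' : SemiSimplexCategory} (f : n ⟶ n') (g : n' ⟶ n'') :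
    ordHom (f ≫ g) = (ordHom g).comp (ordHom f) := by
  rw [ordHom, SemiSimplexCategory.homEquiv_comp]
  rfl

section

variable {G : Type u} [Group G] {X : GSemiSimplicialSet G}

/-- The simplices of the bar resolution at a simplex `p`: chains of simplices that contain `p`. -/
structure BarSmp (p : X.Elements) (n : SemiSimplexCategory) : Type u where
  /-- the dimensions of the simplices of the chain -/
  F : Fin (n.len + 1) ⥤ SemiSimplexCategory
  /-- the inclusion of `p` into the first simplex of the chain -/
  t : p.1.1.unop ⟶ F.obj 0
  /-- the last simplex of the chain -/
  top : (underlying X).obj (op (F.obj (Fin.last _)))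
  map_top : (underlying X).map (t ≫ F.map (homOfLE (Fin.zero_le _))).op top = p.2

namespace BarSmp

lemma ext_of_eq {p : X.Elements} {n : SemiSimplexCategory} {b b' : BarSmp p n} (hF : b.F = b'.F)
    (ht : HEq b.t b'.t) (htop : HEq b.top b'.top) : b = b' := by
  obtain ⟨F, t, x, h⟩ := b
  obtain ⟨F', t', x', h'⟩ := b'
  obtain rfl : F = F' := hF
  obtain rfl : t = t' := eq_of_heq ht
  obtain rfl : x = x' := eq_of_heq htop
  rfl

/-- The face of a chain. -/
@[simps]
def face {p : X.Elements} {n n' : SemiSimplexCategory} (f : Fin (n'.len + 1) →o Fin (n.len + 1))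
    (b : BarSmp p n) : BarSmp p n' where
  F := f.monotone.functor ⋙ b.F
  t := b.t ≫ b.F.map (homOfLE (Fin.zero_le _))
  top := (underlying X).map (b.F.map (homOfLE (Fin.le_last _))).op b.top
  map_top := by
    refine (ConcreteCategory.congr_hom ((underlying X).map_comp _ _) _).symm.trans
      (Eq.trans ?_ b.map_top)
    rw [← op_comp]
    dsimp only [Functor.comp_map]
    rw [Category.assoc, Category.assoc, ← Functor.map_comp, ← Functor.map_comp]
    rfl

/-- The chain obtained by translation and restriction of the base simplex. -/
@[simps]
def push {p p' : X.Elements} (φ : p ⟶ p') {n : SemiSimplexCategory} (b : BarSmp p n) :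
    BarSmp p' n where
  F := b.F
  t := φ.1.1.unop ≫ b.t
  top := (act X φ.1.2).app _ b.top
  map_top := by
    have hb :
        X.map ((b.t ≫ b.F.map (homOfLE (Fin.zero_le _))).op, 𝟙 (SingleObj.star G)) b.top = p.2 :=
      b.map_top
    refine Eq.trans ?_ ((congrArg (X.map φ.1) hb).trans φ.2)
    refine (ConcreteCategory.congr_hom (X.map_comp _ _) _).symm.trans
      (Eq.trans ?_ (ConcreteCategory.congr_hom (X.map_comp _ _) _))
    refine congrArg (fun f ↦ X.map f b.top) (Prod.ext ?_ ?_)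
    · simp
    · exact (Category.comp_id _).trans (Category.id_comp _).symm

end BarSmp

/-- The bar resolution of a simplex. -/
@[reducible] def bar (p : X.Elements) : SemiSimplexCategoryᵒᵖ ⥤ Type u where
  obj n := BarSmp p n.unop
  map f := ↾fun b ↦ b.face (ordHom f.unop)
  map_id n := by
    ext b
    refine BarSmp.ext_of_eq rfl (heq_of_eq ?_) (heq_of_eq ?_)
    · exact (congrArg _ (b.F.map_id _)).trans (Category.comp_id _)
    · refine (congrArg (fun f ↦ (underlying X).map f.op b.top) (b.F.map_id _)).trans ?_
      exact ConcreteCategory.congr_hom ((underlying X).map_id _) _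
  map_comp f g := by
    ext b
    refine (congrArg (fun φ ↦ BarSmp.face φ b) (ordHom_comp g.unop f.unop)).trans ?_
    refine BarSmp.ext_of_eq rfl (heq_of_eq ?_) (heq_of_eq ?_)
    · change b.t ≫ b.F.map _ = (b.t ≫ b.F.map _) ≫ b.F.map _
      rw [Category.assoc]
      exact congrArg _ (b.F.map_comp _ _)
    · refine Eq.trans ?_ (ConcreteCategory.congr_hom ((underlying X).map_comp _ _) _)
      refine congrArg (fun f ↦ (underlying X).map f b.top) ?_
      refine Eq.trans ?_ op_comp
      exact congrArg Quiver.Hom.op (b.F.map_comp _ _)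

/-- The map of bar resolutions induced by a morphism of simplices. -/
def barMap {p p' : X.Elements} (φ : p ⟶ p') : bar p ⟶ bar p' where
  app n := ↾fun b ↦ BarSmp.push φ b
  naturality n n' f := by
    ext b
    refine BarSmp.ext_of_eq rfl (heq_of_eq ?_) (heq_of_eq ?_)
    · exact (Category.assoc _ _ _).symm
    · exact ConcreteCategory.congr_hom ((act X φ.1.2).naturality _) b.top

namespace BarSmp

variable {p : X.Elements}

/-- The last simplex of a chain, as an object of the category of simplices. -/
def topEl {n : SemiSimplexCategory} (b : BarSmp p n) : (underlying X).Elements :=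
  ⟨op (b.F.obj (Fin.last _)), b.top⟩

/-- The restriction from the last simplex of a chain to the last simplex of a face. -/
def faceHom {n n' : SemiSimplexCategory} (f : Fin (n'.len + 1) →o Fin (n.len + 1))
    (b : BarSmp p n) : b.topEl ⟶ (b.face f : BarSmp p n').topEl :=
  ⟨(b.F.map (homOfLE (Fin.le_last _))).op, rfl⟩

/-- The restriction from the last simplex of a chain to the last simplex of a face. -/
def faceTo {n n' : SemiSimplexCategory} (f : Fin (n'.len + 1) →o Fin (n.len + 1))
    (b : BarSmp p n) (b' : BarSmp p n') (h : b.face f = b') : b.topEl ⟶ b'.topEl :=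
  h ▸ faceHom f b

lemma faceTo_val_heq {n n' : SemiSimplexCategory} (f : Fin (n'.len + 1) →o Fin (n.len + 1))
    {b : BarSmp p n} {b' : BarSmp p n'} (h : b.face f = b') :
    (faceTo f b b' h).1 ≍ (b.F.map (homOfLE (Fin.le_last (f (Fin.last _))))).op := by
  subst h
  rfl

lemma faceTo_comp {n n' n'' : SemiSimplexCategory} (f : Fin (n'.len + 1) →o Fin (n.len + 1))
    (g : Fin (n''.len + 1) →o Fin (n'.len + 1)) (e : Fin (n''.len + 1) →o Fin (n.len + 1))
    (he : e = f.comp g) {b : BarSmp p n} {b' : BarSmp p n'}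
    {b'' : BarSmp p n''} (h : b.face f = b') (h' : b'.face g = b'')
    (h'' : b.face e = b'') : faceTo e b b'' h'' = faceTo f b b' h ≫ faceTo g b' b'' h' := by
  subst he h h'
  apply CategoryOfElements.ext
  refine eq_of_heq ((faceTo_val_heq _ h'').trans (heq_of_eq ?_))
  exact congrArg Quiver.Hom.op (b.F.map_comp _ _)

end BarSmp

/-- The last simplex of a chain. -/
def barTop (p : X.Elements) : (bar p).Elements ⥤ (underlying X).Elements where
  obj b := BarSmp.topEl b.2
  map {b b'} φ := BarSmp.faceTo (ordHom φ.1.unop) b.2 b'.2 φ.2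
  map_id b := by
    apply CategoryOfElements.ext
    refine eq_of_heq ((BarSmp.faceTo_val_heq (p := p) _ _).trans (heq_of_eq ?_))
    exact congrArg Quiver.Hom.op (BarSmp.F b.2 |>.map_id _)
  map_comp {b b' b''} φ ψ :=
    BarSmp.faceTo_comp _ _ _ (ordHom_comp ψ.1.unop φ.1.unop) φ.2 ψ.2 (φ ≫ ψ).2

/-- The translation of the last simplex of a chain. -/
def BarSmp.pushHom {p p' : X.Elements} (φ : p ⟶ p') {n : SemiSimplexCategory}
    (b : BarSmp p n) : (inclElements X).obj b.topEl ⟶ (inclElements X).obj (b.push φ).topEl :=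
  ⟨(𝟙 _, φ.1.2), rfl⟩

/-- The translation of the last simplex of a chain. -/
def BarSmp.pushTo {p p' : X.Elements} (φ : p ⟶ p') {n : SemiSimplexCategory}
    (b : BarSmp p n) (c : BarSmp p' n) (h : b.push φ = c) :
    (inclElements X).obj b.topEl ⟶ (inclElements X).obj c.topEl :=
  h ▸ pushHom φ b

lemma BarSmp.pushTo_val_heq {p p' : X.Elements} (φ : p ⟶ p') {n : SemiSimplexCategory}
    {b : BarSmp p n} {c : BarSmp p' n} (h : b.push φ = c) :
    (pushTo φ b c h).1.1 ≍ 𝟙 (op (b.F.obj (Fin.last _))) := by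
  subst h
  rfl

lemma BarSmp.pushTo_val_snd {p p' : X.Elements} (φ : p ⟶ p') {n : SemiSimplexCategory}
    {b : BarSmp p n} {c : BarSmp p' n} (h : b.push φ = c) : (pushTo φ b c h).1.2 = φ.1.2 := by
  subst h
  rfl

lemma BarSmp.faceTo_pushTo {p p' : X.Elements} (φ : p ⟶ p') {n n' : SemiSimplexCategory}
    (f : Fin (n'.len + 1) →o Fin (n.len + 1)) {b : BarSmp p n} {b' : BarSmp p n'}
    {c : BarSmp p' n} {c' : BarSmp p' n'}
    (h : b.face f = b') (h' : c.face f = c') (e : b.push φ = c) (e' : b'.push φ = c') :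
    (inclElements X).map (faceTo f b b' h) ≫ pushTo φ b' c' e' =
      pushTo φ b c e ≫ (inclElements X).map (faceTo f c c' h') := by
  subst h e h'
  apply CategoryOfElements.ext
  refine Prod.ext ?_ ((Category.id_comp _).trans ((pushTo_val_snd φ e').trans
    (Category.comp_id _).symm))
  have h₁ : (pushTo φ (face f b) (face f (push φ b)) e').1.1 =
    𝟙 (op (b.F.obj (f (Fin.last _)))) := eq_of_heq (pushTo_val_heq φ e')
  refine (congrArg (fun x ↦ (b.F.map (homOfLE (Fin.le_last (f (Fin.last _))))).op ≫ x) h₁).trans ?_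
  exact (Category.comp_id (b.F.map (homOfLE (Fin.le_last (f (Fin.last _))))).op).trans
    (Category.id_comp _).symm

attribute [local irreducible] BarSmp.push BarSmp.face in
/-- The natural map of last simplices given by translation. -/
def barTopMap {p p' : X.Elements} (φ : p ⟶ p') : barTop p ⋙ inclElements X ⟶
    NatTrans.mapElements (barMap φ) ⋙ barTop p' ⋙ inclElements X where
  app b := BarSmp.pushTo φ b.2 ((barMap φ).app b.1 b.2) rfl
  naturality b b' ψ := BarSmp.faceTo_pushTo φ (ordHom ψ.1.unop) (b := b.2) (b' := b'.2)
    (c := (barMap φ).app b.1 b.2) (c' := (barMap φ).app b'.1 b'.2) ψ.2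
    ((NatTrans.mapElements (barMap φ)).map ψ).2 rfl rfl

variable {R : Type u} [Ring R] (T : X.Elements ⥤ CochainComplex (ModuleCat.{u} R) ℤ)

/-- The system of complexes of the bar resolution. -/
abbrev barSystem (p : X.Elements) : (bar p).Elements ⥤ CochainComplex (ModuleCat.{u} R) ℤ :=
  barTop p ⋙ inclElements X ⋙ T

/-- The last simplex of a chain, in the equivariant category of simplices. -/
abbrev barEl {p : X.Elements} {m : ℕ} (b : Smp (bar p) m) : X.Elements :=
  (inclElements X).obj (BarSmp.topEl b)

/-- The inclusion of the summand of a chain. -/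
noncomputable abbrev barGen {p : X.Elements} {m : ℕ} (b : Smp (bar p) m) {k n : ℤ}
    (hk : k = n + m) (a : (T.obj (barEl b)).X k) : Tot (barSystem T p) n :=
  Tot.gen (K := barSystem T p) b hk a

/-- The translation of a chain. -/
def barPush {p p' : X.Elements} (φ : p ⟶ p') {m : ℕ} (b : Smp (bar p) m) : Smp (bar p') m :=
  BarSmp.push φ b

/-- The translation of the last simplex of a chain. -/
def barPushHom {p p' : X.Elements} (φ : p ⟶ p') {m : ℕ} (b : Smp (bar p) m) :
    barEl b ⟶ barEl (barPush φ b) :=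
  BarSmp.pushHom φ b

lemma barGen_congr {p : X.Elements} {m : ℕ} {b b' : Smp (bar p) m} (hb : b = b') {o : X.Elements}
    (ψ : o ⟶ barEl b) (ψ' : o ⟶ barEl b') (hψ : ψ.1 ≍ ψ'.1) {k n : ℤ}
    (hk : k = n + m) (a : (T.obj o).X k) :
    barGen T b hk (mapEl T ψ k a) = barGen T b' hk (mapEl T ψ' k a) := by
  subst hb
  obtain rfl : ψ = ψ' := CategoryOfElements.ext _ _ _ (eq_of_heq hψ)
  rfl

/-- The map of bar resolutions induced by a morphism of simplices. -/
noncomputable def resolutionPush {p p' : X.Elements} (φ : p ⟶ p') :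
    tot (barSystem T p) ⟶ tot (barSystem T p') :=
  totMap (barMap φ) (Functor.whiskerRight (barTopMap φ) T)

lemma resolutionPush_gen {p p' : X.Elements} (φ : p ⟶ p') {m : ℕ} (b : Smp (bar p) m) {k n : ℤ}
    (hk : k = n + m) (a : (T.obj (barEl b)).X k) :
    ((resolutionPush T φ).f n).hom (barGen T b hk a) =
      barGen T (barPush φ b) hk (mapEl T (barPushHom φ b) k a) :=
  Tot.map_gen _ _ _ _ _

lemma barPush_id {p : X.Elements} {m : ℕ} (b : Smp (bar p) m) : barPush (𝟙 p) b = b :=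
  BarSmp.ext_of_eq rfl (heq_of_eq (Category.id_comp _))
    (heq_of_eq (ConcreteCategory.congr_hom (X.map_id _) _))

lemma barPush_comp {p p' p'' : X.Elements} (φ : p ⟶ p') (ψ : p' ⟶ p'') {m : ℕ}
    (b : Smp (bar p) m) : barPush (φ ≫ ψ) b = barPush ψ (barPush φ b) := by
  refine BarSmp.ext_of_eq rfl (heq_of_eq (Category.assoc _ _ _)) (heq_of_eq ?_)
  refine Eq.trans ?_ (ConcreteCategory.congr_hom (X.map_comp _ _) _)
  exact congrArg (fun f ↦ X.map f b.top) (Prod.ext (Category.comp_id _).symm rfl)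

/-- The bar resolution of a system of complexes. -/
@[simps]
noncomputable def resolutionObj : X.Elements ⥤ CochainComplex (ModuleCat.{u} R) ℤ where
  obj p := tot (barSystem T p)
  map φ := resolutionPush T φ
  map_id p := by
    refine tot_hom_ext fun n m b k hk a ↦ (resolutionPush_gen T (𝟙 p) b hk a).trans ?_
    refine (barGen_congr T (barPush_id b) (BarSmp.pushHom (𝟙 p) b) (𝟙 _) HEq.rfl hk a).trans ?_
    exact congrArg (barGen T b hk) (mapEl_id T a)
  map_comp φ ψ := by
    refine tot_hom_ext fun n m b k hk a ↦ (resolutionPush_gen T (φ ≫ ψ) b hk a).trans ?_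
    refine Eq.trans ?_ ((congrArg ((resolutionPush T ψ).f n).hom
      (resolutionPush_gen T φ b hk a)).trans
      (resolutionPush_gen T ψ (barPush φ b) hk _)).symm
    refine (barGen_congr T (barPush_comp φ ψ b) (BarSmp.pushHom (φ ≫ ψ) b)
      (barPushHom φ b ≫ barPushHom ψ (barPush φ b)) (heq_of_eq ?_) hk a).trans ?_
    · exact Prod.ext (Category.comp_id (𝟙 (op (b.F.obj (Fin.last _))))).symm rfl
    · exact congrArg (barGen T (barPush ψ (barPush φ b)) hk)
        (mapEl_comp T (barPushHom φ b) (barPushHom ψ (barPush φ b)) a)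

/-- The map of bar resolutions induced by a map of systems of complexes. -/
noncomputable def resolutionMap {T T' : X.Elements ⥤ CochainComplex (ModuleCat.{u} R) ℤ}
    (τ : T ⟶ T') (p : X.Elements) : tot (barSystem T p) ⟶ tot (barSystem T' p) :=
  totMap (𝟙 _) (overId (Functor.whiskerLeft (barTop p) (Functor.whiskerLeft (inclElements X) τ)))

lemma resolutionMap_gen {T T' : X.Elements ⥤ CochainComplex (ModuleCat.{u} R) ℤ} (τ : T ⟶ T')
    {p : X.Elements} {m : ℕ} (b : Smp (bar p) m) {k n : ℤ}
    (hk : k = n + m) (a : (T.obj (barEl b)).X k) :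
    ((resolutionMap τ p).f n).hom (barGen T b hk a) =
      barGen T' b hk (((τ.app (barEl b)).f k).hom a) :=
  Tot.mapId_gen _ _ _ _

variable (X R) in
/-- The functor of bar resolutions. -/
@[simps]
noncomputable def resolution : (X.Elements ⥤ CochainComplex (ModuleCat.{u} R) ℤ) ⥤
    X.Elements ⥤ CochainComplex (ModuleCat.{u} R) ℤ where
  obj T := resolutionObj T
  map {T T'} τ :=
    { app p := resolutionMap τ p
      naturality p p' φ := by
        refine tot_hom_ext fun n m b k hk a ↦ ?_
        refine (congrArg ((resolutionMap τ p').f n).hom (resolutionPush_gen T φ b hk a)).trans ?_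
        refine Eq.trans ?_ (congrArg ((resolutionPush T' φ).f n).hom
          (resolutionMap_gen τ b hk a)).symm
        refine (resolutionMap_gen τ (barPush φ b) hk _).trans
          (Eq.trans ?_ (resolutionPush_gen _ _ _ _ _).symm)
        exact congrArg (barGen T' (barPush φ b) hk) (mapEl_naturality τ (barPushHom φ b) a) }
  map_id T := by
    ext p : 2
    refine tot_hom_ext fun n m b k hk a ↦ ?_
    exact resolutionMap_gen _ _ _ _
  map_comp τ σ := by
    ext p : 2
    refine tot_hom_ext fun n m b k hk a ↦ ?_
    refine (resolutionMap_gen _ _ _ _).trans ?_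
    refine Eq.trans ?_ (congrArg ((resolutionMap σ p).f n).hom (resolutionMap_gen τ b hk a)).symm
    exact (resolutionMap_gen σ b hk _).symm

variable [TopologicalSpace G]

lemma semiSimplexCategory_endo_eq_id {n : SemiSimplexCategory} (f : n ⟶ n) : f = 𝟙 n := by
  apply SemiSimplexCategory.homEquiv.injective
  exact RelEmbedding.ext fun i ↦ congrFun ((SemiSimplexCategory.homEquiv f).strictMono.eq_id.trans
    (SemiSimplexCategory.homEquiv (𝟙 n)).strictMono.eq_id.symm) i

/-- A chain is determined by its inclusions and its last simplex. An endomorphism of `p` has trivial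
face operator, so it fixes the whole chain as soon as its group element fixes the last simplex,
whose stabilizer is open. Smoothness at the last simplex does the rest. -/
lemma isSmoothComplex_resolutionObj (hX : HasOpenStabilizers X) (hT : IsSmoothComplex (toBG X) T) :
    IsSmoothComplex (toBG X) (resolutionObj T) := by
  intro n p (y : Tot (barSystem T p) n)
  change ∃ U ∈ 𝓝 (1 : G), ∀ φ : p ⟶ p, φ.1.2 ∈ U → ((resolutionPush T φ).f n).hom y = y
  refine Tot.induction (P := fun y ↦ ∃ U ∈ 𝓝 (1 : G), ∀ φ : p ⟶ p, φ.1.2 ∈ U →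
    ((resolutionPush T φ).f n).hom y = y) y ⟨Set.univ, Filter.univ_mem, fun g _ ↦ map_zero _⟩ ?_ ?_
  · rintro y z ⟨U, hU, hy⟩ ⟨V, hV, hz⟩
    exact ⟨U ∩ V, Filter.inter_mem hU hV, fun φ hφ ↦
      (map_add ((resolutionPush T φ).f n).hom y z).trans
        (congrArg₂ _ (hy φ hφ.1) (hz φ hφ.2))⟩
  · intro m b k hk a
    obtain ⟨U, hU, ha⟩ := hT k (barEl b) a
    refine ⟨U ∩ {g | (act X g).app _ b.top = b.top},
      Filter.inter_mem hU ((hX _ b.top).mem_nhds ?_), ?_⟩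
    · exact ConcreteCategory.congr_hom (X.map_id _) b.top
    · rintro φ ⟨hg, hgx⟩
      refine (resolutionPush_gen T φ b hk a).trans ?_
      -- Once the last simplex is fixed, translation becomes an endomorphism of it, to which `ha`
      -- applies.
      let ψ : barEl b ⟶ barEl b := ⟨(𝟙 _, φ.1.2), hgx⟩
      refine (barGen_congr T (b := barPush φ b) (b' := b) (BarSmp.ext_of_eq rfl (heq_of_eq ?_)
        (heq_of_eq hgx)) (barPushHom φ b) ψ HEq.rfl hk a).trans ?_
      · exact (congrArg (fun f ↦ f ≫ b.t) (semiSimplexCategory_endo_eq_id _)).trans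
          (Category.id_comp _)
      · exact congrArg _ (ha ψ hg)

end

end MayerVietoris

/-! ### Contraction of the bar resolution by an extra degeneracy -/

namespace MayerVietoris

section

variable {G : Type u} [Group G] {X : GSemiSimplicialSet G} {p : X.Elements}

namespace BarSmp

/-- The inclusion of the base of a chain into its last simplex. -/
def toBase {n : SemiSimplexCategory} (b : BarSmp p n) : (inclElements X).obj b.topEl ⟶ p :=
  ⟨((b.t ≫ b.F.map (homOfLE (Fin.zero_le _))).op, 𝟙 _), b.map_top⟩

lemma faceHom_toBase {n n' : SemiSimplexCategory} (f : Fin (n'.len + 1) →o Fin (n.len + 1))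
    (b : BarSmp p n) : (inclElements X).map (faceHom f b) ≫ (b.face f).toBase = b.toBase := by
  apply CategoryOfElements.ext
  refine Prod.ext ?_ (Category.comp_id _)
  refine congrArg Quiver.Hom.op (?_ : ((b.t ≫ b.F.map _) ≫ b.F.map _) ≫ b.F.map _ = _)
  rw [Category.assoc, Category.assoc, ← b.F.map_comp, ← b.F.map_comp]
  rfl

lemma faceTo_toBase {n n' : SemiSimplexCategory} (f : Fin (n'.len + 1) →o Fin (n.len + 1))
    {b : BarSmp p n} {b' : BarSmp p n'} (h : b.face f = b') :
    (inclElements X).map (faceTo f b b' h) ≫ b'.toBase = b.toBase := by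
  subst h
  exact faceHom_toBase f b

lemma pushHom_toBase {p' : X.Elements} (φ : p ⟶ p') {n : SemiSimplexCategory} (b : BarSmp p n) :
    pushHom φ b ≫ (b.push φ).toBase = b.toBase ≫ φ := by
  apply CategoryOfElements.ext
  refine Prod.ext ?_ ((Category.comp_id φ.1.2).trans (Category.id_comp φ.1.2).symm)
  refine (Category.id_comp _).trans ?_
  exact congrArg Quiver.Hom.op (Category.assoc φ.1.1.unop b.t (b.F.map (homOfLE (Fin.zero_le _))))

end BarSmp

lemma functor_map_heq {C : Type*} [Category C] {n : ℕ} (F : Fin n ⥤ C) {i j i' j' : Fin n}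
    (hi : i = i') (hj : j = j') (f : i ⟶ j) (f' : i' ⟶ j') : F.map f ≍ F.map f' := by
  subst hi hj
  exact heq_of_eq (congrArg F.map (Subsingleton.elim _ _))

section

variable {C : Type*} [Category C] {m : ℕ} (F : Fin (m + 1) ⥤ C) {A : C} (t : A ⟶ F.obj 0)

/-- The objects of a chain extended to the left. -/
def consObj (F : Fin (m + 1) ⥤ C) (A : C) : Fin (m + 2) → C
  | ⟨0, _⟩ => A
  | ⟨i + 1, h⟩ => F.obj ⟨i, Nat.lt_of_succ_lt_succ h⟩

/-- The morphisms of a chain extended to the left. -/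
def consMap : ∀ (i j : Fin (m + 2)) (_ : i ≤ j), consObj F A i ⟶ consObj F A j
  | ⟨0, _⟩, ⟨0, _⟩, _ => 𝟙 A
  | ⟨0, _⟩, ⟨_ + 1, _⟩, _ => t ≫ F.map (homOfLE (Fin.zero_le _))
  | ⟨_ + 1, _⟩, ⟨_ + 1, _⟩, h => F.map (homOfLE (Fin.succ_le_succ_iff.1 h))

/-- A chain extended to the left. -/
@[simps]
def consChain : Fin (m + 2) ⥤ C where
  obj := consObj F A
  map {i j} f := consMap F t i j (leOfHom f)
  map_id := by
    rintro ⟨_ | i, h⟩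
    · rfl
    · exact F.map_id _
  map_comp := by
    rintro ⟨_ | i, hi⟩ ⟨_ | j, hj⟩ ⟨_ | k, hk⟩ f g
    · exact (Category.comp_id _).symm
    · exact (Category.id_comp _).symm
    · exact absurd (leOfHom g) (by simp)
    · exact (congrArg (fun f ↦ t ≫ f) (F.map_comp _ _)).trans (Category.assoc _ _ _).symm
    · exact absurd (leOfHom f) (by simp)
    · exact absurd (leOfHom f) (by simp)
    · exact absurd (leOfHom g) (by simp)
    · exact F.map_comp _ _

/-- A map `f` that fixes `0` and is `g` shifted by one keeps the prepended object, so it only takes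
a subchain of `F`. -/
lemma consChain_comp {m' : ℕ} (f : Fin (m' + 2) →o Fin (m + 2)) (g : Fin (m' + 1) →o Fin (m + 1))
    (h0 : f 0 = 0) (hs : ∀ i, f i.succ = (g i).succ) :
    f.monotone.functor ⋙ consChain F t =
      consChain (g.monotone.functor ⋙ F) (t ≫ F.map (homOfLE (Fin.zero_le (g 0)))) := by
  have h0' (h) : f ⟨0, h⟩ = 0 := h0
  have hs' (i h) : f ⟨i + 1, h⟩ = (g ⟨i, Nat.lt_of_succ_lt_succ h⟩).succ := hs ⟨i, _⟩
  refine Functor.hext ?_ ?_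
  · rintro ⟨_ | i, h⟩
    · exact congrArg (consObj F A) h0
    · exact congrArg (consObj F A) (hs' _ h)
  · rintro ⟨_ | i, hi⟩ ⟨_ | j, hj⟩ φ
    · exact functor_map_heq (consChain F t) h0 h0 (homOfLE (f.monotone (leOfHom φ))) (𝟙 0)
    · refine (functor_map_heq (consChain F t) h0 (hs' _ hj)
        (homOfLE (f.monotone (leOfHom φ)))
        (homOfLE (Fin.zero_le _) : 0 ⟶ _)).trans (heq_of_eq ?_)
      refine Eq.trans ?_ (Category.assoc _ _ _).symm
      exact congrArg (fun f ↦ t ≫ f) (F.map_comp _ _)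
    · exact absurd (leOfHom φ) (by simp)
    · exact functor_map_heq (consChain F t) (hs' _ hi) (hs' _ hj)
        (homOfLE (f.monotone (leOfHom φ)))
        (homOfLE (Fin.succ_le_succ_iff.2 (g.monotone (Fin.succ_le_succ_iff.1 (leOfHom φ)))))

end

/-- The chain extended by its base. -/
def barCons {m : ℕ} (b : Smp (bar p) m) : Smp (bar p) (m + 1) where
  F := consChain (BarSmp.F b) (BarSmp.t b)
  t := 𝟙 _
  top := BarSmp.top b
  map_top := by
    refine Eq.trans ?_ (BarSmp.map_top b)
    refine congrArg (fun f ↦ (underlying X).map f (BarSmp.top b)) (congrArg Quiver.Hom.op ?_)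
    exact Category.id_comp (BarSmp.t b ≫ (BarSmp.F b).map (homOfLE (Fin.zero_le _)))

variable (p) in
/-- The chain that consists of the base only. -/
def barOne : Smp (bar p) 0 where
  F := (Functor.const _).obj p.1.1.unop
  t := 𝟙 _
  top := p.2
  map_top := by
    refine Eq.trans ?_ (ConcreteCategory.congr_hom ((underlying X).map_id _) p.2)
    refine congrArg (fun f ↦ (underlying X).map f p.2) (congrArg Quiver.Hom.op ?_)
    exact Category.id_comp (𝟙 p.1.1.unop)

variable {R : Type u} [Ring R] (T : X.Elements ⥤ CochainComplex (ModuleCat.{u} R) ℤ)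

lemma genMap_barSystem {m j : ℕ} (f : Inj j m) (b : Smp (bar p) m) {k n : ℤ} (hk : k = n + j)
    (a : (T.obj (barEl b)).X k) : Tot.genMap (K := barSystem T p) f b hk a =
      barGen T (BarSmp.face (ordHom f) b) hk
        (mapEl T ((inclElements X).map (BarSmp.faceHom (ordHom f) b)) k a) := rfl

/-- Omitting the prepended base returns the original chain. This is the face that produces the
identity in the homotopy formula. -/
lemma genMap_barCons_zero {m : ℕ} (b : Smp (bar p) m) {k n : ℤ} (hk : k = n + m)
    (a : (T.obj (barEl b)).X k) :
    Tot.genMap (K := barSystem T p) (face 0) (barCons b) hk a = barGen T b hk a := by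
  refine (genMap_barSystem T (face 0) (barCons b) hk a).trans ?_
  refine (barGen_congr T (b := BarSmp.face (ordHom (face 0)) (barCons b)) (b' := b)
    (BarSmp.ext_of_eq rfl (heq_of_eq ?_) (heq_of_eq ?_)) _ (𝟙 (barEl b)) (heq_of_eq ?_)
      hk a).trans ?_
  · refine (Category.id_comp _).trans ?_
    exact (congrArg _ ((BarSmp.F b).map_id _)).trans (Category.comp_id _)
  · refine (congrArg (fun f ↦ (underlying X).map (Quiver.Hom.op f) (BarSmp.top b))
      ((BarSmp.F b).map_id _)).trans ?_
    exact ConcreteCategory.congr_hom ((underlying X).map_id _) (BarSmp.top b)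
  · exact Prod.ext (congrArg Quiver.Hom.op ((BarSmp.F b).map_id _)) rfl
  · exact congrArg (barGen T b hk) (mapEl_id T a)

lemma map_op_heq (Y : SemiSimplexCategoryᵒᵖ ⥤ Type u) {A A' B : SemiSimplexCategory} (h : A = A')
    {f : A ⟶ B} {f' : A' ⟶ B} (hf : f ≍ f') (x : Y.obj (op B)) : Y.map f.op x ≍ Y.map f'.op x := by
  subst h
  rw [eq_of_heq hf]

lemma op_prod_heq {A A' B : SemiSimplexCategory} (h : A = A') {f : A ⟶ B} {f' : A' ⟶ B}
    (hf : f ≍ f') {s s' : SingleObj G} (g : s ⟶ s') :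
    ((f.op, g) : (op B, s) ⟶ (op A, s')) ≍ ((f'.op, g) : (op B, s) ⟶ (op A', s')) := by
  subst h
  rw [eq_of_heq hf]

lemma consChain_map_succ_heq {C : Type*} [Category C] {m : ℕ} (F : Fin (m + 1) ⥤ C) {A : C}
    (t : A ⟶ F.obj 0) {i j : Fin (m + 1)} {i' j' : Fin (m + 2)} (hi : i' = i.succ)
    (hj : j' = j.succ) (f : i ⟶ j) (f' : i' ⟶ j') : (consChain F t).map f' ≍ F.map f := by
  subst hi hj
  exact heq_of_eq (congrArg F.map (Subsingleton.elim _ _))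

/-- The later faces do not touch the prepended base, so they commute with prepending. The fields
depend on the chain, hence the heterogeneous comparison. -/
lemma face_barCons_succ {m : ℕ} (b : Smp (bar p) (m + 1)) (r : Fin (m + 2)) :
    (BarSmp.face (ordHom (face r.succ)) (barCons b) : Smp (bar p) (m + 1)) =
      barCons (m := m) (BarSmp.face (ordHom (face r)) b) := by
  have hl : ordHom (face r.succ) (Fin.last (m + 1)) = (ordHom (face r) (Fin.last m)).succ :=
    Fin.succ_succAbove_succ r (Fin.last m)
  refine BarSmp.ext_of_eq ?_ ?_ ?_
  · exact consChain_comp _ _ _ (ordHom (face r)) (Fin.succ_succAbove_zero r)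
      fun i ↦ Fin.succ_succAbove_succ r i
  · exact (heq_of_eq (Category.id_comp _)).trans
      (functor_map_heq (consChain (BarSmp.F b) (BarSmp.t b)) rfl
        (Fin.succ_succAbove_zero r) _ (𝟙 0))
  · refine map_op_heq (underlying X) ?_ ?_ (BarSmp.top b)
    · exact congrArg (consObj (BarSmp.F b) p.1.1.unop) hl
    · exact consChain_map_succ_heq (j := Fin.last _) _ _ hl rfl _ _

lemma genMap_barCons_succ {m : ℕ} (b : Smp (bar p) (m + 1)) (r : Fin (m + 2)) {k n : ℤ}
    (hk : k = n + (m + 1 : ℕ)) (a : (T.obj (barEl b)).X k) :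
    Tot.genMap (K := barSystem T p) (face r.succ) (barCons b) hk a =
      barGen T (barCons (m := m) (BarSmp.face (ordHom (face r)) b)) hk
        (mapEl T ((inclElements X).map (BarSmp.faceHom (ordHom (face r)) b)) k a) := by
  have hl : ordHom (face r.succ) (Fin.last (m + 1)) = (ordHom (face r) (Fin.last m)).succ :=
    Fin.succ_succAbove_succ r (Fin.last m)
  refine (genMap_barSystem T (face r.succ) (barCons b) hk a).trans ?_
  refine barGen_congr T (face_barCons_succ b r)
    ((inclElements X).map (BarSmp.faceHom (ordHom (face r.succ)) (barCons b)))
    ((inclElements X).map (BarSmp.faceHom (ordHom (face r)) b)) ?_ hk a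
  refine op_prod_heq ?_ ?_ _
  · exact congrArg (consObj (BarSmp.F b) p.1.1.unop) hl
  · exact consChain_map_succ_heq (j := Fin.last _) _ _ hl rfl _ _

/-- For a chain of length one the last face leaves the base alone, and the coefficient is restricted
from the last simplex to the base. This is the retraction onto the value at `p`. -/
lemma genMap_barCons_one (b : Smp (bar p) 0) {k n : ℤ}
    (hk : k = n + (0 : ℕ)) (a : (T.obj (barEl b)).X k) :
    Tot.genMap (K := barSystem T p) (face 1) (barCons b) hk a =
      barGen T (barOne p) hk (mapEl T (BarSmp.toBase b) k a) := by
  refine (genMap_barSystem T (face 1) (barCons b) hk a).trans ?_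
  refine barGen_congr T (b := BarSmp.face (ordHom (face 1)) (barCons b)) (b' := barOne p)
    (BarSmp.ext_of_eq ?_ (heq_of_eq ?_) (heq_of_eq ?_)) _ _ (heq_of_eq ?_) hk a
  · refine Functor.hext ?_ ?_
    · intro i
      obtain rfl : i = 0 := Subsingleton.elim (α := Fin 1) _ _
      rfl
    · intro i j φ
      obtain rfl : i = 0 := Subsingleton.elim (α := Fin 1) _ _
      obtain rfl : j = 0 := Subsingleton.elim (α := Fin 1) _ _
      rfl
  · exact Category.id_comp _
  · exact BarSmp.map_top b
  · rfl

/-- The augmentation of the system of complexes of the bar resolution. -/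
def barAug (p : X.Elements) : barSystem T p ⟶ (Functor.const _).obj (T.obj p) where
  app b := T.map (BarSmp.toBase b.2)
  naturality b b' ψ := by
    refine (T.map_comp _ _).symm.trans (Eq.trans ?_ (Category.comp_id _).symm)
    exact congrArg T.map (BarSmp.faceTo_toBase _ ψ.2)

/-- The augmentation of the bar resolution. -/
noncomputable def resolutionAug (p : X.Elements) : tot (barSystem T p) ⟶ T.obj p :=
  totAug (barAug T p)

lemma resolutionAug_gen_zero (b : Smp (bar p) 0) {k n : ℤ}
    (hk : k = n + (0 : ℕ)) (a : (T.obj (barEl b)).X k) :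
    ((resolutionAug T p).f n).hom (barGen T b hk a) =
      degCast (T.obj p) (by simpa using hk) (mapEl T (BarSmp.toBase b) k a) :=
  totAug_gen_zero (barAug T p) b hk a

lemma resolutionAug_gen_succ {m : ℕ} (b : Smp (bar p) (m + 1)) {k n : ℤ}
    (hk : k = n + (m + 1 : ℕ)) (a : (T.obj (barEl b)).X k) :
    ((resolutionAug T p).f n).hom (barGen T b hk a) = 0 :=
  totAug_gen_succ (barAug T p) b hk a

variable (p) in
/-- The homotopy that contracts the bar resolution. -/
noncomputable def barHomotopy (n n' : ℤ) (h : n + 1 = n') : Tot (barSystem T p) n' →ₗ[R]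
    Tot (barSystem T p) n :=
  Tot.lift fun m b k hk ↦ (k.negOnePow : ℤ) •
    Tot.gen (K := barSystem T p) (barCons b) (k := k) (n := n) (by push_cast; lia)

lemma barHomotopy_gen {n n' : ℤ} (h : n + 1 = n') {m : ℕ} (b : Smp (bar p) m) {k : ℤ}
    (hk : k = n' + m) (a : (T.obj (barEl b)).X k) :
    barHomotopy p T n n' h (barGen T b hk a) = (k.negOnePow : ℤ) •
      barGen T (barCons b) (k := k) (n := n) (by push_cast; lia) a :=
  Tot.lift_gen (K := barSystem T p) _ _ _ _

variable (p) in
/-- The inclusion of the value at a simplex into its bar resolution. -/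
noncomputable def barIncl (n : ℤ) : (T.obj p).X n →ₗ[R] Tot (barSystem T p) n :=
  Tot.gen (K := barSystem T p) (barOne p) (by simp)

lemma gen_degCast {S : SemiSimplexCategoryᵒᵖ ⥤ Type u}
    {K : S.Elements ⥤ CochainComplex (ModuleCat.{u} R) ℤ} {m : ℕ} (x : Smp S m) {k k' n : ℤ}
    (h : k = k') (hk : k' = n + m) (a : val K x k) :
    Tot.gen x hk (degCast (K.obj (smp x)) h a) = Tot.gen x (h.trans hk) a := by
  subst h
  rw [degCast_rfl]

lemma Tot.diff_gen_zero {S : SemiSimplexCategoryᵒᵖ ⥤ Type u}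
    {K : S.Elements ⥤ CochainComplex (ModuleCat.{u} R) ℤ} {n n' : ℤ} (h : n + 1 = n') (x : Smp S 0)
    {k : ℤ} (hk : k = n + (0 : ℕ)) (a : val K x k) : diff n n' h (gen x hk a) =
      gen x (k := k + 1) (n := n') (by lia) (valD K x k (k + 1) a) := by
  simp [diff_gen, bdry]

lemma negOnePow_mul_self (k : ℤ) : (k.negOnePow : ℤ) * k.negOnePow = 1 := by
  rw [← Units.val_mul, ← Int.negOnePow_add, Int.negOnePow_even _ ⟨k, rfl⟩, Units.val_one]

lemma diff_barCons_succ {n n' : ℤ} (h : n + 1 = n') {m : ℕ}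
    (b : Smp (bar p) (m + 1)) {k : ℤ} (hk : k = n + (m + 1 + 1 : ℕ)) (a : (T.obj (barEl b)).X k) :
    Tot.diff n n' h (barGen T (barCons b) hk a) =
      barGen T (barCons b) (k := k + 1) (n := n') (by lia) (((T.obj (barEl b)).d k (k + 1)).hom a) +
      (k.negOnePow : ℤ) • (barGen T b (n := n') (by push_cast at hk ⊢; lia) a -
        ∑ r : Fin (m + 2), (-1 : ℤ) ^ (r : ℕ) •
          barGen T (barCons (m := m) (BarSmp.face (ordHom (face r)) b)) (n := n')
            (by push_cast at hk ⊢; lia)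
            (mapEl T ((inclElements X).map (BarSmp.faceHom (ordHom (face r)) b)) k a)) := by
  refine (Tot.diff_gen (K := barSystem T p) h (barCons b) hk a).trans ?_
  refine congrArg (fun z : Tot (barSystem T p) n' ↦ _ + (k.negOnePow : ℤ) • z) ?_
  refine (Tot.bdry_succ (K := barSystem T p) (barCons b) _ a).trans ?_
  rw [Fin.sum_univ_succ, sub_eq_add_neg, ← Finset.sum_neg_distrib]
  refine congrArg₂ (fun x y ↦ x + y) ?_ (Finset.sum_congr rfl fun r _ ↦ ?_)
  · exact (one_smul ℤ _).trans (genMap_barCons_zero T b _ a)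
  · refine (congrArg (fun z ↦ (-1 : ℤ) ^ ((r.succ : Fin (m + 3)) : ℕ) • z)
      (genMap_barCons_succ T b r (n := n') (by push_cast at hk ⊢; lia) a)).trans ?_
    rw [Fin.val_succ, pow_succ, mul_neg_one, neg_smul]

lemma diff_barCons_zero {n n' : ℤ} (h : n + 1 = n') 
    (b : Smp (bar p) 0) {k : ℤ} (hk : k = n + (0 + 1 : ℕ)) (a : (T.obj (barEl b)).X k) :
    Tot.diff n n' h (barGen T (barCons b) hk a) =
      barGen T (barCons b) (k := k + 1) (n := n') (by lia) (((T.obj (barEl b)).d k (k + 1)).hom a) +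
      (k.negOnePow : ℤ) • (barGen T b (n := n') (by push_cast at hk ⊢; lia) a -
        barGen T (barOne p) (n := n') (by push_cast at hk ⊢; lia)
          (mapEl T (BarSmp.toBase b) k a)) := by
  refine (Tot.diff_gen (K := barSystem T p) h (barCons b) hk a).trans ?_
  refine congrArg (fun z : Tot (barSystem T p) n' ↦ _ + (k.negOnePow : ℤ) • z) ?_
  refine (Tot.bdry_succ (K := barSystem T p) (barCons b) _ a).trans ?_
  rw [Fin.sum_univ_two, sub_eq_add_neg]
  refine congrArg₂ (fun x y ↦ x + y) ?_ ?_
  · exact (one_smul ℤ _).trans (genMap_barCons_zero T b _ a)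
  · refine (congrArg (fun z ↦ (-1 : ℤ) ^ ((1 : Fin 2) : ℕ) • z)
      (genMap_barCons_one T b (n := n') (by push_cast at hk ⊢; lia) a)).trans ?_
    simp

/-- The homotopy formula of an extra degeneracy. The zeroth face of the prepended chain gives the
generator back, the later faces cancel against the homotopy of its boundary, and for a chain of
length one the remaining face is cancelled by the augmentation. -/
lemma barHomotopy_diff_gen {n n' n'' : ℤ} (h : n + 1 = n') (h' : n' + 1 = n'') {m : ℕ}
    (b : Smp (bar p) m) {k : ℤ} (hk : k = n' + m) (a : (T.obj (barEl b)).X k) :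
    Tot.diff n n' h (barHomotopy p T n n' h (barGen T b hk a)) +
        barHomotopy p T n' n'' h' (Tot.diff n' n'' h' (barGen T b hk a)) +
      barIncl p T n' (((resolutionAug T p).f n').hom (barGen T b hk a)) = barGen T b hk a := by
  -- `A` is the prepended chain with the internal differential applied, `B` the original generator
  -- and `C` the contribution of the other faces. The homotopy carries the sign `(-1) ^ k`, so `A`
  -- occurs with opposite signs.
  have key {M : Type u} [AddCommGroup M] (A B C : M) :
      (k.negOnePow : ℤ) • (A + (k.negOnePow : ℤ) • (B - C)) + (-(k.negOnePow : ℤ)) • A + C = B := by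
    rw [smul_add, smul_smul, negOnePow_mul_self, one_smul, neg_smul]
    abel
  obtain _ | m := m
  · refine Eq.trans ?_ (key (barGen T (barCons b) (k := k + 1) (n := n') (by push_cast; lia)
      (((T.obj (barEl b)).d k (k + 1)).hom a)) (barGen T b hk a)
      (barGen T (barOne p) hk (mapEl T (BarSmp.toBase b) k a)))
    refine congrArg₂ (fun x y ↦ x + y) (congrArg₂ (fun x y ↦ x + y) ?_ ?_) ?_
    · refine (congrArg (Tot.diff n n' h) (barHomotopy_gen T h b hk a)).trans ?_
      refine (map_zsmul _ _ _).trans ?_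
      exact congrArg (fun z ↦ (k.negOnePow : ℤ) • z) (diff_barCons_zero T h b _ a)
    · refine (congrArg (barHomotopy p T n' n'' h')
        (Tot.diff_gen_zero (K := barSystem T p) h' b hk a)).trans ?_
      rw [← Units.val_neg, ← Int.negOnePow_succ]
      exact barHomotopy_gen T h' b (k := k + 1) (by lia) _
    · refine (congrArg (barIncl p T n') (resolutionAug_gen_zero T b hk a)).trans ?_
      exact gen_degCast (K := barSystem T p) (barOne p) _ _ _
  · refine Eq.trans ?_ (key (barGen T (barCons b) (k := k + 1) (n := n') (by push_cast; lia)
      (((T.obj (barEl b)).d k (k + 1)).hom a)) (barGen T b hk a)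
      (∑ r : Fin (m + 2), (-1 : ℤ) ^ (r : ℕ) •
          barGen T (barCons (m := m) (BarSmp.face (ordHom (face r)) b)) (n := n')
            (by push_cast at hk ⊢; lia)
            (mapEl T ((inclElements X).map (BarSmp.faceHom (ordHom (face r)) b)) k a)))
    refine Eq.trans (congrArg₂ (fun x y ↦ x + y) (congrArg₂ (fun x y ↦ x + y) ?_ ?_)
      ((congrArg (barIncl p T n') (resolutionAug_gen_succ T b hk a)).trans (map_zero _)))
      ((add_zero _).trans (add_assoc _ _ _).symm)
    · refine (congrArg (Tot.diff n n' h) (barHomotopy_gen T h b hk a)).trans ?_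
      refine (map_zsmul _ _ _).trans ?_
      exact congrArg (fun z ↦ (k.negOnePow : ℤ) • z) (diff_barCons_succ T h b _ a)
    · refine (congrArg (barHomotopy p T n' n'' h')
        (Tot.diff_gen (K := barSystem T p) h' b hk a)).trans ?_
      rw [map_add, map_zsmul]
      refine congrArg₂ (fun x y ↦ x + y) ?_ ?_
      · rw [← Units.val_neg, ← Int.negOnePow_succ]
        exact barHomotopy_gen T h' b (k := k + 1) (by lia) _
      · refine (congrArg (fun z ↦ (k.negOnePow : ℤ) • barHomotopy p T n' n'' h' z)
          (Tot.bdry_succ (K := barSystem T p) (n := n'') b (by lia) a)).trans ?_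
        rw [map_sum, Finset.smul_sum]
        refine Finset.sum_congr rfl fun r _ ↦ ?_
        rw [map_zsmul, smul_comm]
        refine congrArg (fun z ↦ (-1 : ℤ) ^ (r : ℕ) • z) ?_
        refine (congrArg (fun z ↦ (k.negOnePow : ℤ) • z)
          (barHomotopy_gen T h' (BarSmp.face (ordHom (face r)) b : Smp (bar p) m) (k := k)
            (by push_cast at hk ⊢; lia) _)).trans ?_
        rw [smul_smul, negOnePow_mul_self, one_smul]
        rfl

variable (p) in
lemma toBase_barOne : BarSmp.toBase (barOne p) = 𝟙 p := by
  apply CategoryOfElements.ext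
  exact Prod.ext (congrArg Quiver.Hom.op (Category.id_comp (𝟙 p.1.1.unop))) rfl

lemma quasiIso_resolutionAug (p : X.Elements) : QuasiIso (resolutionAug T p) := by
  refine quasiIso_of_contraction _ (barIncl p T) ?_ ?_ ?_
  · rintro n n' rfl z
    refine (DFunLike.congr_fun (tot_d (barSystem T p) rfl) _).trans ?_
    exact Tot.diff_gen_zero (K := barSystem T p) rfl (barOne p) (by simp) z
  · intro n z
    refine (resolutionAug_gen_zero T (barOne p) (by simp) z).trans ?_
    refine (degCast_rfl (T.obj p) _).trans ?_
    refine (congrArg (fun φ ↦ mapEl T φ n z) (toBase_barOne p)).trans ?_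
    exact mapEl_id T z
  · intro n n' n'' h h' y hy
    have key : Tot.diff n n' h ∘ₗ barHomotopy p T n n' h +
        barHomotopy p T n' n'' h' ∘ₗ Tot.diff n' n'' h' +
        barIncl p T n' ∘ₗ Tot.aug (barAug T p) n' = LinearMap.id :=
      Tot.hom_ext fun m b k hk a ↦ barHomotopy_diff_gen T h h' b hk a
    have hy' : Tot.diff n' n'' h' y = 0 :=
      (DFunLike.congr_fun (tot_d (barSystem T p) h') y).symm.trans hy
    refine ⟨barHomotopy p T n n' h y, ?_⟩
    refine (LinearMap.congr_fun key y).symm.trans ((add_comm _ _).trans ?_)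
    refine congrArg (fun z ↦ barIncl p T n' (Tot.aug (barAug T p) n' y) + z) ?_
    refine (congrArg (fun z ↦ Tot.diff n n' h (barHomotopy p T n n' h y) +
      barHomotopy p T n' n'' h' z) hy').trans ?_
    rw [map_zero, add_zero]
    exact (DFunLike.congr_fun (tot_d (barSystem T p) h) _).symm

/-- The augmentation of the bar resolution, as a map of systems of complexes. -/
noncomputable def resolutionAugNat : resolutionObj T ⟶ T where
  app p := resolutionAug T p
  naturality p p' φ := by
    refine tot_hom_ext fun n m b k hk a ↦ ?_
    refine (congrArg ((resolutionAug T p').f n).hom (resolutionPush_gen T φ b hk a)).trans ?_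
    obtain _ | m := m
    · refine (resolutionAug_gen_zero T (barPush φ b) hk _).trans ?_
      refine Eq.trans ?_ (congrArg ((T.map φ).f n).hom (resolutionAug_gen_zero T b hk a).symm)
      refine Eq.trans ?_ (degCast_map (T.map φ) _ _).symm
      refine congrArg (degCast (T.obj p') _) ?_
      refine (mapEl_comp T (barPushHom φ b) (BarSmp.toBase (barPush φ b)) a).symm.trans ?_
      refine Eq.trans ?_ (mapEl_comp T (BarSmp.toBase b) φ a)
      exact congrArg (fun φ ↦ mapEl T φ k a) (BarSmp.pushHom_toBase φ b)
    · refine (resolutionAug_gen_succ T (barPush φ b) hk _).trans ?_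
      exact ((congrArg ((T.map φ).f n).hom
        (resolutionAug_gen_succ T b hk a)).trans (map_zero _)).symm

variable [TopologicalSpace G]

variable (R X) in
/-- The bar resolution of a complex of smooth coefficients. -/
noncomputable def smoothResolution (hX : HasOpenStabilizers X) :
    CochainComplex (SmoothCoefficients R X) ℤ ⥤ CochainComplex (SmoothCoefficients R X) ℤ :=
  liftPointwise (pointwise R (toBG X) ⋙ resolution X R) fun K ↦
    isSmoothComplex_resolutionObj _ hX (isSmoothComplex_pointwise K)

variable (R X) in
/-- The augmentation of the bar resolution of a complex of smooth coefficients. -/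
noncomputable def smoothResolutionAug (hX : HasOpenStabilizers X) :
    smoothResolution X R hX ⟶ 𝟭 _ where
  app K := (fullyFaithfulPointwise R _).preimage
    (X := (smoothResolution X R hX).obj K) (Y := K)
    (resolutionAugNat ((pointwise R (toBG X)).obj K))
  naturality K K' f := by
    let T := (pointwise R (toBG X)).obj K
    let T' := (pointwise R (toBG X)).obj K'
    let τ : T ⟶ T' := (pointwise R (toBG X)).map f
    apply (fullyFaithfulPointwise R _).map_injective
    ext p : 2
    refine tot_hom_ext fun n m b k hk a ↦ ?_
    refine (congrArg ((resolutionAug T' p).f n).hom (resolutionMap_gen τ b hk a)).trans ?_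
    obtain _ | m := m
    · refine (resolutionAug_gen_zero T' b hk _).trans ?_
      refine Eq.trans ?_ (congrArg ((τ.app p).f n).hom (resolutionAug_gen_zero T b hk a).symm)
      refine Eq.trans ?_ (degCast_map (τ.app p) _ _).symm
      exact congrArg (degCast (T'.obj p) _) (mapEl_naturality τ (BarSmp.toBase b) a).symm
    · refine (resolutionAug_gen_succ T' b hk _).trans ?_
      exact ((congrArg ((τ.app p).f n).hom
        (resolutionAug_gen_succ T b hk a)).trans (map_zero _)).symm

lemma quasiIso_smoothResolutionAug (hX : HasOpenStabilizers X)
    (K : CochainComplex (SmoothCoefficients R X) ℤ) :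
    QuasiIso ((smoothResolutionAug X R hX).app K) :=
  (quasiIso_iff_pointwise _).2 fun p ↦ quasiIso_resolutionAug ((pointwise R (toBG X)).obj K) p

end

end MayerVietoris

/-! ### The last-vertex map from the bar resolution to the chains -/

namespace MayerVietoris

/-- The face of a monotone map. -/
def faceOrd {j : ℕ} (r : Fin (j + 2)) : Fin (j + 1) →o Fin (j + 2) :=
  (Fin.succAboveOrderEmb r).toOrderHom

lemma faceOrd_apply {j : ℕ} (r : Fin (j + 2)) (i : Fin (j + 1)) : faceOrd r i = r.succAbove i := rfl

lemma exists_eq_succ_of_not_injective {α : Type*} [PartialOrder α] {j : ℕ} (t : Fin (j + 1) →o α)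
    (ht : ¬ Function.Injective t) : ∃ i : Fin j, t i.castSucc = t i.succ := by
  by_contra! h
  exact ht (Fin.strictMono_iff_lt_succ.2 fun i ↦
    lt_of_le_of_ne (t.monotone (Fin.castSucc_le_succ i)) (h i)).injective

/-- If `t` repeats a value at two consecutive places, the two faces omitting one of these places
agree and have opposite signs; every other face still contains the repetition. -/
lemma sum_faces_eq_zero {α M : Type*} [PartialOrder α] [AddCommGroup M] {j : ℕ}
    (φ : (Fin (j + 1) →o α) → M) (hφ : ∀ t : Fin (j + 1) →o α, ¬ Function.Injective t → φ t = 0)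
    (t : Fin (j + 2) →o α) (ht : ¬ Function.Injective t) :
    ∑ r : Fin (j + 2), (-1 : ℤ) ^ (r : ℕ) • φ (t.comp (faceOrd r)) = 0 := by
  obtain ⟨i, hi⟩ := exists_eq_succ_of_not_injective t ht
  rw [Fintype.sum_eq_add i.castSucc i.succ (by simp [Fin.ext_iff])]
  · have : t.comp (faceOrd i.castSucc) = t.comp (faceOrd i.succ) := by
      ext l
      simp only [OrderHom.comp_coe, Function.comp_apply, faceOrd_apply]
      rcases lt_trichotomy l i with h | rfl | h
      · rw [Fin.succAbove_of_castSucc_lt _ _ (by simpa using h),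
          Fin.succAbove_of_castSucc_lt _ _ (Fin.castSucc_lt_succ_iff.2 h.le)]
      · rw [Fin.succAbove_castSucc_self, Fin.succAbove_succ_self, hi]
      · rw [Fin.succAbove_of_le_castSucc _ _ (by simpa using h.le),
          Fin.succAbove_of_le_castSucc _ _ (Fin.succ_le_castSucc_iff.2 h)]
    rw [this, Fin.val_succ, Fin.val_castSucc, pow_succ]
    simp
  · rintro r ⟨h₁, h₂⟩
    rw [hφ _ fun hinj ↦ ?_, smul_zero]
    obtain ⟨a, ha⟩ := Fin.exists_succAbove_eq h₁.symm
    obtain ⟨b, hb⟩ := Fin.exists_succAbove_eq h₂.symm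
    have : a = b := hinj (by
      simp only [OrderHom.comp_coe, Function.comp_apply, faceOrd_apply, ha, hb, hi])
    subst this
    exact absurd (ha.symm.trans hb) (by simp [Fin.ext_iff])

/-- The face inclusion given by an injective monotone map. -/
def injOf {j m : ℕ} (t : Fin (j + 1) →o Fin (m + 1)) (ht : Function.Injective t) : Inj j m :=
  SemiSimplexCategory.homEquiv.symm
    (OrderEmbedding.ofStrictMono t (t.monotone.strictMono_of_injective ht))

lemma ordHom_injOf {j m : ℕ} (t : Fin (j + 1) →o Fin (m + 1)) (ht : Function.Injective t) :
    ordHom (injOf t ht) = t := by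
  rw [ordHom, injOf, Equiv.apply_symm_apply]
  rfl

lemma ordHom_injective {n n' : SemiSimplexCategory} (f : n ⟶ n') : Function.Injective (ordHom f) :=
  (SemiSimplexCategory.homEquiv f).injective

lemma eq_of_ordHom_eq {n n' : SemiSimplexCategory} {f g : n ⟶ n'} (h : ordHom f = ordHom g) :
    f = g := by
  apply SemiSimplexCategory.homEquiv.injective
  exact RelEmbedding.ext fun i ↦ DFunLike.congr_fun h i

lemma injOf_ordHom {j m : ℕ} (f : Inj j m) : injOf (ordHom f) (ordHom_injective f) = f :=
  eq_of_ordHom_eq (ordHom_injOf _ _)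

lemma ordHom_face {j : ℕ} (r : Fin (j + 2)) : ordHom (face r) = faceOrd r := rfl

namespace Tot

section

variable {R : Type u} [Ring R] {S : SemiSimplexCategoryᵒᵖ ⥤ Type u}
  {K : S.Elements ⥤ CochainComplex (ModuleCat.{u} R) ℤ}

open Classical in
/-- The element of the total complex given by a sequence of vertices of a simplex, which is zero
for degenerate sequences. -/
noncomputable def brk {m j : ℕ} (x : Smp S m) (t : Fin (j + 1) →o Fin (m + 1)) {k n : ℤ}
    (h : k = n + j) : val K x k →ₗ[R] Tot K n :=
  if ht : Function.Injective t then genMap (injOf t ht) x h else 0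

lemma brk_of_injective {m j : ℕ} (x : Smp S m) (t : Fin (j + 1) →o Fin (m + 1)) {k n : ℤ}
    (h : k = n + j) (ht : Function.Injective t) :
    brk (K := K) x t h = genMap (injOf t ht) x h := dif_pos ht

lemma brk_ordHom {m j : ℕ} (x : Smp S m) (f : Inj j m) {k n : ℤ}
    (h : k = n + j) : brk (K := K) x (ordHom f) h = genMap f x h := by
  rw [brk_of_injective x _ h (ordHom_injective f), injOf_ordHom]

lemma brk_of_not_injective {m j : ℕ} (x : Smp S m) (t : Fin (j + 1) →o Fin (m + 1)) {k n : ℤ}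
    (h : k = n + j) (ht : ¬ Function.Injective t) : brk (K := K) x t h = 0 := dif_neg ht

/-- Restriction to a face only relabels vertices, and an injective relabelling neither creates nor
removes repetitions. -/
lemma brk_valMap {m l j : ℕ} {x : Smp S m} {y : Smp S l} (t : Fin (j + 1) →o Fin (l + 1))
    (φ : smp x ⟶ smp y) {k n : ℤ} (h : k = n + j) (a : val K x k) :
    brk y t h (valMap K φ k a) = brk x ((ordHom φ.1.unop).comp t) h a := by
  by_cases ht : Function.Injective t
  · rw [brk_of_injective _ _ _ ht, genMap_valMap, ← brk_ordHom, ordHom_comp, ordHom_injOf]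
  · rw [brk_of_not_injective _ _ _ ht, brk_of_not_injective, LinearMap.zero_apply,
      LinearMap.zero_apply]
    exact fun h ↦ ht (Function.Injective.of_comp h)

lemma diff_brk_zero {n n' : ℤ} (h : n + 1 = n') {m : ℕ} (t : Fin (0 + 1) →o Fin (m + 1))
    (x : Smp S m) {k : ℤ} (hk : k = n + (0 : ℕ)) (a : val K x k) :
    diff n n' h (brk x t hk a) =
      brk x t (k := k + 1) (n := n') (by lia) (valD K x k (k + 1) a) := by
  have ht : Function.Injective t := Function.injective_of_subsingleton (α := Fin 1) _
  rw [brk_of_injective _ _ _ ht, brk_of_injective _ _ _ ht, diff_genMap_zero]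

/-- With degenerate sequences set to zero, the boundary formula holds uniformly for all monotone
sequences. This is needed because different simplices of a chain can share their last vertex. -/
lemma diff_brk_succ {n n' : ℤ} (h : n + 1 = n') {m j : ℕ} (t : Fin (j + 1 + 1) →o Fin (m + 1))
    (x : Smp S m) {k : ℤ} (hk : k = n + (j + 1 : ℕ)) (a : val K x k) :
    diff n n' h (brk x t hk a) =
      brk x t (k := k + 1) (n := n') (by lia) (valD K x k (k + 1) a) + (k.negOnePow : ℤ) •
        ∑ r : Fin (j + 2), (-1 : ℤ) ^ (r : ℕ) • brk x (t.comp (faceOrd r)) (n := n')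
          (by push_cast at hk ⊢; lia) a := by
  by_cases ht : Function.Injective t
  · rw [brk_of_injective _ _ _ ht, brk_of_injective _ _ _ ht, diff_genMap_succ]
    congr 2
    refine Finset.sum_congr rfl fun r _ ↦ ?_
    rw [← brk_ordHom, ordHom_comp, ordHom_injOf, ordHom_face]
  · rw [brk_of_not_injective _ _ _ ht, brk_of_not_injective _ _ _ ht, LinearMap.zero_apply,
      LinearMap.zero_apply, map_zero, zero_add]
    refine Eq.symm ((congrArg _ ?_).trans (smul_zero _))
    refine sum_faces_eq_zero (fun t ↦ brk (K := K) x t (k := k) (n := n')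
      (by push_cast at hk ⊢; lia) a) ?_ t ht
    intro t ht
    exact LinearMap.congr_fun (brk_of_not_injective _ _ _ ht) a

lemma aug_brk_zero {L : CochainComplex (ModuleCat.{u} R) ℤ} (ζ : K ⟶ (Functor.const _).obj L)
    {k n : ℤ} {m : ℕ} (t : Fin (0 + 1) →o Fin (m + 1))
    (x : Smp S m) (hk : k = n + (0 : ℕ)) (a : val K x k) :
    aug ζ n (brk x t hk a) = degCast L (by simpa using hk) (augVal ζ x k a) := by
  rw [brk_of_injective _ _ _ (Function.injective_of_subsingleton (α := Fin 1) _), aug_genMap_zero]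

lemma aug_brk_succ {L : CochainComplex (ModuleCat.{u} R) ℤ} (ζ : K ⟶ (Functor.const _).obj L)
    {k n : ℤ} {m j : ℕ} (t : Fin (j + 1 + 1) →o Fin (m + 1))
    (x : Smp S m) (hk : k = n + (j + 1 : ℕ)) (a : val K x k) :
    aug ζ n (brk x t hk a) = 0 := by
  by_cases ht : Function.Injective t
  · rw [brk_of_injective _ _ _ ht, aug_genMap_succ]
  · rw [brk_of_not_injective _ _ _ ht, LinearMap.zero_apply, map_zero]

end

lemma map_brk {R : Type u} [Ring R] {S S' : SemiSimplexCategoryᵒᵖ ⥤ Type u}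
    {K : S.Elements ⥤ CochainComplex (ModuleCat.{u} R) ℤ}
    {K' : S'.Elements ⥤ CochainComplex (ModuleCat.{u} R) ℤ} (f : S ⟶ S')
    (τ : K ⟶ NatTrans.mapElements f ⋙ K') {n : ℤ} {m j : ℕ}
    (t : Fin (j + 1) →o Fin (m + 1)) (x : Smp S m) {k : ℤ} (hk : k = n + j) (a : val K x k) :
    map f τ n (brk x t hk a) =
      brk (K := K') (m := m) (f.app _ x) t hk (mapVal f τ x k a) := by
  by_cases ht : Function.Injective t
  · rw [brk_of_injective _ _ _ ht, brk_of_injective _ _ _ ht, map_genMap]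
  · rw [brk_of_not_injective _ _ _ ht, brk_of_not_injective _ _ _ ht, LinearMap.zero_apply,
      LinearMap.zero_apply, map_zero]

end Tot

section

variable {G : Type u} [Group G] {X : GSemiSimplicialSet G} {p : X.Elements}

namespace BarSmp

/-- The last vertices of the simplices of a chain, as vertices of the last simplex. -/
def vert {n : SemiSimplexCategory} (b : BarSmp p n) :
    Fin (n.len + 1) →o Fin ((b.F.obj (Fin.last _)).len + 1) where
  toFun i := ordHom (b.F.map (homOfLE (Fin.le_last i))) (Fin.last _)
  monotone' i j h := by
    have : b.F.map (homOfLE (Fin.le_last i)) =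
        b.F.map (homOfLE h) ≫ b.F.map (homOfLE (Fin.le_last j)) := by
      rw [← b.F.map_comp]
      rfl
    exact le_of_eq_of_le (DFunLike.congr_fun ((congrArg ordHom this).trans (ordHom_comp _ _))
      (Fin.last _)) ((ordHom _).monotone (Fin.le_last _))

/-- When a face drops the end of the chain, the last simplex shrinks. Its vertices must then be
viewed in the original last simplex, where functoriality of the chain identifies them with the
selected ones. -/
lemma vert_face {n n' : SemiSimplexCategory} (f : Fin (n'.len + 1) →o Fin (n.len + 1))
    (b : BarSmp p n) : (ordHom (b.F.map (homOfLE (Fin.le_last (f (Fin.last _)))))).comp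
      (b.face f).vert = b.vert.comp f := by
  refine DFunLike.ext _ _ fun i ↦ ?_
  have : b.F.map (homOfLE (Fin.le_last (f i))) =
      b.F.map (homOfLE (f.monotone (Fin.le_last i))) ≫
        b.F.map (homOfLE (Fin.le_last (f (Fin.last _)))) := by
    rw [← b.F.map_comp]
    rfl
  have h' := DFunLike.congr_fun ((congrArg ordHom this).trans (ordHom_comp _ _)) (Fin.last _)
  exact h'.symm

end BarSmp

variable {R : Type u} [Ring R] (T : X.Elements ⥤ CochainComplex (ModuleCat.{u} R) ℤ)

/-- The dimension of the last simplex of a chain. -/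
abbrev topDim {m : ℕ} (b : Smp (bar p) m) : ℕ := (b.F.obj (Fin.last _)).len

/-- The last simplex of a chain. -/
def topSmp {m : ℕ} (b : Smp (bar p) m) : Smp (underlying X) (topDim b) := b.top

/-- The element of the chains given by a sequence of vertices of the last simplex of a chain. -/
noncomputable def topBrk {m j : ℕ} (b : Smp (bar p) m) (t : Fin (j + 1) →o Fin (topDim b + 1))
    {k n : ℤ} (hk : k = n + j) (a : (T.obj (barEl b)).X k) : Tot (inclElements X ⋙ T) n :=
  Tot.brk (K := inclElements X ⋙ T) (topSmp b) t hk a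

lemma diff_topBrk_zero {n n' : ℤ} (h : n + 1 = n') {m : ℕ} (b : Smp (bar p) m)
    (t : Fin (0 + 1) →o Fin (topDim b + 1)) {k : ℤ} (hk : k = n + (0 : ℕ))
    (a : (T.obj (barEl b)).X k) : Tot.diff n n' h (topBrk T b t hk a) =
      topBrk T b t (k := k + 1) (n := n') (by lia) (((T.obj (barEl b)).d k (k + 1)).hom a) :=
  Tot.diff_brk_zero (K := inclElements X ⋙ T) h t (topSmp b) hk a

lemma diff_topBrk_succ {n n' : ℤ} (h : n + 1 = n') {m j : ℕ} (b : Smp (bar p) m)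
    (t : Fin (j + 1 + 1) →o Fin (topDim b + 1)) {k : ℤ} (hk : k = n + (j + 1 : ℕ))
    (a : (T.obj (barEl b)).X k) : Tot.diff n n' h (topBrk T b t hk a) =
      topBrk T b t (k := k + 1) (n := n') (by lia) (((T.obj (barEl b)).d k (k + 1)).hom a) +
      (k.negOnePow : ℤ) • ∑ r : Fin (j + 2), (-1 : ℤ) ^ (r : ℕ) •
        topBrk T b (t.comp (faceOrd r)) (n := n') (by push_cast at hk ⊢; lia) a :=
  Tot.diff_brk_succ (K := inclElements X ⋙ T) h t (topSmp b) hk a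

lemma topBrk_face {m l j : ℕ} (f : Inj l m) (b : Smp (bar p) m)
    (t : Fin (j + 1) →o Fin (topDim (m := l) (BarSmp.face (ordHom f) b) + 1)) {k n : ℤ}
    (hk : k = n + j) (a : (T.obj (barEl b)).X k) :
    topBrk T (BarSmp.face (ordHom f) b : Smp (bar p) l) t hk
        (mapEl T ((inclElements X).map (BarSmp.faceHom (ordHom f) b)) k a) =
      topBrk T b ((ordHom (b.F.map (homOfLE (Fin.le_last (ordHom f (Fin.last _)))))).comp t) hk a :=
  Tot.brk_valMap (K := inclElements X ⋙ T) (x := topSmp b)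
    (y := topSmp (BarSmp.face (ordHom f) b : Smp (bar p) l)) t (BarSmp.faceHom (ordHom f) b) hk a

/-- Translation acts on the last simplex and leaves the numbering of its vertices unchanged. This
gives the naturality of the last-vertex map in `p`. -/
lemma chainsAct_topBrk {p' : X.Elements} (φ : p ⟶ p') {m j : ℕ} (b : Smp (bar p) m)
    (t : Fin (j + 1) →o Fin (topDim b + 1)) {k n : ℤ} (hk : k = n + j)
    (a : (T.obj (barEl b)).X k) :
    ((chainsAct T φ.1.2).f n).hom (topBrk T b t hk a) =
      topBrk T (barPush φ b) t hk (mapEl T (barPushHom φ b) k a) :=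
  Tot.map_brk (act X φ.1.2) (actSystem X T φ.1.2) t (topSmp b) hk a

/-- The map from the bar resolution to the chains, as linear maps. -/
noncomputable def barChainLin (p : X.Elements) (n : ℤ) :
    Tot (barSystem T p) n →ₗ[R] Tot (inclElements X ⋙ T) n :=
  Tot.lift fun _ b _ hk ↦ Tot.brk (K := inclElements X ⋙ T) (topSmp b) (BarSmp.vert b) hk

lemma barChainLin_gen {m : ℕ} (b : Smp (bar p) m) {k n : ℤ} (hk : k = n + m)
    (a : (T.obj (barEl b)).X k) :
    barChainLin T p n (barGen T b hk a) = topBrk T b (BarSmp.vert b) hk a :=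
  Tot.lift_gen (K := barSystem T p) _ _ _ _

lemma barChainLin_genMap {m l : ℕ} (f : Inj l m) (b : Smp (bar p) m) {k n : ℤ} (hk : k = n + l)
    (a : (T.obj (barEl b)).X k) :
    barChainLin T p n (Tot.genMap (K := barSystem T p) f b hk a) =
      topBrk T b ((BarSmp.vert b).comp (ordHom f)) hk a := by
  refine (congrArg (barChainLin T p n) (genMap_barSystem T f b hk a)).trans ?_
  refine (barChainLin_gen T _ hk _).trans ((topBrk_face T f b _ hk a).trans ?_)
  exact congrArg (fun t ↦ topBrk T b t hk a) (BarSmp.vert_face (ordHom f) b)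

/-- The map from the bar resolution to the chains. -/
noncomputable def barChain (p : X.Elements) : tot (barSystem T p) ⟶ tot (inclElements X ⋙ T) :=
  totDesc (L := tot (inclElements X ⋙ T)) (barChainLin T p) fun n n' h m b k hk a ↦ by
    refine (DFunLike.congr_fun (tot_d (inclElements X ⋙ T) h) _).trans ?_
    refine (congrArg (Tot.diff n n' h) (barChainLin_gen T b hk a)).trans ?_
    obtain _ | m := m
    · refine (diff_topBrk_zero T h b _ hk a).trans (Eq.symm ?_)
      refine (congrArg (barChainLin T p n')
        (Tot.diff_gen_zero (K := barSystem T p) h b hk a)).trans ?_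
      exact barChainLin_gen T b _ _
    · refine (diff_topBrk_succ T h b _ hk a).trans (Eq.symm ?_)
      refine (congrArg (barChainLin T p n') (Tot.diff_gen (K := barSystem T p) h b hk a)).trans ?_
      rw [map_add, map_zsmul]
      refine congrArg₂ (fun x y ↦ x + (k.negOnePow : ℤ) • y) (barChainLin_gen T b _ _) ?_
      refine (congrArg (barChainLin T p n')
        (Tot.bdry_succ (K := barSystem T p) (n := n') b (by lia) a)).trans ?_
      rw [map_sum]
      refine Finset.sum_congr rfl fun r _ ↦ ?_
      rw [map_zsmul]
      exact congrArg (fun x ↦ (-1 : ℤ) ^ (r : ℕ) • x) (barChainLin_genMap T (face r) b _ a)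

lemma barChain_gen {m : ℕ} (b : Smp (bar p) m) {k n : ℤ} (hk : k = n + m)
    (a : (T.obj (barEl b)).X k) :
    ((barChain T p).f n).hom (barGen T b hk a) = topBrk T b (BarSmp.vert b) hk a :=
  barChainLin_gen T b hk a

lemma chainsMap_topBrk {T T' : X.Elements ⥤ CochainComplex (ModuleCat.{u} R) ℤ} (τ : T ⟶ T')
    {m j : ℕ} (b : Smp (bar p) m)
    (t : Fin (j + 1) →o Fin (topDim b + 1)) {k n : ℤ} (hk : k = n + j)
    (a : (T.obj (barEl b)).X k) :
    ((chainsMap τ).f n).hom (topBrk T b t hk a) =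
      topBrk T' b t hk (((τ.app (barEl b)).f k).hom a) := by
  refine (Tot.map_brk (𝟙 (underlying X)) (overId (Functor.whiskerLeft (inclElements X) τ)) t
    (topSmp b) hk a).trans ?_
  rfl

/-- The natural map from the bar resolution to the chains. -/
noncomputable def resolutionToChains : resolutionObj T ⟶ toBG X ⋙ chainsObj T where
  app p := barChain T p
  naturality p p' φ := by
    refine tot_hom_ext fun n m b k hk a ↦ ?_
    refine (congrArg ((barChain T p').f n).hom (resolutionPush_gen T φ b hk a)).trans ?_
    refine (barChain_gen T (barPush φ b) hk _).trans ?_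
    refine (chainsAct_topBrk T φ b (BarSmp.vert b) hk a).symm.trans ?_
    exact (congrArg ((chainsAct T φ.1.2).f n).hom (barChain_gen T b hk a)).symm

variable [TopologicalSpace G]

variable (X R) in
/-- The natural map from the bar resolution to the restriction of the chains. -/
noncomputable def smoothResolutionToChains (hX : HasOpenStabilizers X) :
    smoothResolution X R hX ⟶ smoothChains R X hX ⋙ restrictionComplex R X where
  app K := (fullyFaithfulPointwise R _).preimage
    (X := (smoothResolution X R hX).obj K)
    (Y := (smoothChains R X hX ⋙ restrictionComplex R X).obj K)
    (resolutionToChains ((pointwise R (toBG X)).obj K))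
  naturality K K' f := by
    let T := (pointwise R (toBG X)).obj K
    let T' := (pointwise R (toBG X)).obj K'
    let τ : T ⟶ T' := (pointwise R (toBG X)).map f
    apply (fullyFaithfulPointwise R _).map_injective
    ext p : 2
    refine tot_hom_ext fun n m b k hk a ↦ ?_
    refine (congrArg ((barChain T' p).f n).hom (resolutionMap_gen τ b hk a)).trans ?_
    refine (barChain_gen T' b hk _).trans ?_
    refine (chainsMap_topBrk τ b (BarSmp.vert b) hk a).symm.trans ?_
    exact (congrArg ((chainsMap τ).f n).hom (barChain_gen T b hk a)).symm

-- For coefficients restricted from `G`, face operators act trivially on values, so in dimension 0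
-- neither the choice of the last vertex nor the passage to the base matters. In positive dimensions
-- both augmentations vanish.
variable (R) in
lemma smoothResolutionToChains_triangle (hX : HasOpenStabilizers X)
    (V : CochainComplex (SmoothRep R G) ℤ) :
    (smoothResolutionToChains X R hX).app ((restrictionComplex R X).obj V) ≫
      (restrictionComplex R X).map ((chainsAug R X hX).app V) =
    (smoothResolutionAug X R hX).app ((restrictionComplex R X).obj V) := by
  let T := (pointwise R (toBG X)).obj ((restrictionComplex R X).obj V)
  apply (fullyFaithfulPointwise R _).map_injective
  ext p : 2
  refine tot_hom_ext fun n m b k hk a ↦ ?_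
  refine (congrArg ((totAug (restrictAug R X V)).f n).hom (barChain_gen T b hk a)).trans ?_
  obtain _ | m := m
  · refine (Tot.aug_brk_zero (restrictAug R X V) (BarSmp.vert b) (topSmp b) hk a).trans ?_
    refine Eq.trans ?_ (resolutionAug_gen_zero T b hk a).symm
    refine congrArg (degCast (T.obj p) _) ?_
    exact (mapEl_id ((pointwise R (𝟭 (SingleObj G))).obj V) a).symm
  · refine (Tot.aug_brk_succ (restrictAug R X V) (BarSmp.vert b) (topSmp b) hk a).trans ?_
    exact (resolutionAug_gen_succ T b hk a).symm

end

end MayerVietoris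

/-! ### The join homotopy and the chains of the last-vertex map -/

namespace MayerVietoris

lemma quasiIso_of_homotopy {R : Type u} [Ring R] {K L : CochainComplex (ModuleCat.{u} R) ℤ}
    (f g : K ⟶ L) (H : ∀ n n' : ℤ, n + 1 = n' → (K.X n' →ₗ[R] L.X n))
    (hH : ∀ (n n' n'' : ℤ) (h : n + 1 = n') (h' : n' + 1 = n'') (y : K.X n'),
      (L.d n n').hom (H n n' h y) + H n' n'' h' ((K.d n' n'').hom y) =
        (f.f n').hom y - (g.f n').hom y) (hg : QuasiIso g) : QuasiIso f := by
  rw [quasiIso_iff_elements] at hg ⊢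
  intro n₀ n n' n'' h₀ h₁ h₂ y z hy hz
  have hLd (x : L.X n₀) : (L.d n n').hom ((L.d n₀ n).hom x) = 0 :=
    ConcreteCategory.congr_hom (L.d_comp_d n₀ n n') x
  have h1 := hH n n' n'' h₁ h₂ y
  rw [hy, map_zero, add_zero, hz] at h1
  -- Subtracting the homotopy turns a cycle in the cone of `f` into a cycle in the cone of `g`; the
  -- solution is translated back in the same way.
  obtain ⟨y', z', rfl, hz'⟩ := hg n₀ n n' n'' h₀ h₁ h₂ y (z - H n n' h₁ y) hy
    (by rw [map_sub, h1]; abel)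
  have h2 := hH n₀ n n' h₀ h₁ y'
  refine ⟨y', z' - H n₀ n h₀ y', rfl, ?_⟩
  rw [map_sub, eq_sub_of_add_eq h2]
  rw [sub_eq_iff_eq_add] at hz'
  rw [hz']
  abel

section

variable {A : Type*} [PartialOrder A]

/-- The concatenation of two monotone sequences. -/
def appendOrd {N j m : ℕ} (hN : N = j + m + 1) (α : Fin (j + 1) →o A) (β : Fin (m + 1) →o A)
    (h : ∀ i i', α i ≤ β i') : Fin (N + 1) →o A where
  toFun i := if hi : (i : ℕ) < j + 1 then α ⟨i, hi⟩ else β ⟨i - (j + 1), by omega⟩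
  monotone' i i' hi := by
    have : (i : ℕ) ≤ i' := hi
    dsimp only
    split_ifs with h₁ h₂ h₂
    · exact α.monotone hi
    · exact h _ _
    · omega
    · exact β.monotone (by simp only [Fin.mk_le_mk]; omega)

lemma appendOrd_congr {N j m : ℕ} (hN : N = j + m + 1) {α α' : Fin (j + 1) →o A}
    {β β' : Fin (m + 1) →o A} (hα : α = α') (hβ : β = β') (h : ∀ i i', α i ≤ β i')
    (h' : ∀ i i', α' i ≤ β' i') : appendOrd hN α β h = appendOrd hN α' β' h' := by
  subst hα hβ
  rfl

lemma comp_appendOrd {B : Type*} [PartialOrder B] (f : A →o B) {N j m : ℕ} (hN : N = j + m + 1)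
    (α : Fin (j + 1) →o A) (β : Fin (m + 1) →o A) (h : ∀ i i', α i ≤ β i') :
    f.comp (appendOrd hN α β h) =
      appendOrd hN (f.comp α) (f.comp β) fun i i' ↦ f.monotone (h i i') := by
  refine DFunLike.ext _ _ fun i ↦ ?_
  exact apply_dite f _ _ _

lemma appendOrd_left {N j m : ℕ} (hN : N = j + m + 1) (α : Fin (j + 1) →o A)
    (β : Fin (m + 1) →o A) (h : ∀ i i', α i ≤ β i') {i : Fin (N + 1)} {l : Fin (j + 1)}
    (hl : (i : ℕ) = l) : appendOrd hN α β h i = α l :=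
  (dif_pos (hl.trans_lt l.2)).trans (congrArg α (Fin.ext hl))

lemma appendOrd_right {N j m : ℕ} (hN : N = j + m + 1) (α : Fin (j + 1) →o A)
    (β : Fin (m + 1) →o A) (h : ∀ i i', α i ≤ β i') {i : Fin (N + 1)} {l : Fin (m + 1)}
    (hl : (i : ℕ) = j + 1 + l) : appendOrd hN α β h i = β l :=
  (dif_neg (by omega)).trans (congrArg β (Fin.ext (by simp [hl])))

lemma val_succAbove {n : ℕ} (r : Fin (n + 1)) (i : Fin n) :
    (r.succAbove i : ℕ) = if (i : ℕ) < r then (i : ℕ) else i + 1 := by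
  simp only [Fin.succAbove, Fin.lt_def, Fin.val_castSucc]
  split_ifs <;> rfl

lemma appendOrd_face_left {N j m : ℕ} (hN : N + 1 = j + 1 + m + 1) (α : Fin (j + 2) →o A)
    (β : Fin (m + 1) →o A) (h : ∀ i i', α i ≤ β i') (r : Fin (j + 2)) (r' : Fin (N + 2))
    (hr : (r' : ℕ) = r) : (appendOrd hN α β h).comp (faceOrd r') =
      appendOrd (by omega) (α.comp (faceOrd r)) β fun _ _ ↦ h _ _ := by
  have hN' : N = j + m + 1 := by omega
  have hle (i i') : α.comp (faceOrd r) i ≤ β i' := h _ _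
  refine DFunLike.ext _ _ fun i ↦ ?_
  by_cases hi : (i : ℕ) < j + 1
  · refine Eq.trans ?_ (appendOrd_left (i := i) hN' _ _ hle (l := ⟨i, hi⟩) rfl).symm
    refine appendOrd_left hN α β h (i := faceOrd r' i) ?_
    simp only [faceOrd_apply, val_succAbove, hr]
  · refine Eq.trans ?_ (appendOrd_right (i := i) hN' _ _ hle
      (l := ⟨i - (j + 1), by omega⟩) (by simp only; omega)).symm
    refine appendOrd_right hN α β h (i := faceOrd r' i) ?_
    simp only [faceOrd_apply, val_succAbove, hr]
    split_ifs <;> omega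

lemma appendOrd_face_right {N j m : ℕ} (hN : N + 1 = j + (m + 1) + 1) (α : Fin (j + 1) →o A)
    (β : Fin (m + 2) →o A) (h : ∀ i i', α i ≤ β i') (r : Fin (m + 2)) (r' : Fin (N + 2))
    (hr : (r' : ℕ) = j + 1 + r) : (appendOrd hN α β h).comp (faceOrd r') =
      appendOrd (by omega) α (β.comp (faceOrd r)) fun _ _ ↦ h _ _ := by
  have hN' : N = j + m + 1 := by omega
  have hle (i i') : α i ≤ β.comp (faceOrd r) i' := h _ _
  refine DFunLike.ext _ _ fun i ↦ ?_
  by_cases hi : (i : ℕ) < j + 1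
  · refine Eq.trans ?_ (appendOrd_left (i := i) hN' _ _ hle (l := ⟨i, hi⟩) rfl).symm
    refine appendOrd_left hN α β h (i := faceOrd r' i) ?_
    simp only [faceOrd_apply, val_succAbove, hr]
    split_ifs <;> omega
  · refine Eq.trans ?_ (appendOrd_right (i := i) hN' _ _ hle
      (l := ⟨i - (j + 1), by omega⟩) (by simp only; omega)).symm
    refine appendOrd_right hN α β h (i := faceOrd r' i) ?_
    simp only [faceOrd_apply, val_succAbove, hr]
    split_ifs <;> omega

lemma appendOrd_face_zero {m : ℕ} (hN : m + 1 = 0 + m + 1) (α : Fin (0 + 1) →o A)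
    (β : Fin (m + 1) →o A) (h : ∀ i i', α i ≤ β i') (r' : Fin (m + 2))
    (hr : (r' : ℕ) = 0) : (appendOrd hN α β h).comp (faceOrd r') = β := by
  refine DFunLike.ext _ _ fun i ↦ ?_
  refine appendOrd_right hN α β h (i := faceOrd r' i) ?_
  simp only [faceOrd_apply, val_succAbove, hr]
  split_ifs <;> omega

lemma appendOrd_face_last {j : ℕ} (hN : j + 1 = j + 0 + 1) (α : Fin (j + 1) →o A)
    (β : Fin (0 + 1) →o A) (h : ∀ i i', α i ≤ β i') (r' : Fin (j + 2))
    (hr : (r' : ℕ) = j + 1) : (appendOrd hN α β h).comp (faceOrd r') = α := by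
  refine DFunLike.ext _ _ fun i ↦ ?_
  refine appendOrd_left hN α β h (i := faceOrd r' i) ?_
  simp only [faceOrd_apply, val_succAbove, hr]
  split_ifs <;> omega

end

lemma sum_fin_split {M : Type*} [AddCommMonoid M] {N a b : ℕ} (h : N = a + b) (g : Fin N → M) :
    ∑ i, g i = ∑ i : Fin a, g ⟨i, by omega⟩ + ∑ i : Fin b, g ⟨a + i, by omega⟩ := by
  subst h
  exact Fin.sum_univ_add g

section

variable {G : Type u} [Group G] {X : GSemiSimplicialSet G} {p : X.Elements}

namespace BarSmp

/-- The vertices of the base of a chain, as vertices of the last simplex. -/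
def baseVert {n : SemiSimplexCategory} (b : BarSmp p n) :
    Fin (p.1.1.unop.len + 1) →o Fin ((b.F.obj (Fin.last _)).len + 1) :=
  ordHom (b.t ≫ b.F.map (homOfLE (Fin.zero_le _)))

/-- The base and the `i'`-th last vertex both come from the simplex `F i'` of the chain, and there
the last vertex is maximal. Therefore the two sequences can be concatenated. -/
lemma baseVert_le_vert {n : SemiSimplexCategory} (b : BarSmp p n) (i) (i') :
    b.baseVert i ≤ b.vert i' := by
  have h : b.t ≫ b.F.map (homOfLE (Fin.zero_le (Fin.last _))) =
      (b.t ≫ b.F.map (homOfLE (Fin.zero_le i'))) ≫ b.F.map (homOfLE (Fin.le_last i')) := by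
    rw [Category.assoc, ← b.F.map_comp]
    rfl
  have h' := (congrArg ordHom h).trans (ordHom_comp (b.t ≫ b.F.map (homOfLE (Fin.zero_le i')))
    (b.F.map (homOfLE (Fin.le_last i'))))
  have e : b.baseVert = ordHom (b.t ≫ b.F.map (homOfLE (Fin.zero_le (Fin.last _)))) := rfl
  refine le_of_eq_of_le (DFunLike.congr_fun (e.trans h') i) ?_
  exact (ordHom (b.F.map (homOfLE (Fin.le_last i')))).monotone (Fin.le_last _)

lemma baseVert_face {n n' : SemiSimplexCategory} (f : Fin (n'.len + 1) →o Fin (n.len + 1))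
    (b : BarSmp p n) : (ordHom (b.F.map (homOfLE (Fin.le_last (f (Fin.last _)))))).comp
      (b.face f).baseVert = b.baseVert := by
  have h : ((b.t ≫ b.F.map (homOfLE (Fin.zero_le (f 0)))) ≫
      b.F.map (homOfLE (f.monotone (Fin.zero_le (Fin.last _))))) ≫
      b.F.map (homOfLE (Fin.le_last (f (Fin.last _)))) =
        b.t ≫ b.F.map (homOfLE (Fin.zero_le _)) := by
    rw [Category.assoc, Category.assoc, ← b.F.map_comp, ← b.F.map_comp]
    rfl
  exact (ordHom_comp _ _).symm.trans (congrArg ordHom h)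

lemma baseVert_push {p' : X.Elements} (φ : p ⟶ p') {n : SemiSimplexCategory} (b : BarSmp p n) :
    (b.push φ).baseVert = b.baseVert.comp (ordHom φ.1.1.unop) :=
  (congrArg ordHom (Category.assoc φ.1.1.unop b.t (b.F.map (homOfLE (Fin.zero_le _))))).trans
    (ordHom_comp _ _)

end BarSmp

variable {R : Type u} [Ring R] (T : X.Elements ⥤ CochainComplex (ModuleCat.{u} R) ℤ)

/-- The vertices of the base of a chain, followed by the last vertices of its simplices. -/
def joinVert {j m : ℕ} {x : Smp (underlying X) j} (b : Smp (bar (eqSmp x)) m) {N : ℕ}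
    (hN : N = j + m + 1) : Fin (N + 1) →o Fin (topDim b + 1) :=
  appendOrd hN (BarSmp.baseVert b) (BarSmp.vert b) (BarSmp.baseVert_le_vert b)

/-- The sign in the homotopy between the chains on the bar resolution and the chains. -/
def joinSign (j m : ℕ) (k : ℤ) : ℤ := k.negOnePow * (-1) ^ (j * (m + 1))

/-- The chains with values in the bar resolution. -/
noncomputable abbrev joinGen {j m : ℕ} {x : Smp (underlying X) j} (b : Smp (bar (eqSmp x)) m)
    {κ k n : ℤ} (hκ : κ = n + j) (hk : k = κ + m) (a : (T.obj (barEl b)).X k) :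
    Tot (inclElements X ⋙ resolutionObj T) n :=
  Tot.gen (K := inclElements X ⋙ resolutionObj T) x hκ (barGen T b hk a)

/-- The homotopy between the chains on the bar resolution and the chains. -/
noncomputable def joinHomotopy (n n' : ℤ) (h : n + 1 = n') :
    Tot (inclElements X ⋙ resolutionObj T) n' →ₗ[R] Tot (inclElements X ⋙ T) n :=
  Tot.lift fun j x κ hκ ↦ (Tot.lift fun m b k hk ↦ joinSign j m k •
    Tot.brk (K := inclElements X ⋙ T) (topSmp b) (joinVert b rfl) (by push_cast; lia) :
      Tot (barSystem T (eqSmp x)) κ →ₗ[R] Tot (inclElements X ⋙ T) n)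

lemma joinHomotopy_gen {n n' : ℤ} (h : n + 1 = n') {j m : ℕ} {x : Smp (underlying X) j}
    (b : Smp (bar (eqSmp x)) m)
    {κ k : ℤ} (hκ : κ = n' + j) (hk : k = κ + m) (a : (T.obj (barEl b)).X k) {N : ℕ}
    (hN : N = j + m + 1) :
    joinHomotopy T n n' h (joinGen T b hκ hk a) =
      joinSign j m k • topBrk T b (joinVert b hN) (n := n) (by push_cast [hN]; lia) a := by
  subst hN
  refine (Tot.lift_gen (K := inclElements X ⋙ resolutionObj T) _ _ _ _).trans ?_
  exact Tot.lift_gen (K := barSystem T (eqSmp x)) _ _ _ _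

/-- Passing to the `r`-th face of `x` precomposes the inclusion of the base into the chain, so the
join loses its `r`-th entry and the last vertices stay the same. -/
lemma joinHomotopy_genMap {n n' : ℤ} (h : n + 1 = n') {j m : ℕ} {x : Smp (underlying X) (j + 1)}
    (r : Fin (j + 2)) (b : Smp (bar (eqSmp x)) m)
    {κ k : ℤ} (hκ : κ = n' + j) (hk : k = κ + m) (a : (T.obj (barEl b)).X k) {N : ℕ}
    (hN : N + 1 = j + 1 + m + 1) :
    joinHomotopy T n n' h (Tot.genMap (K := inclElements X ⋙ resolutionObj T) (face r) x hκ
        (barGen T b hk a)) =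
      joinSign j m k • topBrk T b ((joinVert b hN).comp (faceOrd ⟨r, by omega⟩)) (n := n)
        (by lia) a := by
  let φ : eqSmp x ⟶ eqSmp ((underlying X).map (face r).op x) :=
    (inclElements X).map (X := smp x) (Y := smp ((underlying X).map (face r).op x))
      ⟨(face r).op, rfl⟩
  refine (congrArg (fun y ↦ joinHomotopy T n n' h (Tot.gen (K := inclElements X ⋙ resolutionObj T)
    ((underlying X).map (face r).op x) hκ y)) (resolutionPush_gen T φ b hk a)).trans ?_
  refine (joinHomotopy_gen T h (barPush φ b) hκ hk _ (N := N) (by omega)).trans ?_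
  refine congrArg (fun y ↦ joinSign j m k • y) ?_
  -- The group component of `φ` is the identity, so the translation introduced by the change of base
  -- acts trivially on chains.
  refine (chainsAct_topBrk T φ b (joinVert (barPush φ b) (by omega)) _ a).symm.trans ?_
  refine (ConcreteCategory.congr_hom (HomologicalComplex.congr_hom
    ((chainsObj T).map_id (SingleObj.star G)) n) _).trans ?_
  refine congrArg (fun t ↦ topBrk T b t _ a) ?_
  refine Eq.trans ?_ (appendOrd_face_left hN (BarSmp.baseVert b) (BarSmp.vert b)
    (BarSmp.baseVert_le_vert b) r ⟨r, by omega⟩ rfl).symm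
  have e : BarSmp.baseVert (barPush φ b) = (BarSmp.baseVert b).comp (faceOrd r) :=
    BarSmp.baseVert_push φ b
  have e' : BarSmp.vert (barPush φ b) = BarSmp.vert b := rfl
  exact appendOrd_congr _ e e' _ _

-- A face of the chain over `x` keeps the base and omits one last vertex, which has position `j + 1
-- + r` in the join.
attribute [local irreducible] BarSmp.baseVert BarSmp.vert in
lemma joinHomotopy_barGenMap {n n' : ℤ} (h : n + 1 = n') {j m : ℕ} {x : Smp (underlying X) j}
    (r : Fin (m + 2)) (b : Smp (bar (eqSmp x)) (m + 1))
    {κ k : ℤ} (hκ : κ = n' + j) (hk : k = κ + m) (a : (T.obj (barEl b)).X k) {N : ℕ}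
    (hN : N + 1 = j + (m + 1) + 1) :
    joinHomotopy T n n' h (Tot.gen (K := inclElements X ⋙ resolutionObj T) x hκ
        (Tot.genMap (K := barSystem T (eqSmp x)) (face r) b hk a)) =
      joinSign j m k • topBrk T b ((joinVert b hN).comp (faceOrd ⟨j + 1 + r, by omega⟩)) (n := n)
        (by lia) a := by
  refine (congrArg (fun y ↦ joinHomotopy T n n' h (Tot.gen (K := inclElements X ⋙ resolutionObj T)
    x hκ y)) (genMap_barSystem T (face r) b hk a)).trans ?_
  refine (joinHomotopy_gen T h _ hκ hk _ (N := N) (by omega)).trans ?_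
  refine congrArg (fun y ↦ joinSign j m k • y) ?_
  refine (topBrk_face T (face r) b _ _ a).trans ?_
  refine congrArg (fun t ↦ topBrk T b t _ a) ?_
  refine (comp_appendOrd _ _ _ _ _).trans ?_
  refine Eq.trans ?_ (appendOrd_face_right hN (BarSmp.baseVert b) (BarSmp.vert b)
    (BarSmp.baseVert_le_vert b) r ⟨j + 1 + r, by omega⟩ rfl).symm
  exact appendOrd_congr _ (BarSmp.baseVert_face (ordHom (face r)) b)
    (BarSmp.vert_face (ordHom (face r)) b) _ _

section

variable {j m : ℕ} {x : Smp (underlying X) j} (b : Smp (bar (eqSmp x)) m) {N : ℕ}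
  (hN : N + 1 = j + m + 1)

/-- The alternating sum over the faces that omit a vertex of the base. -/
noncomputable def joinLeft {k n : ℤ} (hk : k = n + N) (a : (T.obj (barEl b)).X k) :
    Tot (inclElements X ⋙ T) n :=
  ∑ r : Fin (j + 1), (-1 : ℤ) ^ (r : ℕ) •
    topBrk T b ((joinVert b hN).comp (faceOrd ⟨r, by omega⟩)) hk a

/-- The alternating sum over the faces that omit a last vertex. -/
noncomputable def joinRight {k n : ℤ} (hk : k = n + N) (a : (T.obj (barEl b)).X k) :
    Tot (inclElements X ⋙ T) n :=
  ∑ r : Fin (m + 1), (-1 : ℤ) ^ (r : ℕ) •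
    topBrk T b ((joinVert b hN).comp (faceOrd ⟨j + 1 + r, by omega⟩)) hk a

lemma diff_topBrk_joinVert {n n' : ℤ} (h : n + 1 = n') {k : ℤ} (hk : k = n + (N + 1 : ℕ))
    (a : (T.obj (barEl b)).X k) :
    Tot.diff n n' h (topBrk T b (joinVert b hN) hk a) =
      topBrk T b (joinVert b hN) (k := k + 1) (n := n') (by lia)
        (((T.obj (barEl b)).d k (k + 1)).hom a) +
      (k.negOnePow : ℤ) • (joinLeft T b hN (n := n') (by push_cast at hk ⊢; lia) a +
        (-1 : ℤ) ^ (j + 1) • joinRight T b hN (by push_cast at hk ⊢; lia) a) := by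
  -- The `j + m + 2` entries of the join are the `j + 1` vertices of the base followed by the `m +
  -- 1` last vertices. The second block of faces acquires the sign `(-1) ^ (j + 1)`.
  rw [diff_topBrk_succ, sum_fin_split (show N + 2 = (j + 1) + (m + 1) by omega), joinRight,
    Finset.smul_sum]
  refine congrArg (fun y : Tot (inclElements X ⋙ T) n' ↦ _ + (k.negOnePow : ℤ) • (_ + y)) ?_
  refine Finset.sum_congr rfl fun r _ ↦ ?_
  rw [smul_smul, ← pow_add]

end

lemma joinLeft_zero {m : ℕ} {x : Smp (underlying X) 0} (b : Smp (bar (eqSmp x)) m)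
    (hN : m + 1 = 0 + m + 1) {k n : ℤ} (hk : k = n + m) (a : (T.obj (barEl b)).X k) :
    joinLeft T b hN hk a = topBrk T b (BarSmp.vert b) hk a := by
  rw [joinLeft, Fin.sum_univ_one]
  refine (one_smul ℤ _).trans (congrArg (fun t ↦ topBrk T b t hk a) ?_)
  exact appendOrd_face_zero _ _ _ _ _ rfl

lemma joinRight_zero {j : ℕ} {x : Smp (underlying X) j} (b : Smp (bar (eqSmp x)) 0)
    (hN : j + 1 = j + 0 + 1) {k n : ℤ} (hk : k = n + j) (a : (T.obj (barEl b)).X k) :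
    joinRight T b hN hk a = topBrk T b (BarSmp.baseVert b) hk a := by
  rw [joinRight, Fin.sum_univ_one]
  refine (one_smul ℤ _).trans (congrArg (fun t ↦ topBrk T b t hk a) ?_)
  exact appendOrd_face_last _ _ _ _ _ rfl

lemma joinHomotopy_bdry {n n' : ℤ} (h : n + 1 = n') {j m : ℕ} {x : Smp (underlying X) (j + 1)}
    (b : Smp (bar (eqSmp x)) m) {κ k : ℤ} (hκ : κ + 1 = n' + (j + 1 : ℕ)) (hk : k = κ + m)
    (a : (T.obj (barEl b)).X k) {N : ℕ} (hN : N + 1 = j + 1 + m + 1) :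
    joinHomotopy T n n' h (Tot.bdry (K := inclElements X ⋙ resolutionObj T) (j + 1) x κ hκ
        (barGen T b hk a)) =
      joinSign j m k • joinLeft T b hN (n := n) (by lia) a := by
  refine (congrArg (joinHomotopy T n n' h)
    (Tot.bdry_succ (K := inclElements X ⋙ resolutionObj T) x hκ (barGen T b hk a))).trans ?_
  rw [map_sum, joinLeft, Finset.smul_sum]
  refine Finset.sum_congr rfl fun r _ ↦ ?_
  rw [map_zsmul, smul_comm]
  exact congrArg (fun y ↦ (-1 : ℤ) ^ (r : ℕ) • y) (joinHomotopy_genMap T h r b _ hk a hN)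

lemma joinHomotopy_barBdry {n n' : ℤ} (h : n + 1 = n') {j m : ℕ} {x : Smp (underlying X) j}
    (b : Smp (bar (eqSmp x)) (m + 1)) {κ k : ℤ} (hκ : κ = n' + j) (hk : k + 1 = κ + (m + 1 : ℕ))
    (a : (T.obj (barEl b)).X k) {N : ℕ} (hN : N + 1 = j + (m + 1) + 1) :
    joinHomotopy T n n' h (Tot.gen (K := inclElements X ⋙ resolutionObj T) x hκ
        (Tot.bdry (K := barSystem T (eqSmp x)) (m + 1) b k hk a)) =
      joinSign j m k • joinRight T b hN (n := n) (by lia) a := by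
  refine (congrArg (fun y ↦ joinHomotopy T n n' h
    (Tot.gen (K := inclElements X ⋙ resolutionObj T) x hκ y))
    (Tot.bdry_succ (K := barSystem T (eqSmp x)) b hk a)).trans ?_
  refine (congrArg (joinHomotopy T n n' h) (map_sum _ _ _)).trans ?_
  rw [map_sum, joinRight, Finset.smul_sum]
  refine Finset.sum_congr rfl fun r _ ↦ ?_
  refine (congrArg (joinHomotopy T n n' h) (map_zsmul _ _ _)).trans ?_
  rw [map_zsmul, smul_comm]
  exact congrArg (fun y ↦ (-1 : ℤ) ^ (r : ℕ) • y)
    (joinHomotopy_barGenMap T h r b hκ (by push_cast at hk; lia) a hN)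

lemma diff_joinGen {n n' : ℤ} (h : n + 1 = n') {j m : ℕ} {x : Smp (underlying X) j}
    (b : Smp (bar (eqSmp x)) m) {κ k : ℤ} (hκ : κ = n + j) (hk : k = κ + m)
    (a : (T.obj (barEl b)).X k) :
    Tot.diff n n' h (joinGen T b hκ hk a) =
      joinGen T b (κ := κ + 1) (k := k + 1) (n := n') (by lia) (by lia)
        (((T.obj (barEl b)).d k (k + 1)).hom a) +
      (k.negOnePow : ℤ) • Tot.gen (K := inclElements X ⋙ resolutionObj T) x (k := κ + 1) (n := n')
        (by lia) (Tot.bdry (K := barSystem T (eqSmp x)) (n := κ + 1) m b k (by lia) a) +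
      (κ.negOnePow : ℤ) • Tot.bdry (K := inclElements X ⋙ resolutionObj T) (n := n') j x κ
        (by lia) (barGen T b hk a) := by
  refine (Tot.diff_gen (K := inclElements X ⋙ resolutionObj T) h x hκ (barGen T b hk a)).trans ?_
  refine congrArg (fun y : Tot (inclElements X ⋙ resolutionObj T) n' ↦ y + _) ?_
  have e := (DFunLike.congr_fun (tot_d (barSystem T (eqSmp x)) (n := κ) (n' := κ + 1) rfl)
    (barGen T b hk a)).trans (Tot.diff_gen (K := barSystem T (eqSmp x)) rfl b hk a)
  refine (congrArg (Tot.gen (K := inclElements X ⋙ resolutionObj T) x (k := κ + 1) (n := n')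
    (by lia)) e).trans ?_
  refine (map_add _ _ _).trans (congrArg (fun y : Tot (inclElements X ⋙ resolutionObj T) n' ↦
    _ + y) (map_zsmul _ _ _))

lemma joinSign_succ (j m : ℕ) (k : ℤ) : joinSign j m (k + 1) = -joinSign j m k := by
  simp [joinSign, Int.negOnePow_succ]

lemma neg_one_pow_mul_self (a : ℕ) : (-1 : ℤ) ^ a * (-1) ^ a = 1 := by
  rw [← mul_pow, neg_one_mul, neg_neg, one_pow]

/-- The exponent `j * (m + 1)` grows by `j` with `m`. Together with the position sign `(-1) ^ (j +
1)` this leaves a minus sign, which cancels the faces of the chain. -/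
lemma joinSign_right (j m : ℕ) (k : ℤ) :
    joinSign j (m + 1) k * k.negOnePow * (-1) ^ (j + 1) + k.negOnePow * joinSign j m k = 0 := by
  have h := neg_one_pow_mul_self j
  rw [joinSign, joinSign, mul_add_one j (m + 1), pow_add, pow_succ]
  linear_combination (-(k.negOnePow : ℤ) * k.negOnePow * (-1) ^ (j * (m + 1))) * h

/-- Here the exponent grows by `m + 1` with `j`; the factor `(-1) ^ m` accounts for the difference
of the degrees `k` and `κ`, and the remaining sign cancels the faces of `x`. -/
lemma joinSign_left (j m : ℕ) {κ k : ℤ} (hk : k = κ + m) :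
    joinSign (j + 1) m k * k.negOnePow + κ.negOnePow * joinSign j m k = 0 := by
  have h := neg_one_pow_mul_self m
  have h' : (k.negOnePow : ℤ) = κ.negOnePow * (-1) ^ m := by
    rw [hk, Int.negOnePow_add, Units.val_mul, Int.coe_negOnePow_natCast]
  rw [joinSign, joinSign, add_one_mul j (m + 1), pow_add, pow_succ, h']
  linear_combination (-(κ.negOnePow : ℤ) * κ.negOnePow * (-1) ^ (j * (m + 1)) * (-1) ^ m) * h

lemma joinSign_zero (m : ℕ) (k : ℤ) : joinSign 0 m k * k.negOnePow = 1 := by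
  rw [joinSign, zero_mul, pow_zero, mul_one, negOnePow_mul_self]

lemma joinSign_right_zero (j : ℕ) (k : ℤ) : joinSign j 0 k * k.negOnePow * (-1) ^ (j + 1) = -1 := by
  have h := neg_one_pow_mul_self j
  have h' := negOnePow_mul_self k
  rw [joinSign, pow_succ, zero_add, mul_one]
  linear_combination (-(k.negOnePow : ℤ) * k.negOnePow) * h - h'

/-- The boundary of a join. Faces omitting a vertex of the base cancel against the boundary of `x`,
and faces omitting a last vertex cancel against the boundary of the bar resolution. The only
survivors occur when one factor is a single point: omitting it leaves the other factor alone. -/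
lemma joinHomotopy_diff {n n' n'' : ℤ} (h : n + 1 = n') (h' : n' + 1 = n'') {j m : ℕ}
    {x : Smp (underlying X) j} (b : Smp (bar (eqSmp x)) m) {κ k : ℤ} (hκ : κ = n' + j)
    (hk : k = κ + m) (a : (T.obj (barEl b)).X k) {N : ℕ} (hN : N + 1 = j + m + 1) :
    Tot.diff n n' h (joinHomotopy T n n' h (joinGen T b hκ hk a)) +
        joinHomotopy T n' n'' h' (Tot.diff n' n'' h' (joinGen T b hκ hk a)) =
      (if j = 0 then joinLeft T b hN (n := n') (by lia) a else 0) -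
        (if m = 0 then joinRight T b hN (n := n') (by lia) a else 0) := by
  rw [joinHomotopy_gen T h b hκ hk a hN, map_zsmul, diff_topBrk_joinVert, diff_joinGen, map_add,
    map_add, map_zsmul, map_zsmul, joinHomotopy_gen T h' b _ _ _ hN, joinSign_succ]
  have hA : (joinSign j m k * k.negOnePow) • joinLeft T b hN (n := n') (by lia) a +
      (κ.negOnePow : ℤ) • joinHomotopy T n' n'' h'
        (Tot.bdry (K := inclElements X ⋙ resolutionObj T) (n := n'') j x κ (by lia)
          (barGen T b hk a)) = if j = 0 then joinLeft T b hN (n := n') (by lia) a else 0 := by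
    obtain _ | j := j
    · rw [joinSign_zero, one_smul, if_pos rfl]
      exact (congrArg (fun y ↦ _ + (κ.negOnePow : ℤ) • y)
        (map_zero (joinHomotopy T n' n'' h'))).trans (by rw [smul_zero, add_zero])
    · rw [joinHomotopy_bdry T h' b _ hk a hN, smul_smul, ← add_smul, joinSign_left j m hk,
        zero_smul, if_neg (by simp)]
  have hB : (joinSign j m k * k.negOnePow * (-1) ^ (j + 1)) •
        joinRight T b hN (n := n') (by lia) a +
      (k.negOnePow : ℤ) • joinHomotopy T n' n'' h' (Tot.gen (K := inclElements X ⋙ resolutionObj T)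
        x (k := κ + 1) (n := n'') (by lia) (Tot.bdry (K := barSystem T (eqSmp x)) (n := κ + 1) m b k
          (by lia) a)) = -(if m = 0 then joinRight T b hN (n := n') (by lia) a else 0) := by
    obtain _ | m := m
    · rw [joinSign_right_zero, neg_one_smul, if_pos rfl]
      have e : joinHomotopy T n' n'' h' (Tot.gen (K := inclElements X ⋙ resolutionObj T)
          x (k := κ + 1) (n := n'') (by lia) (Tot.bdry (K := barSystem T (eqSmp x)) (n := κ + 1)
            0 b k (by lia) a)) = 0 :=
        (congrArg (joinHomotopy T n' n'' h') (map_zero _)).trans (map_zero _)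
      exact (congrArg (fun y ↦ -joinRight T b hN (n := n') (by lia) a + (k.negOnePow : ℤ) • y)
        e).trans (by rw [smul_zero, add_zero])
    · refine (congrArg (fun y ↦ _ + (k.negOnePow : ℤ) • y)
        (joinHomotopy_barBdry T h' b (κ := κ + 1) (k := k) (by lia) (by push_cast at hk ⊢; lia) a
          hN)).trans ?_
      rw [smul_smul, ← add_smul, joinSign_right, zero_smul, if_neg (by simp), neg_zero]
  rw [sub_eq_add_neg, ← hA, ← hB]
  simp only [smul_add, smul_smul, neg_smul, mul_assoc]
  abel

/-- The augmentation of a system of complexes that comes from the one-object category. -/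
noncomputable def constAug (V : SingleObj G ⥤ CochainComplex (ModuleCat.{u} R) ℤ) :
    inclElements X ⋙ toBG X ⋙ V ⟶ (Functor.const _).obj (V.obj (SingleObj.star G)) where
  app _ := 𝟙 _
  naturality p p' φ := by
    refine (Category.comp_id _).trans (Eq.trans ?_ (Category.id_comp _).symm)
    exact V.map_id _

lemma degCast_topBrk {m j : ℕ} (b : Smp (bar p) m) (t : Fin (j + 1) →o Fin (topDim b + 1))
    {k n n' : ℤ} (h : n = n') (hk : k = n + j) (a : (T.obj (barEl b)).X k) :
    degCast (tot (inclElements X ⋙ T)) h (topBrk T b t hk a) = topBrk T b t (h ▸ hk) a := by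
  subst h
  exact degCast_rfl _ _

/-- The augmentation sees only vertices `x`. Omitting such an `x` from the join leaves the sequence
of last vertices, which is the last-vertex map. -/
lemma chainsAug_joinGen {j m : ℕ} {x : Smp (underlying X) j} (b : Smp (bar (eqSmp x)) m) {κ k n : ℤ}
    (hκ : κ = n + j) (hk : k = κ + m) (a : (T.obj (barEl b)).X k) {N : ℕ} (hN : N + 1 = j + m + 1) :
    ((chainsMap (resolutionToChains T) ≫ totAug (constAug (X := X) (chainsObj T))).f n).hom
      (joinGen T b hκ hk a) = if j = 0 then joinLeft T b hN (n := n) (by lia) a else 0 := by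
  refine (congrArg ((totAug (constAug (X := X) (chainsObj T))).f n).hom
    ((chainsMap_gen (resolutionToChains T) x hκ (barGen T b hk a)).trans
      (congrArg (Tot.gen (K := inclElements X ⋙ toBG X ⋙ chainsObj T) x hκ)
        (barChain_gen T b hk a)))).trans ?_
  obtain _ | j := j
  · obtain rfl : N = m := by omega
    rw [if_pos rfl, joinLeft_zero]
    refine (totAug_gen_zero (constAug (X := X) (chainsObj T)) x hκ _).trans ?_
    exact degCast_topBrk T b (BarSmp.vert b) _ hk a
  · rw [if_neg (by simp)]
    exact totAug_gen_succ (constAug (X := X) (chainsObj T)) x hκ _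

/-- The augmentation sees only chains with one member. Omitting its last vertex from the join leaves
the base `x` as a face of the last simplex, with the coefficient restricted to it. -/
lemma chainsMap_resolutionAug_joinGen {j m : ℕ} {x : Smp (underlying X) j}
    (b : Smp (bar (eqSmp x)) m) {κ k n : ℤ} (hκ : κ = n + j) (hk : k = κ + m)
    (a : (T.obj (barEl b)).X k) {N : ℕ} (hN : N + 1 = j + m + 1) :
    ((chainsMap (resolutionAugNat T)).f n).hom
      (joinGen T b hκ hk a) = if m = 0 then joinRight T b hN (n := n) (by lia) a else 0 := by
  refine (chainsMap_gen (resolutionAugNat T) x hκ (barGen T b hk a)).trans ?_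
  obtain _ | m := m
  · obtain rfl : N = j := by omega
    rw [if_pos rfl, joinRight_zero]
    refine (congrArg (Tot.gen (K := inclElements X ⋙ T) x hκ)
      (resolutionAug_gen_zero T b hk a)).trans ?_
    refine (gen_degCast (K := inclElements X ⋙ T) x _ hκ _).trans ?_
    let φ : smp (topSmp b) ⟶ smp x :=
      ⟨(BarSmp.t b ≫ (BarSmp.F b).map (homOfLE (Fin.zero_le _))).op, BarSmp.map_top b⟩
    refine (Tot.gen_valMap (K := inclElements X ⋙ T) φ _ a).trans ?_
    exact (LinearMap.congr_fun
      (Tot.brk_ordHom (K := inclElements X ⋙ T) (topSmp b) φ.1.unop _) a).symm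
  · rw [if_neg (by simp)]
    exact (congrArg (Tot.gen (K := inclElements X ⋙ T) x hκ)
      (resolutionAug_gen_succ T b hk a)).trans (map_zero _)

/-- Followed by the augmentation, the map is homotopic by the join to the chains of
`resolutionAugNat`, which form a quasi-isomorphism because chains preserve them. Two out of three
then removes the augmentation. -/
lemma quasiIso_chainsMap_resolutionToChains
    (h : QuasiIso (totAug (constAug (X := X) (chainsObj T)))) :
    QuasiIso (chainsMap (resolutionToChains T)) := by
  have hq : QuasiIso (chainsMap (resolutionAugNat T)) :=
    quasiIso_chainsMap _ (quasiIso_resolutionAug T)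
  have : QuasiIso (chainsMap (resolutionToChains T) ≫
      totAug (constAug (X := X) (chainsObj T))) := by
    refine quasiIso_of_homotopy _ _ (joinHomotopy T) (fun n n' n'' h h' y ↦ ?_) hq
    let f := chainsMap (resolutionToChains T) ≫ totAug (constAug (X := X) (chainsObj T))
    let f' : Tot (inclElements X ⋙ resolutionObj T) n' →ₗ[R] Tot (inclElements X ⋙ T) n' :=
      (f.f n').hom
    let g' : Tot (inclElements X ⋙ resolutionObj T) n' →ₗ[R] Tot (inclElements X ⋙ T) n' :=
      ((chainsMap (resolutionAugNat T)).f n').hom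
    have key : Tot.diff n n' h ∘ₗ joinHomotopy T n n' h +
        joinHomotopy T n' n'' h' ∘ₗ Tot.diff n' n'' h' = f' - g' := by
      refine Tot.hom_ext fun j x κ hκ z ↦ ?_
      let φ : Tot (barSystem T (eqSmp x)) κ →ₗ[R] Tot (inclElements X ⋙ resolutionObj T) n' :=
        Tot.gen (K := inclElements X ⋙ resolutionObj T) x hκ
      suffices (Tot.diff n n' h ∘ₗ joinHomotopy T n n' h +
        joinHomotopy T n' n'' h' ∘ₗ Tot.diff n' n'' h') ∘ₗ φ = (f' - g') ∘ₗ φ from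
        LinearMap.congr_fun this z
      refine Tot.hom_ext fun m b k hk a ↦ ?_
      refine (joinHomotopy_diff T h h' b hκ hk a (N := j + m) rfl).trans ?_
      exact (congrArg₂ (fun x y : Tot (inclElements X ⋙ T) n' ↦ x - y)
        (chainsAug_joinGen T b hκ hk a rfl)
        (chainsMap_resolutionAug_joinGen T b hκ hk a rfl)).symm
    refine Eq.trans ?_ (LinearMap.congr_fun key y)
    exact congrArg₂ (fun x y ↦ x + y) (DFunLike.congr_fun (tot_d (inclElements X ⋙ T) h) _)
      (congrArg (joinHomotopy T n' n'' h')
        (DFunLike.congr_fun (tot_d (inclElements X ⋙ resolutionObj T) h') y))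
  exact quasiIso_of_comp_right _ (totAug (constAug (X := X) (chainsObj T)))

end

end MayerVietoris

namespace MayerVietoris

/-! ### Simplicial sets from chain complexes -/

section

variable (E : ℕ → Type u) [∀ j, AddCommGroup (E j)] (d : ∀ j, E (j + 1) →+ E j)

/-- Maps from the normalized chains of the nerve of an ordered set to a chain complex. -/
@[ext]
structure NormalizedMap (A : Type) [PartialOrder A] : Type u where
  /-- the value at a chain of elements -/
  toFun : ∀ j, (Fin (j + 1) →o A) → E j
  eq_zero : ∀ j (t : Fin (j + 1) →o A), ¬ Function.Injective t → toFun j t = 0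
  d_toFun : ∀ j (t : Fin (j + 1 + 1) →o A), d j (toFun (j + 1) t) =
    ∑ r : Fin (j + 2), (-1 : ℤ) ^ (r : ℕ) • toFun j (t.comp (faceOrd r))

variable {E d}

/-- The composition with a monotone map. -/
def NormalizedMap.precomp {A B : Type} [PartialOrder A] [PartialOrder B] (f : A →o B)
    (φ : NormalizedMap E d B) : NormalizedMap E d A where
  toFun j t := φ.toFun j (f.comp t)
  eq_zero j _ ht := φ.eq_zero j _ fun h ↦ ht (Function.Injective.of_comp h)
  d_toFun j t := φ.d_toFun j (f.comp t)

variable (E d) in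
/-- The simplicial set of maps from the normalized chains of simplices to a chain complex. -/
def normalizedSSet : SSet.{u} where
  obj n := NormalizedMap E d (Fin (n.unop.len + 1))
  map f := ↾ NormalizedMap.precomp f.unop.toOrderHom

lemma faceOrd_injective_right {n : ℕ} {r s : Fin (n + 2)} (h : faceOrd r = faceOrd s) : r = s :=
  Fin.succAbove_left_injective (funext fun i ↦ DFunLike.congr_fun h i)

lemma faceOrd_comp_faceOrd {n : ℕ} (s : Fin (n + 2)) (r : Fin (n + 3)) (h : (r : ℕ) ≤ s) :
    (faceOrd r).comp (faceOrd s) =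
      (faceOrd s.succ).comp (faceOrd (r.castLT (h.trans_lt s.is_lt))) :=
  congrArg SimplexCategory.Hom.toOrderHom (SimplexCategory.δ_comp_δ'' h).symm

lemma eq_faceOrd {n : ℕ} (t : Fin (n + 1) →o Fin (n + 2)) (ht : Function.Injective t)
    {i : Fin (n + 2)} (hi : ∀ a, t a ≠ i) : t = faceOrd i := by
  have h : StrictMono t := t.monotone.strictMono_of_injective ht
  have hr : Set.range t = Set.range (faceOrd i) := by
    have : Set.range (faceOrd i) = {i}ᶜ := Fin.range_succAbove i
    rw [this]
    refine Set.eq_of_subset_of_ncard_le (by rintro _ ⟨a, rfl⟩; exact hi a) ?_ (Set.toFinite _)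
    rw [Set.ncard_compl, Set.ncard_singleton, Set.ncard_range_of_injective ht]
    simp
  refine OrderHom.ext _ _ ?_
  exact (StrictMono.range_inj h (Fin.strictMono_succAbove i)).1 hr

lemma eq_id_of_injective {n : ℕ} (t : Fin (n + 1) →o Fin (n + 1)) (ht : Function.Injective t) :
    t = OrderHom.id := by
  refine OrderHom.ext _ _ ((StrictMono.range_inj (t.monotone.strictMono_of_injective ht)
    strictMono_id).1 ?_)
  rw [Set.range_id]
  exact Set.range_eq_univ.2 (Finite.surjective_of_injective ht)

/-- The only injective sequences outside the horn are the full simplex and its `i`-th face. The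
simplex gets the value `0`, which forces the value at the missing face; the boundary equation of
that face then follows from the simplicial identities. -/
lemma exists_horn_filler {n : ℕ} (i : Fin (n + 2)) (g : ∀ j, (Fin (j + 1) →o Fin (n + 2)) → E j)
    (hg₀ : ∀ j (t : Fin (j + 1) →o Fin (n + 2)), Set.range t ∪ {i} = Set.univ → g j t = 0)
    (hg₁ : ∀ j (t : Fin (j + 1) →o Fin (n + 2)), ¬ Function.Injective t → g j t = 0)
    (hg₂ : ∀ j (t : Fin (j + 1 + 1) →o Fin (n + 2)), Set.range t ∪ {i} ≠ Set.univ →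
      d j (g (j + 1) t) = ∑ r : Fin (j + 2), (-1 : ℤ) ^ (r : ℕ) • g j (t.comp (faceOrd r))) :
    ∃ φ : NormalizedMap E d (Fin (n + 2)),
      ∀ j (t : Fin (j + 1) →o Fin (n + 2)), Set.range t ∪ {i} ≠ Set.univ → φ.toFun j t = g j t := by
  classical
  -- The unique solution of the equation that the alternating sum over all faces of the simplex is
  -- `d 0 = 0`.
  let c : E n := -((-1 : ℤ) ^ (i : ℕ) • ∑ r ∈ {i}ᶜ, (-1 : ℤ) ^ (r : ℕ) • g n (faceOrd r))
  let φ : ∀ j, (Fin (j + 1) →o Fin (n + 2)) → E j :=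
    Function.update g n (Function.update (g n) (faceOrd i) c)
  have hφi : φ n (faceOrd i) = c := by simp [φ]
  have hφn (t : Fin (n + 1) →o Fin (n + 2)) (ht : t ≠ faceOrd i) : φ n t = g n t := by
    simp [φ, ht]
  have hφ (j : ℕ) (hj : j ≠ n) (t : Fin (j + 1) →o Fin (n + 2)) : φ j t = g j t := by
    simp [φ, hj]
  have hi : Set.range (faceOrd i) ∪ {i} = Set.univ := by
    have : Set.range (faceOrd i) = {i}ᶜ := Fin.range_succAbove i
    rw [this, Set.compl_union_self]
  have hφh (j : ℕ) (t : Fin (j + 1) →o Fin (n + 2)) (ht : Set.range t ∪ {i} ≠ Set.univ) :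
      φ j t = g j t := by
    by_cases hj : j = n
    · subst hj
      exact hφn t fun h ↦ ht (h ▸ hi)
    · exact hφ j hj t
  have hφ0 (j : ℕ) (t : Fin (j + 1) →o Fin (n + 2)) (ht : ¬ Function.Injective t) :
      φ j t = 0 := by
    by_cases hj : j = n
    · subst hj
      rw [hφn t fun h ↦ ht (h ▸ (Fin.succAboveOrderEmb i).injective), hg₁ _ _ ht]
    · rw [hφ j hj t, hg₁ _ _ ht]
  refine ⟨⟨φ, hφ0, fun j t ↦ ?_⟩, hφh⟩
  by_cases ht : Function.Injective t
  swap
  · rw [hφ0 _ t ht, map_zero, sum_faces_eq_zero (φ j) (hφ0 j) t ht]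
  by_cases hh : Set.range t ∪ {i} = Set.univ
  swap
  · rw [hφh _ _ hh, hg₂ _ _ hh]
    refine Finset.sum_congr rfl fun r _ ↦ ?_
    rw [hφh]
    intro h
    refine hh (Set.eq_univ_of_univ_subset (h.symm.subset.trans ?_))
    refine Set.union_subset_union_left {i} ?_
    rintro _ ⟨a, rfl⟩
    exact ⟨faceOrd r a, rfl⟩
  have hj₁ : j + 1 ≤ n + 1 := by
    have := Fintype.card_le_of_injective t ht
    simp at this
    lia
  have hj₂ : n ≤ j + 1 := by
    have h := Set.ncard_union_le (Set.range t) {i}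
    rw [hh, Set.ncard_univ, Set.ncard_range_of_injective ht, Set.ncard_singleton] at h
    simp at h
    lia
  -- An injective sequence whose range together with `i` is everything has `n + 2` or `n + 1`
  -- entries: it is the identity or the `i`-th face.
  obtain rfl | rfl : j = n ∨ n = j + 1 := by lia
  · obtain rfl := eq_id_of_injective t ht
    rw [hφ _ (by lia), hg₀ _ _ hh, map_zero, Fintype.sum_eq_add_sum_compl i]
    refine Eq.trans ?_ (congrArg₂ (fun x y : E j ↦ (-1 : ℤ) ^ (i : ℕ) • x + y) hφi.symm
      (Finset.sum_congr rfl fun r hr ↦ congrArg (fun x : E j ↦ (-1 : ℤ) ^ (r : ℕ) • x)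
        (hφn (faceOrd r) fun h ↦ by simp [faceOrd_injective_right h] at hr).symm))
    simp only [c]
    rw [smul_neg, smul_smul, ← pow_add, Even.neg_one_pow ⟨_, rfl⟩, one_smul, neg_add_cancel]
  · obtain rfl := eq_faceOrd t ht (i := i) (by
      rintro a rfl
      have : Set.range t = Set.univ := by
        rw [← hh, Set.union_singleton, Set.insert_eq_of_mem (Set.mem_range_self a)]
      have h := Fintype.card_le_of_surjective t (Set.range_eq_univ.1 this)
      simp at h)
    rw [hφi]
    simp only [hφ j (by lia)]
    -- The boundary of `c` consists of the double faces through all `r ≠ i`; as all double faces sum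
    -- to zero, it equals the sum of those through `i`.
    have key := sum_sum_alternating_eq_zero j (fun s r ↦ g j ((faceOrd r).comp (faceOrd s)))
      fun s r h ↦ congrArg (g j) (faceOrd_comp_faceOrd s r h)
    rw [Fintype.sum_eq_add_sum_compl i] at key
    have h₁ (r : Fin (j + 1 + 2)) (hr : r ≠ i) : d j (g (j + 1) (faceOrd r)) =
        ∑ s : Fin (j + 2), (-1 : ℤ) ^ (s : ℕ) • g j ((faceOrd r).comp (faceOrd s)) := by
      refine hg₂ j (faceOrd r) fun h ↦ ?_
      obtain ⟨a, ha⟩ | h := h.symm.subset (Set.mem_univ r)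
      · exact Fin.succAbove_ne r a ha
      · exact hr h
    have h₂ : ∑ r ∈ {i}ᶜ, (-1 : ℤ) ^ (r : ℕ) • d j (g (j + 1) (faceOrd r)) =
        ∑ r ∈ {i}ᶜ, ∑ s : Fin (j + 2), (-1 : ℤ) ^ ((s : ℕ) + r) •
          g j ((faceOrd r).comp (faceOrd s)) := by
      refine Finset.sum_congr rfl fun r hr ↦ ?_
      rw [h₁ r (by simpa using hr), Finset.smul_sum]
      simp only [smul_smul, ← pow_add, add_comm]
    simp only [c, map_neg, map_zsmul, map_sum]
    rw [h₂, ← neg_eq_of_add_eq_zero_right key]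
    simp only [pow_add, mul_comm _ ((-1 : ℤ) ^ (i : ℕ)), mul_smul, ← Finset.smul_sum]
    rw [smul_neg, neg_neg, smul_smul, ← pow_add, Even.neg_one_pow ⟨_, rfl⟩, one_smul]

end

/-! ### The Kan property -/

section

open Simplicial

variable (E : ℕ → Type u) [∀ j, AddCommGroup (E j)] (d : ∀ j, E (j + 1) →+ E j)

-- Fibrations are tested on horn inclusions. A map from a horn is recorded by its values on the
-- monotone sequences in the horn, extended by zero, and the filler of this function is a simplex by
-- the Yoneda lemma.
open SSet.modelCategoryQuillen in
instance : SSet.KanComplex (normalizedSSet E d) := by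
  classical
  refine (HomotopicalAlgebra.isFibrant_iff _).2 ⟨?_⟩
  rw [fibrations_eq]
  intro _ _ _ hf
  simp only [J, MorphismProperty.iSup_iff] at hf
  obtain ⟨n, ⟨i⟩⟩ := hf
  refine ⟨fun {t _} _ ↦ ?_⟩
  let x (j : ℕ) (σ : Fin (j + 1) →o Fin (n + 2)) : Δ[n + 1].obj (op ⦋j⦌) :=
    SSet.stdSimplex.objMk σ
  let s (j : ℕ) (σ : Fin (j + 1) →o Fin (n + 2)) (hσ : Set.range σ ∪ {i} ≠ Set.univ) :
      NormalizedMap E d (Fin (j + 1)) := t.app (op ⦋j⦌) ⟨x j σ, hσ⟩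
  have hs (j k : ℕ) (σ : Fin (j + 1) →o Fin (n + 2)) (τ : Fin (k + 1) →o Fin (j + 1))
      (hσ : Set.range σ ∪ {i} ≠ Set.univ) (hτ : Set.range (σ.comp τ) ∪ {i} ≠ Set.univ) :
      s k (σ.comp τ) hτ = (s j σ hσ).precomp τ := by
    have := ConcreteCategory.congr_hom (t.naturality (X := op ⦋j⦌) (Y := op ⦋k⦌)
      (Quiver.Hom.op (X := ⦋k⦌) (Y := ⦋j⦌) (SimplexCategory.Hom.mk τ))) ⟨x j σ, hσ⟩
    exact this
  let g (j : ℕ) (σ : Fin (j + 1) →o Fin (n + 2)) : E j :=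
    if hσ : Set.range σ ∪ {i} ≠ Set.univ then (s j σ hσ).toFun j OrderHom.id else 0
  have hg (j k : ℕ) (σ : Fin (j + 1) →o Fin (n + 2)) (τ : Fin (k + 1) →o Fin (j + 1))
      (hσ : Set.range σ ∪ {i} ≠ Set.univ) : g k (σ.comp τ) = (s j σ hσ).toFun k τ := by
    have hτ : Set.range (σ.comp τ) ∪ {i} ≠ Set.univ := fun h ↦ by
      refine hσ (Set.eq_univ_of_univ_subset (h.symm.subset.trans ?_))
      refine Set.union_subset_union_left {i} ?_
      rintro _ ⟨a, rfl⟩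
      exact ⟨τ a, rfl⟩
    refine (dif_pos hτ).trans ?_
    rw [hs j k σ τ hσ hτ]
    rfl
  obtain ⟨φ, hφ⟩ := exists_horn_filler (d := d) i g (fun j σ h ↦ dif_neg (not_not.2 h))
    (fun j σ h ↦ by
      by_cases hσ : Set.range σ ∪ {i} = Set.univ
      · exact dif_neg (not_not.2 hσ)
      · obtain ⟨a, ha⟩ := exists_eq_succ_of_not_injective σ h
        -- `τ` merges the two places at which `σ` repeats a value. Thus `σ = σ ∘ τ`, and the value
        -- at `σ` is that of a normalized map at the non-injective `τ`, hence zero.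
        let τ : Fin (j + 1) →o Fin (j + 1) := ⟨fun b ↦ if b = a.succ then a.castSucc else b, by
          intro b c hbc
          simp only [Fin.le_def, Fin.ext_iff, apply_ite Fin.val, Fin.val_succ,
            Fin.val_castSucc] at hbc ⊢
          split_ifs <;> lia⟩
        have hτ : σ.comp τ = σ := by
          refine OrderHom.ext _ _ (funext fun b ↦ ?_)
          by_cases hb : b = a.succ
          · exact (congrArg σ (if_pos hb)).trans (ha.trans (congrArg σ hb.symm))
          · exact congrArg σ (if_neg hb)
        refine (congrArg (g j) hτ.symm).trans ((hg j j σ τ hσ).trans ?_)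
        refine (s j σ hσ).eq_zero j τ fun h ↦ ?_
        have : a.succ = a.castSucc := h (by simp [τ, Fin.ext_iff])
        simp [Fin.ext_iff] at this)
    (fun j σ h ↦ by
      refine (congrArg (d j) (dif_pos h)).trans (((s _ σ h).d_toFun j OrderHom.id).trans ?_)
      exact Finset.sum_congr rfl fun r _ ↦ congrArg (fun x : E j ↦ (-1 : ℤ) ^ (r : ℕ) • x)
        (hg _ _ σ (faceOrd r) h).symm)
  refine ⟨⟨{
    l := SSet.yonedaEquiv.symm φ
    fac_left := ?_
    fac_right := by subsingleton }⟩⟩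
  ext m y
  refine NormalizedMap.ext (funext fun k ↦ funext fun τ ↦ ?_)
  obtain ⟨m⟩ := m
  obtain ⟨m⟩ := m
  obtain ⟨y, hy⟩ := y
  let σ : Fin (m + 1) →o Fin (n + 2) := SSet.stdSimplex.asOrderHom y
  change φ.toFun k (σ.comp τ) = (s m σ hy).toFun k τ
  rw [← hg m k σ τ hy]
  refine hφ k (σ.comp τ) fun h ↦ hy (Set.eq_univ_of_univ_subset (h.symm.subset.trans ?_))
  refine Set.union_subset_union_left {i} ?_
  rintro _ ⟨a, rfl⟩
  exact ⟨τ a, rfl⟩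

end

/-! ### Contraction of the integral chains of a contractible semi-simplicial set -/

section

open Simplicial AlgebraicTopology

variable (Y : SemiSimplexCategoryᵒᵖ ⥤ Type u)

/-- The integral chains of a semi-simplicial set. -/
abbrev FreeChains (m : ℕ) : Type u := FreeAbelianGroup (Smp Y m)

/-- The boundary of the integral chains. -/
noncomputable def freeBdry (m : ℕ) : FreeChains Y (m + 1) →+ FreeChains Y m :=
  FreeAbelianGroup.lift fun y ↦
    ∑ r : Fin (m + 2), (-1 : ℤ) ^ (r : ℕ) • FreeAbelianGroup.of (Y.map (face r).op y)

variable {Y}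

lemma freeBdry_of {m : ℕ} (y : Smp Y (m + 1)) : freeBdry Y m (FreeAbelianGroup.of y) =
    ∑ r : Fin (m + 2), (-1 : ℤ) ^ (r : ℕ) • FreeAbelianGroup.of (Y.map (face r).op y) :=
  FreeAbelianGroup.lift_apply_of _ _

open Classical in
/-- The integral chain given by a sequence of vertices of a simplex. -/
noncomputable def freeBrk {m j : ℕ} (y : Smp Y m) (t : Fin (j + 1) →o Fin (m + 1)) :
    FreeChains Y j :=
  if ht : Function.Injective t then FreeAbelianGroup.of (Y.map (injOf t ht).op y) else 0

lemma freeBrk_ordHom {m j : ℕ} (y : Smp Y m) (f : Inj j m) :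
    freeBrk y (ordHom f) = FreeAbelianGroup.of (Y.map f.op y) := by
  rw [freeBrk, dif_pos (ordHom_injective f), injOf_ordHom]

lemma freeBrk_map {m n j : ℕ} (y : Smp Y m) (f : Inj n m) (t : Fin (j + 1) →o Fin (n + 1)) :
    freeBrk (Y.map f.op y : Smp Y n) t = freeBrk y ((ordHom f).comp t) := by
  by_cases ht : Function.Injective t
  · rw [← ordHom_injOf t ht, ← ordHom_comp, freeBrk_ordHom, freeBrk_ordHom, op_comp, Y.map_comp]
    rfl
  · rw [freeBrk, dif_neg ht, freeBrk]
    rw [dif_neg]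
    exact fun h ↦ ht (Function.Injective.of_comp (f := ordHom f) h)

/-- The map from the normalized chains of a simplex given by a simplex. -/
noncomputable def freeBrkMap {m : ℕ} (y : Smp Y m) :
    NormalizedMap (FreeChains Y) (freeBdry Y) (Fin (m + 1)) where
  toFun _ t := freeBrk y t
  eq_zero _ _ ht := dif_neg ht
  d_toFun j t := by
    by_cases ht : Function.Injective t
    · rw [freeBrk, dif_pos ht, freeBdry_of]
      refine Finset.sum_congr rfl fun r _ ↦ ?_
      rw [← freeBrk_ordHom, freeBrk_map, ordHom_injOf, ordHom_face]
    · rw [freeBrk, dif_neg ht, map_zero,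
        sum_faces_eq_zero (fun t ↦ freeBrk y t) (fun _ ht ↦ dif_neg ht) t ht]

variable (Y) in
/-- The canonical map from a semi-simplicial set. -/
noncomputable def toNormalized :
    Y ⟶ SemiSimplexCategory.toSimplexCategory.op ⋙ normalizedSSet (FreeChains Y) (freeBdry Y) where
  app n := ↾ fun y ↦ freeBrkMap (m := n.unop.len) y
  naturality n n' f := by
    ext y
    exact NormalizedMap.ext (funext fun j ↦ funext fun t ↦ freeBrk_map (m := n.unop.len)
      (n := n'.unop.len) y f.unop t)

variable (Y) in
/-- The canonical map from the free simplicial set of a semi-simplicial set. -/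
noncomputable def freeToNormalized :
    freeSSet Y ⟶ normalizedSSet (FreeChains Y) (freeBdry Y) :=
  ((SemiSimplexCategory.toSimplexCategory.op.lanAdjunction _).homEquiv _ _).symm (toNormalized Y)

/-- A simplex as a simplex of the free simplicial set. -/
noncomputable def freeSmp {m : ℕ} (y : Smp Y m) : freeSSet Y _⦋m⦌ :=
  (SemiSimplexCategory.toSimplexCategory.op.lanUnit.app Y).app _ y

lemma freeSmp_face {m : ℕ} (r : Fin (m + 2)) (y : Smp Y (m + 1)) :
    (freeSSet Y).δ r (freeSmp y) = freeSmp (Y.map (face r).op y : Smp Y m) :=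
  (ConcreteCategory.congr_hom ((SemiSimplexCategory.toSimplexCategory.op.lanUnit.app Y).naturality
    (face r).op) y).symm

lemma freeToNormalized_freeSmp {m : ℕ} (y : Smp Y m) :
    (freeToNormalized Y).app (op ⦋m⦌) (freeSmp y) = freeBrkMap y := by
  have h := ((SemiSimplexCategory.toSimplexCategory.op.lanAdjunction _).homEquiv
    _ _).apply_symm_apply (toNormalized Y)
  have h' := ConcreteCategory.congr_hom (NatTrans.congr_app h (op (SemiSimplexCategory.mk m))) y
  refine Eq.trans ?_ h'
  rw [Adjunction.homEquiv_unit, Functor.lanAdjunction_unit]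
  rfl

/-- If there were no vertices, there would be no simplices, so the free simplicial set would map to
the empty Kan complex; contractibility would then give a vertex of the empty set. -/
lemma nonempty_of_isContractible (hc : IsContractible Y) : Nonempty (Smp Y 0) := by
  by_contra! h
  have hY (n : SemiSimplexCategoryᵒᵖ) : IsEmpty (Y.obj n) :=
    ⟨fun y ↦ h.false (Y.map (injOf ⟨fun _ ↦ 0, monotone_const⟩
      (Function.injective_of_subsingleton (α := Fin 1) _) :
        Inj 0 n.unop.len).op y)⟩
  let K : SSet.{u} := (Functor.const _).obj PEmpty
  -- A horn has at least one face, so there are no horns in the empty simplicial set.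
  have : SSet.KanComplex K := SSet.KanComplex.iff.2 fun n i f _ ↦ by
    obtain ⟨j, hj⟩ := exists_ne i
    exact ((f j hj).app (op ⦋n⦌) (SSet.stdSimplex.objMk OrderHom.id)).elim
  let f : freeSSet Y ⟶ K :=
    ((SemiSimplexCategory.toSimplexCategory.op.lanAdjunction _).homEquiv _ _).symm
      { app n := ↾ fun y ↦ ((hY n).false y).elim
        naturality n _ _ := by
          ext y
          exact ((hY n).false y).elim }
  obtain ⟨k, -⟩ := (hc K).1 f
  exact k.elim

section

variable {E : ℕ → Type u} [∀ j, AddCommGroup (E j)] {d : ∀ j, E (j + 1) →+ E j}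

variable (E d) in
/-- The value at the identity, on formal sums. -/
noncomputable def evalId (m : ℕ) : FreeAbelianGroup ((normalizedSSet E d) _⦋m⦌) →+ E m :=
  FreeAbelianGroup.lift fun φ ↦ φ.toFun m OrderHom.id

lemma evalId_of {m : ℕ} (φ : (normalizedSSet E d) _⦋m⦌) :
    evalId E d m (FreeAbelianGroup.of φ) = φ.toFun m OrderHom.id :=
  FreeAbelianGroup.lift_apply_of _ _

/-- The complex of integral chains of a simplicial set. -/
noncomputable abbrev freeComplex (X : SSet.{u}) : ChainComplex AddCommGrpCat.{u} ℕ :=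
  (alternatingFaceMapComplex _).obj
    (((SimplicialObject.whiskering _ _).obj AddCommGrpCat.free).obj X)

/-- The differential of the complex of integral chains of a simplicial set. -/
noncomputable def freeD (X : SSet.{u}) (m : ℕ) :
    FreeAbelianGroup (X _⦋m + 1⦌) →+ FreeAbelianGroup (X _⦋m⦌) :=
  ((freeComplex X).d (m + 1) m).hom

lemma freeD_of (X : SSet.{u}) {m : ℕ} (x : X _⦋m + 1⦌) : freeD X m (FreeAbelianGroup.of x) =
    ∑ r : Fin (m + 2), (-1 : ℤ) ^ (r : ℕ) • FreeAbelianGroup.of (X.δ r x) := by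
  have h : (freeComplex X).d (m + 1) m =
      ∑ r : Fin (m + 2), (-1 : ℤ) ^ (r : ℕ) • AddCommGrpCat.free.map (X.δ r) := by
    refine (alternatingFaceMapComplex_obj_d _ m).trans ?_
    rfl
  refine (congrArg (fun f : (AddCommGrpCat.free.obj (X _⦋m + 1⦌) ⟶
    AddCommGrpCat.free.obj (X _⦋m⦌)) ↦ f.hom (FreeAbelianGroup.of x)) h).trans ?_
  refine (congrArg (fun g : FreeAbelianGroup (X _⦋m + 1⦌) →+ FreeAbelianGroup (X _⦋m⦌) ↦
    g (FreeAbelianGroup.of x))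
    (map_sum AddCommGrpCat.homAddEquiv _ _)).trans ?_
  refine (AddMonoidHom.finsetSum_apply (M := FreeAbelianGroup (X _⦋m + 1⦌))
    (N := FreeAbelianGroup (X _⦋m⦌)) _ _ _).trans ?_
  refine Finset.sum_congr rfl fun r _ ↦ ?_
  refine congrArg (fun z : FreeAbelianGroup (X _⦋m⦌) ↦ (-1 : ℤ) ^ (r : ℕ) • z) ?_
  exact FreeAbelianGroup.map_of_apply _

/-- Evaluation at the identity sequence is a chain map: the defining boundary condition of a
normalized map, read at the identity, says exactly this. -/
lemma evalId_freeD {m : ℕ} (c : FreeAbelianGroup ((normalizedSSet E d) _⦋m + 1⦌)) :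
    evalId E d m (freeD _ m c) = d m (evalId E d (m + 1) c) := by
  suffices (evalId E d m).comp (freeD _ m) = (d m).comp (evalId E d (m + 1)) from
    DFunLike.congr_fun this c
  refine FreeAbelianGroup.lift_ext _ _ fun φ ↦ ?_
  rw [AddMonoidHom.comp_apply, AddMonoidHom.comp_apply, freeD_of, evalId_of, map_sum]
  simp only [map_zsmul]
  refine Eq.trans ?_ (NormalizedMap.d_toFun φ m OrderHom.id).symm
  exact Finset.sum_congr rfl fun r _ ↦ congrArg (fun z : E m ↦ (-1 : ℤ) ^ (r : ℕ) • z) (evalId_of _)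

/-- A simplicial homotopy becomes a chain homotopy on free abelian groups; evaluation at the
identity carries it to the complex `E`. The constant map survives only in degree 0. -/
lemma exists_chainHomotopy {X : SSet.{u}} {f : X ⟶ normalizedSSet E d}
    {k : (normalizedSSet E d) _⦋0⦌} (H : SSet.Homotopy f (SSet.const k)) :
    ∃ h : ∀ m, FreeAbelianGroup (X _⦋m⦌) →+ E (m + 1),
      (∀ x : X _⦋0⦌, (f.app (op ⦋0⦌) x).toFun 0 OrderHom.id =
        d 0 (h 0 (FreeAbelianGroup.of x)) + k.toFun 0 OrderHom.id) ∧
      ∀ (m : ℕ) (x : X _⦋m + 1⦌), (f.app (op ⦋m + 1⦌) x).toFun (m + 1) OrderHom.id =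
        h m (freeD X m (FreeAbelianGroup.of x)) +
          d (m + 1) (h (m + 1) (FreeAbelianGroup.of x)) := by
  let C := (H.toSimplicialObjectHomotopy.whiskerRight AddCommGrpCat.free).toChainHomotopy
  let h (m : ℕ) : FreeAbelianGroup (X _⦋m⦌) →+ FreeAbelianGroup ((normalizedSSet E d) _⦋m + 1⦌) :=
    (C.hom m (m + 1)).hom
  have hf (m : ℕ) (x : X _⦋m⦌) : evalId E d m (FreeAbelianGroup.map (f.app (op ⦋m⦌))
      (FreeAbelianGroup.of x)) = (f.app (op ⦋m⦌) x).toFun m OrderHom.id :=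
    (congrArg (evalId E d m) (FreeAbelianGroup.map_of_apply _)).trans (evalId_of _)
  have hg (m : ℕ) (x : X _⦋m⦌) : evalId E d m (FreeAbelianGroup.map
      ((SSet.const k : X ⟶ normalizedSSet E d).app (op ⦋m⦌)) (FreeAbelianGroup.of x)) =
      k.toFun m ((SimplexCategory.const ⦋m⦌ ⦋0⦌ 0).toOrderHom.comp OrderHom.id) :=
    (congrArg (evalId E d m) (FreeAbelianGroup.map_of_apply _)).trans (evalId_of _)
  refine ⟨fun m ↦ (evalId E d (m + 1)).comp (h m), fun x ↦ ?_, fun m x ↦ ?_⟩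
  · have := C.comm 0
    rw [Homotopy.dNext_zero_chainComplex, zero_add, Homotopy.prevD_chainComplex] at this
    have := congrArg (fun f : (AddCommGrpCat.free.obj (X _⦋0⦌) ⟶
      AddCommGrpCat.free.obj ((normalizedSSet E d) _⦋0⦌)) ↦ f.hom (FreeAbelianGroup.of x)) this
    refine (hf 0 x).symm.trans ((congrArg (evalId E d 0) this).trans ?_)
    refine (map_add (evalId E d 0) (freeD _ 0 (h 0 (FreeAbelianGroup.of x)))
      (FreeAbelianGroup.map ((SSet.const k : X ⟶ normalizedSSet E d).app (op ⦋0⦌))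
        (FreeAbelianGroup.of x))).trans (congrArg₂ (· + ·) (evalId_freeD _) ((hg 0 x).trans ?_))
    exact congrArg (k.toFun 0) (OrderHom.ext _ _ (funext fun _ ↦
      Subsingleton.elim (α := Fin 1) _ _))
  · have := C.comm (m + 1)
    rw [Homotopy.dNext_succ_chainComplex, Homotopy.prevD_chainComplex] at this
    have := congrArg (fun f : (AddCommGrpCat.free.obj (X _⦋m + 1⦌) ⟶
      AddCommGrpCat.free.obj ((normalizedSSet E d) _⦋m + 1⦌)) ↦ f.hom (FreeAbelianGroup.of x)) this
    refine (hf (m + 1) x).symm.trans ((congrArg (evalId E d (m + 1)) this).trans ?_)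
    refine (map_add (evalId E d (m + 1)) (h m (freeD X m (FreeAbelianGroup.of x)) +
      freeD _ (m + 1) (h (m + 1) (FreeAbelianGroup.of x)))
      (FreeAbelianGroup.map ((SSet.const k : X ⟶ normalizedSSet E d).app (op ⦋m + 1⦌))
        (FreeAbelianGroup.of x))).trans ?_
    refine (congrArg₂ (· + ·) ((map_add _ _ _).trans (congrArg₂ (· + ·) rfl (evalId_freeD _)))
      ((hg (m + 1) x).trans ?_)).trans (add_zero _)
    -- In positive degree the constant map evaluates `k` at a sequence of equal entries, where a
    -- normalized map vanishes.
    refine k.eq_zero (m + 1) _ fun hinj ↦ ?_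
    exact absurd (hinj (Subsingleton.elim (α := Fin 1) _ _) : (0 : Fin (m + 2)) = 1) (by simp)

end

/-- Applied to the tautological map to `normalizedSSet` of the integral chains, evaluation at the
identity returns the simplex itself, so a null-homotopy of this map contracts the chains onto the
single class `κ`. -/
lemma exists_contraction (hc : IsContractible Y) :
    ∃ (κ : FreeChains Y 0) (h : ∀ m, FreeChains Y m →+ FreeChains Y (m + 1)),
      (∀ y : Smp Y 0, FreeAbelianGroup.of y = freeBdry Y 0 (h 0 (FreeAbelianGroup.of y)) + κ) ∧
      ∀ (m : ℕ) (y : Smp Y (m + 1)), FreeAbelianGroup.of y =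
        h m (freeBdry Y m (FreeAbelianGroup.of y)) +
          freeBdry Y (m + 1) (h (m + 1) (FreeAbelianGroup.of y)) := by
  obtain ⟨k, ⟨H⟩⟩ := (hc (normalizedSSet (FreeChains Y) (freeBdry Y))).1 (freeToNormalized Y)
  obtain ⟨h, h₀, h₁⟩ := exists_chainHomotopy H
  have hf {m : ℕ} (y : Smp Y m) : ((freeToNormalized Y).app (op ⦋m⦌) (freeSmp y)).toFun m
      OrderHom.id = FreeAbelianGroup.of y := by
    rw [freeToNormalized_freeSmp]
    refine (freeBrk_ordHom y (𝟙 _)).trans ?_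
    rw [op_id, Y.map_id]
    rfl
  refine ⟨k.toFun 0 OrderHom.id, fun m ↦ FreeAbelianGroup.lift fun y ↦
    h m (FreeAbelianGroup.of (freeSmp y)), fun y ↦ ?_, fun m y ↦ ?_⟩
  · rw [FreeAbelianGroup.lift_apply_of, ← h₀, hf]
  · rw [FreeAbelianGroup.lift_apply_of]
    refine (hf y).symm.trans ((h₁ m (freeSmp y)).trans ?_)
    rw [ freeBdry_of, freeD_of]
    simp only [map_sum, map_zsmul, FreeAbelianGroup.lift_apply_of, freeSmp_face]

end

/-! ### Constant systems over a contractible semi-simplicial set -/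

section

variable {R : Type u} [Ring R] {Y : SemiSimplexCategoryᵒᵖ ⥤ Type u}
  {L : CochainComplex (ModuleCat.{u} R) ℤ}

variable (Y L) in
/-- The total complex of a constant system. -/
abbrev ConstTot (n : ℤ) : Type u := Tot ((Functor.const Y.Elements).obj L) n

variable (L) in
/-- The elements of the total complex of a constant system given by integral chains. -/
noncomputable def chainLin {j : ℕ} {k n : ℤ} (hk : k = n + j) :
    FreeChains Y j →+ (L.X k →ₗ[R] ConstTot Y L n) :=
  FreeAbelianGroup.lift fun y ↦ Tot.gen (K := (Functor.const Y.Elements).obj L) y hk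

lemma chainLin_of {j : ℕ} {k n : ℤ} (hk : k = n + j) (y : Smp Y j) :
    chainLin L hk (FreeAbelianGroup.of y) =
      Tot.gen (K := (Functor.const Y.Elements).obj L) y hk :=
  FreeAbelianGroup.lift_apply_of _ _

lemma diff_chainLin_zero {n n' : ℤ} (h : n + 1 = n') {k : ℤ} (hk : k = n + (0 : ℕ))
    (c : FreeChains Y 0) (a : L.X k) : Tot.diff n n' h (chainLin L hk c a) =
      chainLin L (k := k + 1) (n := n') (by lia) c ((L.d k (k + 1)).hom a) := by
  induction c using FreeAbelianGroup.induction_on with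
  | zero => simp
  | of y =>
    rw [chainLin_of, chainLin_of, Tot.diff_gen]
    simp only [Tot.bdry, LinearMap.zero_apply, smul_zero, add_zero]
    rfl
  | neg y ih => simpa using ih
  | add c c' hc hc' => simp only [map_add, LinearMap.add_apply, hc, hc']

lemma diff_chainLin_succ {n n' : ℤ} (h : n + 1 = n') {j : ℕ} {k : ℤ} (hk : k = n + (j + 1 : ℕ))
    (c : FreeChains Y (j + 1)) (a : L.X k) : Tot.diff n n' h (chainLin L hk c a) =
      chainLin L (k := k + 1) (n := n') (by lia) c ((L.d k (k + 1)).hom a) +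
        (k.negOnePow : ℤ) • chainLin L (n := n') (by push_cast at hk; lia) (freeBdry Y j c) a := by
  induction c using FreeAbelianGroup.induction_on with
  | zero => simp
  | of y =>
    rw [chainLin_of, chainLin_of, Tot.diff_gen, Tot.bdry_succ, freeBdry_of, map_sum,
      LinearMap.sum_apply]
    simp only [map_zsmul, LinearMap.smul_apply, chainLin_of]
    rfl
  | neg y ih => simp only [map_neg, LinearMap.neg_apply, ih, neg_add, smul_neg]
  | add c c' hc hc' => 
    simp only [map_add, LinearMap.add_apply, hc, hc', smul_add]
    abel

/-- The contraction of the total complex of a constant system. -/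
noncomputable def chainHomotopy (L : CochainComplex (ModuleCat.{u} R) ℤ)
    (s : ∀ m, FreeChains Y m →+ FreeChains Y (m + 1)) (n n' : ℤ) (h : n + 1 = n') :
    ConstTot Y L n' →ₗ[R] ConstTot Y L n :=
  Tot.lift fun m y k hk ↦ (k.negOnePow : ℤ) •
    chainLin L (j := m + 1) (n := n) (by push_cast; lia) (s m (FreeAbelianGroup.of y))

lemma chainHomotopy_chainLin (s : ∀ m, FreeChains Y m →+ FreeChains Y (m + 1)) {n n' : ℤ}
    (h : n + 1 = n') {m : ℕ} (c : FreeChains Y m) {k : ℤ} (hk : k = n' + m) (a : L.X k) :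
    chainHomotopy L s n n' h (chainLin L hk c a) = (k.negOnePow : ℤ) •
      chainLin L (j := m + 1) (n := n) (by push_cast; lia) (s m c) a := by
  induction c using FreeAbelianGroup.induction_on with
  | zero => simp
  | of y =>
    rw [chainLin_of]
    exact Tot.lift_gen (K := (Functor.const Y.Elements).obj L) _ _ _ _
  | neg y ih => simpa using ih
  | add c c' hc hc' => simp only [map_add, LinearMap.add_apply, hc, hc', smul_add]

/-- The integral contraction, combined with the sign `(-1) ^ k`, shows that each cycle is homologous
to `κ` times its augmentation. As `κ` need not be a vertex, the splitting uses a vertex `y₀`, and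
the formula is applied twice to compare the two. -/
lemma quasiIso_totAug_const (hc : IsContractible Y) (L : CochainComplex (ModuleCat.{u} R) ℤ) :
    QuasiIso (totAug (𝟙 ((Functor.const Y.Elements).obj L))) := by
  obtain ⟨y₀⟩ := nonempty_of_isContractible hc
  obtain ⟨κ, s, h₀, h₁⟩ := exists_contraction hc
  let ζ := 𝟙 ((Functor.const Y.Elements).obj L)
  have hd {n n' : ℤ} (h : n + 1 = n') (y : ConstTot Y L n) :
      ((tot ((Functor.const Y.Elements).obj L)).d n n').hom y = Tot.diff n n' h y :=
    DFunLike.congr_fun (tot_d ((Functor.const Y.Elements).obj L) h) y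
  have haug {n : ℤ} (y : Smp Y 0) (z : L.X n) :
      Tot.aug ζ n (Tot.gen y (k := n) (by simp) z) = z :=
    (Tot.aug_gen_zero ζ y (by simp) z).trans (degCast_rfl L z)
  have key {n n' n'' : ℤ} (h : n + 1 = n') (h' : n' + 1 = n'') (y : ConstTot Y L n') :
      Tot.diff n n' h (chainHomotopy L s n n' h y) +
        chainHomotopy L s n' n'' h' (Tot.diff n' n'' h' y) +
        chainLin L (k := n') (n := n') (j := 0) (by simp) κ (Tot.aug ζ n' y) = y := by
    suffices Tot.diff n n' h ∘ₗ chainHomotopy L s n n' h +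
        chainHomotopy L s n' n'' h' ∘ₗ Tot.diff n' n'' h' +
        chainLin L (k := n') (n := n') (j := 0) (by simp) κ ∘ₗ Tot.aug ζ n' = LinearMap.id from
      LinearMap.congr_fun this y
    refine Tot.hom_ext fun m y k hk a ↦ ?_
    have hsq (c : ConstTot Y L n') : (k.negOnePow : ℤ) • (k.negOnePow : ℤ) • c = c := by
      rw [smul_smul, Int.units_coe_mul_self, one_smul]
    have hgen : Tot.gen y hk a = chainLin L hk (FreeAbelianGroup.of y) a := by rw [chainLin_of]
    simp only [LinearMap.add_apply, LinearMap.comp_apply, LinearMap.id_apply]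
    obtain _ | m := m
    · obtain rfl : k = n' := by simpa using hk
      rw [haug, hgen, chainHomotopy_chainLin, map_zsmul, diff_chainLin_succ, diff_chainLin_zero,
        chainHomotopy_chainLin, Int.negOnePow_succ, smul_add, hsq, Units.val_neg, neg_smul,
        add_neg_cancel_comm, ← LinearMap.add_apply, ← map_add, ← h₀]
    · have : Tot.aug ζ n' (Tot.gen y hk a) = 0 := Tot.aug_gen_succ ζ y hk a
      rw [this, map_zero, add_zero, hgen, chainHomotopy_chainLin, map_zsmul, diff_chainLin_succ,
        diff_chainLin_succ, map_add, map_zsmul, chainHomotopy_chainLin, chainHomotopy_chainLin,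
        Int.negOnePow_succ, smul_add, hsq, hsq, Units.val_neg, neg_smul,
        add_comm (_ • _), add_assoc, add_neg_cancel_left, ← LinearMap.add_apply, ← map_add]
      exact congrArg (fun c ↦ chainLin L hk c a) ((add_comm _ _).trans (h₁ m y).symm)
  refine quasiIso_of_contraction _ (fun n ↦ Tot.gen (K := (Functor.const Y.Elements).obj L)
    y₀ (k := n) (by simp)) ?_ ?_ ?_
  · rintro n n' rfl z
    refine (hd rfl _).trans ?_
    have := diff_chainLin_zero (L := L) (n := n) rfl (by simp) (FreeAbelianGroup.of y₀) z
    rw [chainLin_of, chainLin_of] at this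
    exact this
  · exact fun n z ↦ haug y₀ z
  · intro n n' n'' h h' (y : ConstTot Y L n') hy
    let i : L.X n' →ₗ[R] ConstTot Y L n' :=
      Tot.gen (K := (Functor.const Y.Elements).obj L) y₀ (by simp)
    let z : L.X n' := Tot.aug ζ n' y
    have hy' : Tot.diff n' n'' h' y = 0 := (hd h' y).symm.trans hy
    have hz : (L.d n' n'').hom z = 0 := by
      have := ConcreteCategory.congr_hom ((totAug ζ).comm n' n'') y
      exact this.trans ((congrArg ((totAug ζ).f n'').hom hy).trans (map_zero _))
    have hiz : Tot.diff n' n'' h' (i z) = 0 := by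
      obtain rfl := h'
      have := diff_chainLin_zero (L := L) (n := n') rfl (by simp) (FreeAbelianGroup.of y₀) z
      rw [chainLin_of, chainLin_of] at this
      exact this.trans ((congrArg _ hz).trans (map_zero _))
    -- `y` and `i z` are cycles with the same augmentation `z`, so the terms in `κ` cancel in the
    -- difference of the two formulas.
    have e₁ := key h h' y
    have e₂ := key h h' (i z)
    rw [hy', map_zero, add_zero] at e₁
    rw [hiz, map_zero, add_zero, haug y₀ z] at e₂
    refine ⟨chainHomotopy L s n n' h y - chainHomotopy L s n n' h (i z), ?_⟩
    refine Eq.trans ?_ (congrArg (fun w : ConstTot Y L n' ↦ i z + w) (hd h _).symm)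
    rw [map_sub, eq_sub_of_add_eq e₁, eq_sub_of_add_eq e₂]
    abel

/-- The augmentation factors through the constant system with value `L`: the first map is a
quasi-isomorphism because total complexes preserve them, the second by contractibility. -/
lemma quasiIso_totAug {K : Y.Elements ⥤ CochainComplex (ModuleCat.{u} R) ℤ}
    (ζ : K ⟶ (Functor.const _).obj L) (hζ : ∀ p, QuasiIso (ζ.app p)) (hc : IsContractible Y) :
    QuasiIso (totAug ζ) := by
  have h : totAug ζ = totMap (𝟙 Y) (overId ζ) ≫ totAug (𝟙 ((Functor.const Y.Elements).obj L)) := by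
    refine tot_hom_ext fun n m x k hk a ↦ Eq.trans ?_
      (congrArg ((totAug (𝟙 ((Functor.const Y.Elements).obj L))).f n).hom
        (Tot.mapId_gen ζ x hk a)).symm
    obtain _ | m := m
    · exact (totAug_gen_zero ζ x hk a).trans (totAug_gen_zero (𝟙 _) x hk _).symm
    · exact (totAug_gen_succ ζ x hk a).trans (totAug_gen_succ (𝟙 _) x hk _).symm
  have h₁ := quasiIso_totMap ζ hζ
  have h₂ := quasiIso_totAug_const hc L
  rw [h]
  infer_instance

lemma quasiIso_totAug_constAug {G : Type u} [Group G] {X : GSemiSimplicialSet G}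
    (hc : IsContractible (underlying X)) (V : SingleObj G ⥤ CochainComplex (ModuleCat.{u} R) ℤ) :
    QuasiIso (totAug (constAug (X := X) V)) :=
  quasiIso_totAug _ (fun _ ↦ inferInstanceAs (QuasiIso (𝟙 (V.obj (SingleObj.star G))))) hc

end

end MayerVietoris

/-! ### Chains and restriction on the level of smooth complexes -/

namespace MayerVietoris
section

variable {R : Type u} [Ring R] {G : Type u} [Group G] [TopologicalSpace G]
  {X : GSemiSimplicialSet G} (hX : HasOpenStabilizers X)

lemma quasiIso_smoothChains_map {K K' : CochainComplex (SmoothCoefficients R X) ℤ} (f : K ⟶ K')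
    (hf : QuasiIso f) : QuasiIso ((smoothChains R X hX).map f) := by
  rw [quasiIso_iff_pointwise] at hf ⊢
  exact fun _ ↦ quasiIso_chainsMap ((pointwise R (toBG X)).map f) hf

lemma quasiIso_restrictionComplex_map {V V' : CochainComplex (SmoothRep R G) ℤ} (f : V ⟶ V')
    (hf : QuasiIso f) : QuasiIso ((restrictionComplex R X).map f) := by
  rw [quasiIso_iff_pointwise] at hf ⊢
  exact fun _ ↦ hf (SingleObj.star G)

lemma quasiIso_chainsAug (hc : IsContractible (underlying X))
    (V : CochainComplex (SmoothRep R G) ℤ) : QuasiIso ((chainsAug R X hX).app V) := by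
  rw [quasiIso_iff_pointwise]
  exact fun _ ↦ quasiIso_totAug_constAug hc ((pointwise R (𝟭 (SingleObj G))).obj V)

lemma quasiIso_smoothChains_resolutionToChains (hc : IsContractible (underlying X))
    (K : CochainComplex (SmoothCoefficients R X) ℤ) :
    QuasiIso ((smoothChains R X hX).map ((smoothResolutionToChains X R hX).app K)) := by
  rw [quasiIso_iff_pointwise]
  exact fun _ ↦ quasiIso_chainsMap_resolutionToChains ((pointwise R (toBG X)).obj K)
    (quasiIso_totAug_constAug hc _)

end

end MayerVietoris

theorem mainTheorem6 (R : Type u) [Ring R]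
    (G : Type u) [Group G] [TopologicalSpace G] [IsTopologicalGroup G]
    (X : MayerVietoris.GSemiSimplicialSet G)
    (hX : MayerVietoris.HasOpenStabilizers X)
    (hc : MayerVietoris.IsContractible (MayerVietoris.underlying X))
    (MV : MayerVietoris.DerivedInfinityCategory (MayerVietoris.SmoothCoefficients R X))
    (DG : MayerVietoris.DerivedInfinityCategory (MayerVietoris.SmoothRep R G)) :
    ∃ (res : DG.obj ⟶ MV.obj) (α : MV.obj ⟶ DG.obj),
      MayerVietoris.IsInducedBy DG MV (MayerVietoris.restriction R X) res ∧
      MayerVietoris.IsLeftBousfieldLocalization α res := by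
  open MayerVietoris in
  exact exists_leftBousfieldLocalization MV.isLocalization DG.isLocalization
    (smoothResolutionAug X R hX) (smoothResolutionToChains X R hX) (chainsAug R X hX)
    (smoothResolutionToChains_triangle R hX) (quasiIso_smoothChains_map hX)
    quasiIso_restrictionComplex_map (quasiIso_smoothResolutionAug hX)
    (quasiIso_chainsAug hX hc) (quasiIso_smoothChains_resolutionToChains hX hc)
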